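/- Let $F$ be a number field with adele ring $\mathbb{A}$, let $n\ge 1$ and $G=GL(n)$ over $F$, and let $K=\prod_v K_v\subset G(\mathbb{A})$ be the standard maximal compact subgroup ($K_v=GL(n,\mathcal{O}_v)$, $O(n)$, $U(n)$ at finite, real, complex places). For a composition $(n_1,\dots,n_r)$ of $n$ (the *type*), the standard parabolic subgroup $P=M_PN_P$ of this type is the group of block upper triangular matrices, $M_P\simeq GL(n_1)\times\dots\times GL(n_r)$ being the block diagonal matrices and $N_P$ the unipotent radical. The Harish-Chandra map $H_P:G(\mathbb{A})\to\mathbb{R}^n$ is defined by the Iwasawa decomposition: if $g=muk$ with $m=(m_1,\dots,m_r)\in M_P(\mathbb{A})$, $u\in N_P(\mathbb{A})$, $k\in K$, then every coordinate of $H_P(g)$ in the $i$-th block equals $\frac{1}{n_i}\log|\det m_i|_{\mathbb{A}}$. For standard parabolics $P\subset Q$ let $e_1^*,\dots,e_n^*$ be the coordinate forms on $\mathbb{R}^n$ and put: * $\rho_P^Q=\frac12\sum(e_i^*-e_j^*)$, the sum being over the pairs $(i,j)$ with $i,j$ in the same block of $Q$ and $i$ in an earlier block of $P$ than $j$; * $\tau_P^Q$,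 the characteristic function of the $H$ such that $\langle e_i^*-e_{i+1}^*,H\rangle>0$ whenever $i,i+1$ lie in the same block of $Q$ but in different blocks of $P$; * $\chi_P^Q$, the characteristic function of the $H$ such that for every block $b$ of $Q$ the sum of the coordinates of $H$ over the first block of $P$ contained in $b$ is $\le 0$; * $F^P$, the characteristic function of the $g\in G(\mathbb{A})$ such that $\sup_{R,\delta}\langle\rho_R^P,H_R(\delta g)\rangle\le 0$, where $R$ runs over the standard parabolics contained in $P$ and $\delta$ over $R(F)\backslash P(F)$. For a standard parabolic $Q$ of $G$ and $g\in G(\mathbb{A})$ let $$E^Q(g)=\sum_{P\subset Q}\ \sum_{\delta\in P(F)\backslash Q(F)}F^P(\delta g)\,\tau_P^Q(H_P(\delta g))\,\chi_P^Q(H_P(\delta g)),$$ where $P$ runs over the standard parabolics contained in $Q$. In particular this defines $E^{G}$, and likewise $E^{GL(l)}$ on $GL(l,\mathbb{A})$ for every $l\ge1$. **Statement.** Let $P$ be a standard parabolic subgroup of $G$ of type $(n_1,\dots,n_r)$ and let $p\in P(\mathbb{A})$. Write $p=mu$ with $m=(m_1,\dots,m_r)\in M_P(\mathbb{A})\simeq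 GL(n_1,\mathbb{A})\times\dots\times GL(n_r,\mathbb{A})$ and $u\in N_P(\mathbb{A})$. Then $$E^P(p)\le E^G(p)\le E^{GL(n_1)}(m_1).$$ -/

import Mathlib

open scoped MatrixGroups ENNReal
open NumberField

noncomputable section

namespace Truncation

section Parabolics

variable {n : ℕ}

/-- The standard parabolic subgroup `P(R) ⊆ GL(n, R)` of type `c = (n₁, …, n_r)`: the block upper
triangular matrices. The map `c.index` sends a coordinate to the block which contains it. Every
standard parabolic subgroup of `GL(n)` has exactly one type, a composition of `n`. -/
def parabolic (c : Composition n) (R : Type*) [CommRing R] : Subgroup (GL (Fin n) R) where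
  carrier := {g | (g : Matrix (Fin n) (Fin n) R).BlockTriangular c.index}
  one_mem' := by
    simpa using! Matrix.blockTriangular_one
  mul_mem' := by
    intro a b ha hb
    simpa using! Matrix.BlockTriangular.mul ha hb
  inv_mem' := by
    intro a ha
    have : Invertible (a : Matrix (Fin n) (Fin n) R) := a.invertible
    have h : ((a : Matrix (Fin n) (Fin n) R)⁻¹).BlockTriangular c.index :=
      Matrix.blockTriangular_inv_of_blockTriangular (by simpa using! ha)
    simpa [Matrix.coe_units_inv] using! h

/-- The block diagonal embedding `GL(n₁, R) × ⋯ × GL(n_r, R) → GL(n, R)`, whose image is the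
Levi subgroup `M_P(R)` of the standard parabolic subgroup of type `c`. -/
def levi (c : Composition n) (R : Type*) [CommRing R] :
    (∀ i : Fin c.length, GL (Fin (c.blocksFun i)) R) →* GL (Fin n) R :=
  ((Units.map ((Matrix.reindexRingEquiv R c.blocksFinEquiv).toRingHom.comp
    (Matrix.blockDiagonal'RingHom (fun i : Fin c.length => Fin (c.blocksFun i)) R)).toMonoidHom)).comp
    (MulEquiv.piUnits (M := fun i : Fin c.length =>
      Matrix (Fin (c.blocksFun i)) (Fin (c.blocksFun i)) R)).symm.toMonoidHom

/-- The `R`-points `N_P(R)` of the unipotent radical of the standard parabolic subgroup of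
type `c`: the block upper triangular matrices whose diagonal blocks are identity matrices. -/
def unipotentRadical (c : Composition n) (R : Type*) [CommRing R] : Set (GL (Fin n) R) :=
  {g | ∀ i j, c.index j ≤ c.index i →
    (g : Matrix (Fin n) (Fin n) R) i j = (1 : Matrix (Fin n) (Fin n) R) i j}

/-- The simple roots `Δ_P^Q` of a standard parabolic `P ⊆ Q`, as linear forms on `a₀ = ℝⁿ`: the
roots `e_i^* - e_{i+1}^*` where `i` and `i + 1` lie in one block of `Q` but in two different blocks
of `P` (to be paired with vectors of `a_P ⊆ a₀`). -/
def simpleRoots (P Q : Composition n) : Set (Fin n → ℝ) :=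
  {α | ∃ i j : Fin n, (j : ℕ) = i + 1 ∧ Q.index i = Q.index j ∧ P.index i ≠ P.index j ∧
    α = Pi.single i 1 - Pi.single j 1}

/-- The half-sum `ρ_P^Q` of the roots of the diagonal torus in `N_P ∩ M_Q`, for `P ⊆ Q`. -/
def rho (P Q : Composition n) : Fin n → ℝ :=
  (1 / 2 : ℝ) • ∑ ij : Fin n × Fin n with
      Q.index ij.1 = Q.index ij.2 ∧ P.index ij.1 < P.index ij.2,
    (Pi.single ij.1 1 - Pi.single ij.2 1)

open scoped Classical in
/-- `τ_P^Q`, the characteristic function of `{H | ⟨α, H⟩ > 0 for all α ∈ Δ_P^Q}`. -/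
def tau (P Q : Composition n) (H : Fin n → ℝ) : ℝ≥0∞ :=
  if ∀ α ∈ simpleRoots P Q, 0 < α ⬝ᵥ H then 1 else 0

open scoped Classical in
/-- `χ_P^Q` for `P ⊆ Q`, the characteristic function of the `H ∈ a₀` such that, for every block `b`
of `Q`, the sum of the coordinates of `H` over the first of the blocks of `P` which make up `b`
is `≤ 0`. If `Q` is the full group, this says `⟨ϖ_P, H⟩ = (H₁ + ⋯ + H_{n₁}) / n₁ ≤ 0`. -/
def chi (P Q : Composition n) (H : Fin n → ℝ) : ℝ≥0∞ :=
  if ∀ b : Fin Q.length,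
      ∑ i : Fin n with
        P.index i = P.index (Q.embedding b ⟨0, Q.one_le_blocksFun b⟩), H i ≤ 0
    then 1 else 0

end Parabolics

section Adelic

variable (F : Type*) [Field F] [NumberField F]

/-- The adelic absolute value `|x| = ∏_v |x_v|_v` of an idele, with normalized local absolute
values: `|x|_v = ‖x‖` at a real place, `‖x‖²` at a complex place, and `|ϖ_v|_v = N(v)⁻¹` at a finite
place. -/
def ideleAbs (x : (AdeleRing (𝓞 F) F)ˣ) : ℝ :=
  (∏ v : InfinitePlace F, ‖(x : AdeleRing (𝓞 F) F).1 v‖ ^ v.mult) *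
    ∏ᶠ v : IsDedekindDomain.HeightOneSpectrum (𝓞 F), ‖(x : AdeleRing (𝓞 F) F).2 v‖

/-- The standard maximal compact subgroup `K` of `GL(n, 𝔸)`: at a finite place `v` the component
is in `GL(n, 𝓞_v)`, at a real place it is orthogonal and at a complex place it is unitary. -/
def maxCompact (n : ℕ) : Set (GL (Fin n) (AdeleRing (𝓞 F) F)) :=
  {k | (∀ (v : IsDedekindDomain.HeightOneSpectrum (𝓞 F)) (i j : Fin n),
        ((k : Matrix (Fin n) (Fin n) (AdeleRing (𝓞 F) F)) i j).2 v ∈ v.adicCompletionIntegers F ∧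
        ((k⁻¹ : GL (Fin n) (AdeleRing (𝓞 F) F)).val i j).2 v ∈ v.adicCompletionIntegers F) ∧
      ∀ v : InfinitePlace F,
        (Matrix.of fun i j : Fin n => InfinitePlace.Completion.extensionEmbedding v
            (((k : Matrix (Fin n) (Fin n) (AdeleRing (𝓞 F) F)) i j).1 v))
          ∈ Matrix.unitaryGroup (Fin n) ℂ}

variable {F} {n : ℕ}

/-- The vector `H_P(m) ∈ a_P ⊆ a₀ = ℝⁿ` of `m = (m₁, …, m_r) ∈ M_P(𝔸)`, determined by
`⟨det_i, H_P(m)⟩ = log |det m_i|`: every coordinate in the `i`-th block is `log |det m_i| / n_i`. -/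
def leviHeight (P : Composition n)
    (m : ∀ i : Fin P.length, GL (Fin (P.blocksFun i)) (AdeleRing (𝓞 F) F)) : Fin n → ℝ :=
  fun j => Real.log (ideleAbs F (Matrix.GeneralLinearGroup.det (m (P.index j)))) /
    P.blocksFun (P.index j)

open scoped Classical in
/-- The Harish-Chandra map `H_P : GL(n, 𝔸) → a_P ⊆ a₀ = ℝⁿ`: one has `H_P(g) = H_P(m)` if `g = muk`
is an Iwasawa decomposition, `m ∈ M_P(𝔸)`, `u ∈ N_P(𝔸)`, `k ∈ K`. Such a decomposition exists and
`H_P(m)` does not depend on its choice, so that the value `0` is never used by default. -/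
def harishChandra (P : Composition n) (g : GL (Fin n) (AdeleRing (𝓞 F) F)) : Fin n → ℝ :=
  if h : ∃ m : ∀ i : Fin P.length, GL (Fin (P.blocksFun i)) (AdeleRing (𝓞 F) F),
      ∃ u ∈ unipotentRadical P (AdeleRing (𝓞 F) F), ∃ k ∈ maxCompact F n,
        g = levi P (AdeleRing (𝓞 F) F) m * u * k
    then leviHeight P h.choose else 0

/-- The diagonal embedding `GL(n, F) → GL(n, 𝔸)`. -/
def toAdelic (F : Type*) [Field F] [NumberField F] (n : ℕ) :
    GL (Fin n) F →* GL (Fin n) (AdeleRing (𝓞 F) F) :=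
  Matrix.GeneralLinearGroup.map (algebraMap F (AdeleRing (𝓞 F) F))

/-- The degree of instability `deg_i^Q(g)`, the supremum of `⟨ρ_P^Q, H_P(δg)⟩` over the standard
parabolics `P ⊆ Q` and `δ ∈ Q(F)`. As `H_P` is left `P(F)`-invariant, this is the supremum over
`δ ∈ P(F)\Q(F)`. -/
def instabilityDegree (Q : Composition n) (g : GL (Fin n) (AdeleRing (𝓞 F) F)) : EReal :=
  ⨆ (P : Composition n) (_ : parabolic P F ≤ parabolic Q F) (δ : parabolic Q F),
    ((rho P Q ⬝ᵥ harishChandra P (toAdelic F n δ * g) : ℝ) : EReal)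

open scoped Classical in
/-- `F^Q`, the characteristic function of the set of `g` with `deg_i^Q(g) ≤ 0`. -/
def semistable (Q : Composition n) (g : GL (Fin n) (AdeleRing (𝓞 F) F)) : ℝ≥0∞ :=
  if instabilityDegree Q g ≤ 0 then 1 else 0

/-- The quotient `P(F)\Q(F)`. -/
abbrev Cosets (F : Type*) [Field F] (P Q : Composition n) : Type _ :=
  Quotient (QuotientGroup.rightRel ((parabolic P F).subgroupOf (parabolic Q F)))

open scoped Classical in
/-- The truncation function
`E^Q(g) = ∑_{P ⊆ Q} ∑_{δ ∈ P(F)\Q(F)} F^P(δg) τ_P^Q(H_P(δg)) χ_P^Q(H_P(δg))`,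
where `P` runs over the standard parabolics contained in `Q`. The terms depend only on the class
of `δ`, and at most one of them is not zero; the sum is taken in `[0, ∞]`. -/
def truncation (Q : Composition n) (g : GL (Fin n) (AdeleRing (𝓞 F) F)) : ℝ≥0∞ :=
  ∑ P : Composition n with parabolic P F ≤ parabolic Q F, ∑' δ : Cosets F P Q,
    semistable P (toAdelic F n δ.out * g) *
      tau P Q (harishChandra P (toAdelic F n δ.out * g)) *
      chi P Q (harishChandra P (toAdelic F n δ.out * g))

/-- `E^G` for the full group `G = GL(n)`, `n ≥ 1`, the standard parabolic of type `(n)`. -/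
def truncationGL (hn : 0 < n) (g : GL (Fin n) (AdeleRing (𝓞 F) F)) : ℝ≥0∞ :=
  truncation (Composition.single n hn) g

end Adelic

end Truncation

end

/-! For `g` in `GL(n, 𝔸)` let `height g V` be the logarithm of the covolume of a subspace `V` of the
row space `F ^ n`, in the adelic metric defined by `g`. The partial sums of `H_P(δg)` over final
segments cut out by `P` are the heights of the subspaces spanned by the last rows of `δ`, so the
coordinates of `H_P(δg)` are slopes of a flag, and the cosets `P(F)\G(F)` are the flags of type `P`.
The key property is that the height is submodular (`height_inf_add_height_sup_le`), which comes from
the fact that minors of elements of `K` have absolute value at most one.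

In this language `F^P = 1` says that the steps of the flag are semistable, `τ_P^Q = 1` says that the
slopes decrease within each block of `Q`, and `χ_P^Q = 1` says that the first slope in each block of
`Q` is at most zero (`term_eq_ite`). Hence a nonzero term of `E^Q(g)` is a Harder-Narasimhan
filtration relative to the flag of `Q`, with all slopes nonpositive. Such a filtration is unique, so
`E^Q ≤ 1` (`truncation_le_one`).

For `Q = G` the filtration exists, and its largest slope is nonpositive exactly when the full space
has minimal height among all subspaces. So `E^G(g) = 1` if and only if `height g ⊤ ≤ height g Y` for
all `Y` (`one_le_truncationGL`, `height_top_le_of_truncation_ne_zero`).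

Both inequalities follow. If `E^P(p) ≠ 0`, each step of the standard flag of type `P` attains the
minimal height at its top; submodularity glues these statements along the flag, so `⊤` has minimal
height and `E^G(p) = 1`. If `E^G(p) ≠ 0`, one restricts the minimality of `⊤` to the subspaces
containing the coordinate subspace of the blocks after the first. These correspond to the subspaces
of `F ^ n₁`, and their heights for `p` and for `m₁` differ by a constant
(`height_top_le_of_height_top_le`), so `E^{GL(n₁)}(m₁) = 1`. -/

noncomputable section

namespace Truncation

/-! ### Local triangularization, and minors of unitary matrices. -/

section LocalIwasawa

/-- Integral column operations bring any matrix over a valued field to upper triangular form. -/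
theorem exists_integral_mul_upperTriangular {K : Type*} [Field K] (A : ValuationSubring K) {n : ℕ}
    (g : Matrix (Fin n) (Fin n) K) :
    ∃ κ κ' : Matrix (Fin n) (Fin n) K, κ * κ' = 1 ∧ (∀ i j, κ i j ∈ A) ∧ (∀ i j, κ' i j ∈ A) ∧
      ∀ i j, j < i → (g * κ) i j = 0 := by
  -- The rows are cleared from the bottom; `k` is the number of rows already in triangular form.
  suffices H : ∀ k ≤ n, ∃ κ κ' : Matrix (Fin n) (Fin n) K, κ * κ' = 1 ∧ (∀ i j, κ i j ∈ A) ∧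
      (∀ i j, κ' i j ∈ A) ∧ ∀ i j : Fin n, n ≤ i + k → j < i → (g * κ) i j = 0 by
    obtain ⟨κ, κ', h1, h2, h3, h4⟩ := H n le_rfl
    exact ⟨κ, κ', h1, h2, h3, fun i j => h4 i j (by omega)⟩
  have one_mem : ∀ i j : Fin n, (1 : Matrix (Fin n) (Fin n) K) i j ∈ A := by
    intro i j
    rw [Matrix.one_apply]
    split_ifs
    exacts [A.one_mem, A.zero_mem]
  intro k
  induction k with
  | zero => exact fun _ => ⟨1, 1, by simp, one_mem, one_mem, fun i j h => by omega⟩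
  | succ k ih =>
    intro hk
    obtain ⟨κ, κ', h1, h2, h3, h4⟩ := ih (by omega)
    let i₀ : Fin n := ⟨n - k - 1, by omega⟩
    have hi₀ : (i₀ : ℕ) = n - k - 1 := rfl
    by_cases hz : ∀ j ≤ i₀, (g * κ) i₀ j = 0
    · refine ⟨κ, κ', h1, h2, h3, fun i j hi hj => ?_⟩
      rcases eq_or_ne i i₀ with rfl | hne
      · exact hz j hj.le
      · exact h4 i j (by have : (i : ℕ) ≠ i₀ := fun h => hne (Fin.ext h)
                         omega) hj
    push Not at hz
    obtain ⟨j₁, hj₁, hne₁⟩ := hz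
    -- The pivot has maximal valuation among the entries to be cleared, so the elimination
    -- coefficients `c` are integral.
    obtain ⟨j₀, hj₀, hmax⟩ := Finset.exists_max_image (Finset.Iic i₀)
      (fun j => A.valuation ((g * κ) i₀ j)) ⟨j₁, by simpa using hj₁⟩
    simp only [Finset.mem_Iic] at hj₀ hmax
    have hne₀ : (g * κ) i₀ j₀ ≠ 0 := by
      intro h
      have := hmax j₁ hj₁
      rw [h, map_zero, le_zero_iff, map_eq_zero] at this
      exact hne₁ this
    let σ := Equiv.swap j₀ i₀
    have hσ : ∀ b ≤ i₀, σ b ≤ i₀ := by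
      intro b hb
      rw [Equiv.swap_apply_def]
      split_ifs
      exacts [le_rfl, hj₀, hb]
    let c : Fin n → K := fun b => if b < i₀ then (g * κ) i₀ (σ b) / (g * κ) i₀ j₀ else 0
    have hc : ∀ b, c b ∈ A := by
      intro b
      simp only [c]
      split_ifs with hb
      · rw [← A.valuation_le_one_iff, map_div₀]
        exact div_le_one_of_le₀ (hmax _ (hσ b hb.le)) zero_le
      · exact A.zero_mem
    let E : Matrix (Fin n) (Fin n) K := Matrix.vecMulVec (Pi.single i₀ 1) c
    have hE : ∀ i j, E i j ∈ A := by
      intro i j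
      simp only [E, Matrix.vecMulVec_apply]
      refine mul_mem ?_ (hc j)
      rw [Pi.single_apply]
      split_ifs
      exacts [A.one_mem, A.zero_mem]
    -- Since `c` vanishes at `i₀`, the matrix `E` has square zero and `1 - E` has the integral
    -- inverse `1 + E`.
    have hEE : E * E = 0 := by
      simp only [E, Matrix.vecMulVec_mul_vecMulVec]
      simp [c]
    let κ₁ := κ.submatrix id σ
    have hκ₁ : κ₁ * κ'.submatrix σ id = 1 := by
      simp only [κ₁]
      rw [Matrix.submatrix_mul_equiv, h1, Matrix.submatrix_one _ Function.injective_id]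
    have mat_mul_mem : ∀ M N : Matrix (Fin n) (Fin n) K, (∀ i j, M i j ∈ A) → (∀ i j, N i j ∈ A) →
        ∀ i j, (M * N) i j ∈ A := fun M N hM hN i j => by
      rw [Matrix.mul_apply]
      exact A.toSubring.sum_mem fun l _ => mul_mem (hM i l) (hN l j)
    refine ⟨κ₁ * (1 - E), (1 + E) * κ'.submatrix σ id, ?_, ?_, ?_, ?_⟩
    · rw [Matrix.mul_assoc, ← Matrix.mul_assoc (1 - E)]
      have : (1 - E) * (1 + E) = 1 := by
        rw [Matrix.sub_mul, Matrix.mul_add, Matrix.mul_add, hEE]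
        simp
      rw [this, Matrix.one_mul, hκ₁]
    · exact mat_mul_mem _ _ (fun i j => h2 _ _) fun i j => A.toSubring.sub_mem (one_mem i j) (hE i j)
    · exact mat_mul_mem _ _ (fun i j => A.toSubring.add_mem (one_mem i j) (hE i j)) fun i j => h3 _ _
    · intro i j hi hj
      have key : (g * (κ₁ * (1 - E))) i j = (g * κ) i (σ j) - (g * κ) i j₀ * c j := by
        have e1 : g * κ₁ = (g * κ).submatrix id σ := by
          ext a b
          simp [κ₁, Matrix.mul_apply]
        rw [← Matrix.mul_assoc, e1, Matrix.mul_sub, Matrix.mul_one, Matrix.sub_apply,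
          Matrix.mul_vecMulVec]
        simp [Matrix.vecMulVec_apply, σ]
      rw [key]
      rcases eq_or_ne i i₀ with rfl | hne
      · simp only [c, hj, if_true]
        rw [mul_div_cancel₀ _ hne₀, sub_self]
      · have hlt : i₀ < i := by
          have : (i : ℕ) ≠ i₀ := fun h => hne (Fin.ext h)
          simp only [Fin.lt_def]
          omega
        -- The lower rows already vanish in the columns up to `i₀`, so neither the swap nor the
        -- elimination disturbs them.
        have hz : ∀ b ≤ i₀, (g * κ) i b = 0 := fun b hb =>
          h4 i b (by simp only [Fin.lt_def] at hlt; omega) (hb.trans_lt hlt)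
        rw [hz j₀ hj₀, zero_mul, sub_zero]
        rcases le_or_gt j i₀ with hji | hji
        · exact hz _ (hσ j hji)
        · have : σ j = j := Equiv.swap_apply_of_ne_of_ne (hj₀.trans_lt hji).ne' hji.ne'
          rw [this]
          exact h4 i j (by simp only [Fin.lt_def] at hlt; omega) hj

/-- Gram-Schmidt orthogonalization of the rows of a matrix, starting from the last one. -/
theorem exists_unitary_mul_upperTriangular {𝕜 : Type*} [RCLike 𝕜] {n : ℕ}
    (g : Matrix (Fin n) (Fin n) 𝕜) :
    ∃ κ ∈ Matrix.unitaryGroup (Fin n) 𝕜, ∀ i j, j < i → (g * κ) i j = 0 := by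
  let E := EuclideanSpace 𝕜 (Fin n)ᵒᵈ
  let f : (Fin n)ᵒᵈ → E := fun i => WithLp.toLp 2 fun j => g (OrderDual.ofDual i) (OrderDual.ofDual j)
  have hcard : Module.finrank 𝕜 E = Fintype.card (Fin n)ᵒᵈ := by simp [E]
  let e := InnerProductSpace.gramSchmidtOrthonormalBasis hcard f
  -- The entries are conjugated so that the entry `(i, j)` of `g * κ` is the inner product of the
  -- basis vector `j` with the row `i`.
  let κ : Matrix (Fin n) (Fin n) 𝕜 :=
    Matrix.of fun k j => star ((e (OrderDual.toDual j)) (OrderDual.toDual k))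
  refine ⟨κ, ?_, ?_⟩
  · rw [Matrix.mem_unitaryGroup_iff']
    ext i j
    have := orthonormal_iff_ite.1 e.orthonormal (OrderDual.toDual j) (OrderDual.toDual i)
    rw [Matrix.mul_apply, Matrix.one_apply]
    rw [PiLp.inner_apply] at this
    simp only [RCLike.inner_apply] at this
    refine (Fintype.sum_equiv OrderDual.toDual _ _ fun k => ?_).trans (this.trans ?_)
    · simp [κ, Matrix.star_apply]
    · simp [eq_comm]
  · intro i j hij
    have := InnerProductSpace.gramSchmidtOrthonormalBasis_inv_triangular hcard f
      (i := OrderDual.toDual i) (j := OrderDual.toDual j) hij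
    rw [PiLp.inner_apply] at this
    rw [Matrix.mul_apply]
    refine (Fintype.sum_equiv OrderDual.toDual _ _ fun k => ?_).trans this
    simp [κ, f, e]

open scoped ComplexOrder in
/-- A square submatrix of a unitary matrix has determinant of absolute value at most one. -/
theorem norm_det_toSquareBlockProp_unitary_le_one {n : ℕ} (U : Matrix (Fin n) (Fin n) ℂ)
    (hU : U ∈ Matrix.unitaryGroup (Fin n) ℂ) (p : Fin n → Prop) [DecidablePred p] :
    ‖(U.toSquareBlockProp p).det‖ ≤ 1 := by
  let D := U.toSquareBlockProp p
  let C := U.toBlock p fun i => ¬ p i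
  -- The rows of `U` with index in `p` are orthonormal and split into `D` and `C`. So `D * Dᴴ` has
  -- its eigenvalues in `[0, 1]`, and their product is `‖det D‖ ^ 2`.
  have hsum : 1 - D * D.conjTranspose = C * C.conjTranspose := by
    rw [sub_eq_iff_eq_add, add_comm]
    ext i j
    have h := congrFun (congrFun (Matrix.mem_unitaryGroup_iff.1 hU) i) j
    rw [Matrix.mul_apply, ← Fintype.sum_subtype_add_sum_subtype p] at h
    simpa [D, C, Matrix.mul_apply, Matrix.one_apply, Subtype.ext_iff, Matrix.toSquareBlockProp,
      Matrix.toBlock] using h.symm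
  have hpsd : (1 - D * D.conjTranspose).PosSemidef :=
    hsum ▸ Matrix.posSemidef_self_mul_conjTranspose C
  have hA : (D * D.conjTranspose).PosSemidef := Matrix.posSemidef_self_mul_conjTranspose D
  have hle : ∀ i, hA.isHermitian.eigenvalues i ≤ 1 := by
    intro i
    set v := (hA.isHermitian.eigenvectorBasis i)
    have h1 := hpsd.re_dotProduct_nonneg (v : {i // p i} → ℂ)
    have h2 := hA.isHermitian.eigenvalues_eq i
    have h3 : star (v : {i // p i} → ℂ) ⬝ᵥ (v : {i // p i} → ℂ) = 1 := by
      have := hA.isHermitian.eigenvectorBasis.orthonormal.1 i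
      rw [dotProduct_comm, ← EuclideanSpace.inner_eq_star_dotProduct, inner_self_eq_norm_sq_to_K,
        this]
      simp
    rw [Matrix.sub_mulVec, Matrix.one_mulVec, dotProduct_sub, h3, map_sub] at h1
    rw [h2]
    simpa using h1
  have hdet : ‖D.det‖ ^ 2 = ∏ i, hA.isHermitian.eigenvalues i := by
    have h1 := hA.isHermitian.det_eq_prod_eigenvalues
    rw [Matrix.det_mul, Matrix.det_conjTranspose] at h1
    have h2 : D.det * star D.det = ((‖D.det‖ ^ 2 : ℝ) : ℂ) := by
      simpa using Complex.mul_conj' D.det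
    rw [h2] at h1
    rw [← RCLike.ofReal_prod] at h1
    exact Complex.ofReal_injective h1
  have : ‖D.det‖ ^ 2 ≤ 1 := by
    rw [hdet]
    exact Finset.prod_le_one (fun i _ => hA.eigenvalues_nonneg i) fun i _ => hle i
  exact (sq_le_one_iff₀ (norm_nonneg _)).1 this

end LocalIwasawa

/-! ### The adelic absolute value and its logarithm. -/

section IdeleAbs

variable (F : Type*) [Field F] [NumberField F]

/-- The component of an adele at an infinite place. -/
def infiniteComponent (v : InfinitePlace F) : AdeleRing (𝓞 F) F →+* v.Completion where
  toFun x := x.1 v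
  map_one' := rfl
  map_mul' _ _ := rfl
  map_zero' := rfl
  map_add' _ _ := rfl

/-- The component of an adele at a finite place. -/
def finiteComponent (v : IsDedekindDomain.HeightOneSpectrum (𝓞 F)) :
    AdeleRing (𝓞 F) F →+* v.adicCompletion F where
  toFun x := x.2 v
  map_one' := rfl
  map_mul' _ _ := rfl
  map_zero' := rfl
  map_add' _ _ := rfl

variable {F}

theorem adele_ext {x y : AdeleRing (𝓞 F) F} (h₁ : ∀ v, infiniteComponent F v x = infiniteComponent F v y)
    (h₂ : ∀ v, finiteComponent F v x = finiteComponent F v y) : x = y :=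
  Prod.ext (funext h₁) (IsDedekindDomain.FiniteAdeleRing.ext _ h₂)

theorem norm_le_one_iff_mem_integers (v : IsDedekindDomain.HeightOneSpectrum (𝓞 F))
    (x : v.adicCompletion F) : ‖x‖ ≤ 1 ↔ x ∈ v.adicCompletionIntegers F :=
  Valued.toNormedField.norm_le_one_iff

/-- An idele is a local unit at almost all finite places, so the `finprod` in `ideleAbs` is the
actual product and not its default value. -/
theorem hasFiniteMulSupport_norm (x : (AdeleRing (𝓞 F) F)ˣ) :
    (fun v => ‖(x : AdeleRing (𝓞 F) F).2 v‖).HasFiniteMulSupport := by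
  have h : IsUnit (x : AdeleRing (𝓞 F) F).2 :=
    ⟨⟨(x : AdeleRing (𝓞 F) F).2, (x⁻¹).val.2, congrArg Prod.snd x.mul_inv,
      congrArg Prod.snd x.inv_mul⟩, rfl⟩
  have := (IsDedekindDomain.FiniteAdeleRing.isUnit_iff.1 h).2
  refine Set.Finite.subset this fun v hv hv' => hv ?_
  have h1 : Valued.v ((x : AdeleRing (𝓞 F) F).2 v) = 1 := hv'
  change ‖(x : AdeleRing (𝓞 F) F).2 v‖ = 1
  rw [FinitePlace.norm_def, h1]
  simp

theorem ideleAbs_mul (x y : (AdeleRing (𝓞 F) F)ˣ) :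
    ideleAbs F (x * y) = ideleAbs F x * ideleAbs F y := by
  have h1 : ∀ v, ‖((x * y : (AdeleRing (𝓞 F) F)ˣ) : AdeleRing (𝓞 F) F).1 v‖ =
      ‖(x : AdeleRing (𝓞 F) F).1 v‖ * ‖(y : AdeleRing (𝓞 F) F).1 v‖ := fun v => norm_mul _ _
  have h2 : ∀ v, ‖((x * y : (AdeleRing (𝓞 F) F)ˣ) : AdeleRing (𝓞 F) F).2 v‖ =
      ‖(x : AdeleRing (𝓞 F) F).2 v‖ * ‖(y : AdeleRing (𝓞 F) F).2 v‖ := fun v => norm_mul _ _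
  simp only [ideleAbs, h1, h2, mul_pow, Finset.prod_mul_distrib]
  rw [finprod_mul_distrib (hasFiniteMulSupport_norm x) (hasFiniteMulSupport_norm y)]
  ring

theorem ideleAbs_pos (x : (AdeleRing (𝓞 F) F)ˣ) : 0 < ideleAbs F x := by
  refine mul_pos (Finset.prod_pos fun v _ => pow_pos (norm_pos_iff.2 ?_) _) ?_
  · exact (x.isUnit.map (infiniteComponent F v)).ne_zero
  · rw [finprod_eq_prod_of_mulSupport_subset _ (hasFiniteMulSupport_norm x).coe_toFinset.ge]
    exact Finset.prod_pos fun v _ => norm_pos_iff.2 (x.isUnit.map (finiteComponent F v)).ne_zero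

theorem ideleAbs_one : ideleAbs F 1 = 1 := by
  have h := ideleAbs_mul (F := F) 1 1
  rw [mul_one] at h
  have h' := (ideleAbs_pos (F := F) 1).ne'
  field_simp at h
  exact h.symm

theorem ideleAbs_le_one {x : (AdeleRing (𝓞 F) F)ˣ}
    (h₁ : ∀ v, ‖infiniteComponent F v x‖ ≤ 1) (h₂ : ∀ v, ‖finiteComponent F v x‖ ≤ 1) :
    ideleAbs F x ≤ 1 := by
  refine mul_le_one₀ (Finset.prod_le_one (fun v _ => by positivity)
    fun v _ => pow_le_one₀ (norm_nonneg _) (h₁ v)) (finprod_nonneg fun v => norm_nonneg _) ?_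
  rw [finprod_eq_prod_of_mulSupport_subset _ (hasFiniteMulSupport_norm x).coe_toFinset.ge]
  exact Finset.prod_le_one (fun v _ => norm_nonneg _) fun v _ => h₂ v

/-- The product formula. -/
theorem ideleAbs_map_algebraMap (x : Fˣ) :
    ideleAbs F (Units.map (algebraMap F (AdeleRing (𝓞 F) F)).toMonoidHom x) = 1 := by
  rw [← NumberField.prod_abs_eq_one x.ne_zero, ideleAbs]
  congr 1
  · refine Finset.prod_congr rfl fun v _ => ?_
    congr 1
    exact InfinitePlace.Completion.norm_coe v (WithAbs.toAbs v.1 (x : F))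
  · rw [← finprod_comp_equiv (FinitePlace.equivHeightOneSpectrum (K := F))]
    exact finprod_congr fun w => FinitePlace.norm_embedding_eq w x

open scoped Classical in
/-- The logarithm of the adelic absolute value of an adele, `0` by convention if the adele is not
an idele. -/
def logAbs (a : AdeleRing (𝓞 F) F) : ℝ :=
  if h : IsUnit a then Real.log (ideleAbs F h.unit) else 0

theorem logAbs_coe (x : (AdeleRing (𝓞 F) F)ˣ) :
    logAbs (x : AdeleRing (𝓞 F) F) = Real.log (ideleAbs F x) := by
  rw [logAbs, dif_pos x.isUnit]
  congr
  exact Units.ext rfl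

theorem logAbs_mul {a b : AdeleRing (𝓞 F) F} (ha : IsUnit a) (hb : IsUnit b) :
    logAbs (a * b) = logAbs a + logAbs b := by
  obtain ⟨x, rfl⟩ := ha
  obtain ⟨y, rfl⟩ := hb
  rw [← Units.val_mul, logAbs_coe, logAbs_coe, logAbs_coe, ideleAbs_mul,
    Real.log_mul (ideleAbs_pos x).ne' (ideleAbs_pos y).ne']

theorem logAbs_one : logAbs (1 : AdeleRing (𝓞 F) F) = 0 := by
  rw [← Units.val_one, logAbs_coe, ideleAbs_one, Real.log_one]

theorem logAbs_prod {ι : Type*} (s : Finset ι) (f : ι → AdeleRing (𝓞 F) F)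
    (hf : ∀ i ∈ s, IsUnit (f i)) : logAbs (∏ i ∈ s, f i) = ∑ i ∈ s, logAbs (f i) := by
  classical
  induction s using Finset.induction_on with
  | empty => simp [logAbs_one]
  | insert a s has ih =>
    have hs : ∀ i ∈ s, IsUnit (f i) := fun i hi => hf i (Finset.mem_insert_of_mem hi)
    rw [Finset.prod_insert has, Finset.sum_insert has, ← ih hs,
      logAbs_mul (hf a (Finset.mem_insert_self a s)) (IsUnit.prod_iff.2 hs)]

theorem logAbs_algebraMap {x : F} (hx : x ≠ 0) :
    logAbs (algebraMap F (AdeleRing (𝓞 F) F) x) = 0 := by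
  have := logAbs_coe (Units.map (algebraMap F (AdeleRing (𝓞 F) F)).toMonoidHom (Units.mk0 x hx))
  rw [ideleAbs_map_algebraMap, Real.log_one] at this
  exact this

end IdeleAbs

/-! ### The maximal compact subgroup and the adelic Iwasawa decomposition. -/

section Compact

/-- The permutation matrix whose product with `M` has the row `σ i` of `M` as its row `i`. -/
def permGL {n : ℕ} (R : Type*) [CommRing R] (σ : Equiv.Perm (Fin n)) : GL (Fin n) R where
  val := σ.permMatrix R
  inv := σ⁻¹.permMatrix R
  val_inv := by rw [← Matrix.permMatrix_mul]; simp
  inv_val := by rw [← Matrix.permMatrix_mul]; simp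

/-- The Iwasawa decomposition of `GL(n, F_v)` at an infinite place. -/
theorem exists_infinite_mul_upperTriangular {F : Type*} [Field F] {n : ℕ}
    (v : InfinitePlace F)
    (g : Matrix (Fin n) (Fin n) v.Completion) :
    ∃ κ κ' : Matrix (Fin n) (Fin n) v.Completion, κ * κ' = 1 ∧
      κ.map (InfinitePlace.Completion.extensionEmbedding v) ∈ Matrix.unitaryGroup (Fin n) ℂ ∧
      ∀ i j, j < i → (g * κ) i j = 0 := by
  by_cases hv : v.IsReal
  · let e := InfinitePlace.Completion.ringEquivRealOfIsReal hv
    obtain ⟨κ, h1, h2⟩ := exists_unitary_mul_upperTriangular (g.map e)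
    have hκ : (κ.map e.symm).map e = κ := by ext; simp
    have hsκ : ((star κ).map e.symm).map e = star κ := by ext; simp
    refine ⟨κ.map e.symm, (star κ).map e.symm, ?_, ?_, ?_⟩
    · rw [← Matrix.map_mul, Matrix.mem_unitaryGroup_iff.1 h1,
        Matrix.map_one _ (map_zero _) (map_one _)]
    · have : (κ.map e.symm).map (InfinitePlace.Completion.extensionEmbedding v) =
          κ.map Complex.ofRealHom := by
        ext i j
        simp only [Matrix.map_apply]
        rw [← InfinitePlace.Completion.extensionEmbeddingOfIsReal_apply hv]
        exact congrArg _ (e.apply_symm_apply _)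
      rw [this, Matrix.mem_unitaryGroup_iff]
      have h3 : star (κ.map Complex.ofRealHom) = (star κ).map Complex.ofRealHom := by
        ext i j
        simp [Matrix.star_apply]
      rw [h3, ← Matrix.map_mul, Matrix.mem_unitaryGroup_iff.1 h1,
        Matrix.map_one _ (map_zero _) (map_one _)]
    · intro i j hij
      apply e.injective
      have := h2 i j hij
      rw [← hκ, ← Matrix.map_mul] at this
      rw [map_zero]
      exact this
  · let e := InfinitePlace.Completion.ringEquivComplexOfIsComplex
      (InfinitePlace.not_isReal_iff_isComplex.1 hv)
    obtain ⟨κ, h1, h2⟩ := exists_unitary_mul_upperTriangular (g.map e)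
    have hκ : (κ.map e.symm).map e = κ := by ext; simp
    refine ⟨κ.map e.symm, (star κ).map e.symm, ?_, ?_, ?_⟩
    · rw [← Matrix.map_mul, Matrix.mem_unitaryGroup_iff.1 h1,
        Matrix.map_one _ (map_zero _) (map_one _)]
    · exact hκ.symm ▸ h1
    · intro i j hij
      apply e.injective
      have := h2 i j hij
      rw [← hκ, ← Matrix.map_mul] at this
      rw [map_zero]
      exact this

variable {F : Type*} [Field F] [NumberField F] {n : ℕ}

/-- The composite `𝔸 → F_v → ℂ` for an infinite place `v`. -/
def complexComponent (v : InfinitePlace F) : AdeleRing (𝓞 F) F →+* ℂ :=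
  (InfinitePlace.Completion.extensionEmbedding v).comp (infiniteComponent F v)

theorem mem_maxCompact_iff {k : GL (Fin n) (AdeleRing (𝓞 F) F)} : k ∈ maxCompact F n ↔
    (∀ v i j, finiteComponent F v (k.val i j) ∈ v.adicCompletionIntegers F ∧
      finiteComponent F v ((k⁻¹).val i j) ∈ v.adicCompletionIntegers F) ∧
    ∀ v, k.val.map (complexComponent v) ∈ Matrix.unitaryGroup (Fin n) ℂ :=
  Iff.rfl

theorem maxCompact_mul {k l : GL (Fin n) (AdeleRing (𝓞 F) F)} (hk : k ∈ maxCompact F n)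
    (hl : l ∈ maxCompact F n) : k * l ∈ maxCompact F n := by
  rw [mem_maxCompact_iff] at *
  refine ⟨fun v i j => ⟨?_, ?_⟩, fun v => ?_⟩
  · rw [Units.val_mul, Matrix.mul_apply, map_sum]
    exact sum_mem fun a _ => by
      rw [map_mul]
      exact mul_mem (hk.1 v i a).1 (hl.1 v a j).1
  · rw [mul_inv_rev, Units.val_mul, Matrix.mul_apply, map_sum]
    exact sum_mem fun a _ => by
      rw [map_mul]
      exact mul_mem (hl.1 v i a).2 (hk.1 v a j).2
  · rw [Units.val_mul, Matrix.map_mul]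
    exact mul_mem (hk.2 v) (hl.2 v)

theorem maxCompact_inv {k : GL (Fin n) (AdeleRing (𝓞 F) F)} (hk : k ∈ maxCompact F n) :
    k⁻¹ ∈ maxCompact F n := by
  rw [mem_maxCompact_iff] at *
  refine ⟨fun v i j => ⟨(hk.1 v i j).2, by simpa using (hk.1 v i j).1⟩, fun v => ?_⟩
  have h1 : k.val.map (complexComponent v) * (k⁻¹).val.map (complexComponent v) = 1 := by
    rw [← Matrix.map_mul, k.mul_inv, Matrix.map_one _ (map_zero _) (map_one _)]
  have h2 : (k⁻¹).val.map (complexComponent v) = star (k.val.map (complexComponent v)) := by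
    rw [← Matrix.one_mul ((k⁻¹).val.map (complexComponent v)),
      ← Matrix.mem_unitaryGroup_iff'.1 (hk.2 v), Matrix.mul_assoc, h1, Matrix.mul_one]
  rw [h2]
  exact Unitary.star_mem (hk.2 v)

theorem permGL_mem_maxCompact (σ : Equiv.Perm (Fin n)) :
    permGL (AdeleRing (𝓞 F) F) σ ∈ maxCompact F n := by
  have aux : ∀ (v : IsDedekindDomain.HeightOneSpectrum (𝓞 F)) (τ : Equiv.Perm (Fin n)) i j,
      finiteComponent F v (τ.permMatrix (AdeleRing (𝓞 F) F) i j) ∈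
        v.adicCompletionIntegers F := by
    intro v τ i j
    rw [Equiv.Perm.permMatrix, PEquiv.toMatrix_apply]
    split_ifs
    · rw [map_one]; exact one_mem _
    · rw [map_zero]; exact zero_mem _
  rw [mem_maxCompact_iff]
  refine ⟨fun v i j => ⟨aux v σ i j, aux v σ⁻¹ i j⟩, fun v => ?_⟩
  have : (permGL (AdeleRing (𝓞 F) F) σ).val.map (complexComponent v) = σ.permMatrix ℂ := by
    ext i j
    simp only [permGL, Matrix.map_apply, Equiv.Perm.permMatrix, PEquiv.toMatrix_apply]
    split_ifs
    · rw [map_one]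
    · rw [map_zero]
  rw [this, Matrix.mem_unitaryGroup_iff, Matrix.star_eq_conjTranspose,
    Matrix.conjTranspose_permMatrix, ← Matrix.permMatrix_mul]
  simp

/-- The Iwasawa decomposition of `GL(n, 𝔸)`. -/
theorem exists_maxCompact_mul_upperTriangular (g : GL (Fin n) (AdeleRing (𝓞 F) F)) :
    ∃ k ∈ maxCompact F n, ∀ i j, j < i → (g * k).val i j = 0 := by
  choose κ κ' h1 h2 h3 using fun v : InfinitePlace F =>
    exists_infinite_mul_upperTriangular v (g.val.map (infiniteComponent F v))
  choose l l' e1 e2 e3 e4 using fun v : IsDedekindDomain.HeightOneSpectrum (𝓞 F) =>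
    exists_integral_mul_upperTriangular (v.adicCompletionIntegers F)
      (g.val.map (finiteComponent F v))
  -- The local matrices are integral at every finite place, so their entries form adeles.
  let k : Matrix (Fin n) (Fin n) (AdeleRing (𝓞 F) F) := Matrix.of fun i j =>
    (fun v => κ v i j, ⟨fun v => l v i j, Filter.Eventually.of_forall fun v => e2 v i j⟩)
  let k' : Matrix (Fin n) (Fin n) (AdeleRing (𝓞 F) F) := Matrix.of fun i j =>
    (fun v => κ' v i j, ⟨fun v => l' v i j, Filter.Eventually.of_forall fun v => e3 v i j⟩)
  have hk1 : ∀ v, k.map (infiniteComponent F v) = κ v := fun v => rfl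
  have hk1' : ∀ v, k'.map (infiniteComponent F v) = κ' v := fun v => rfl
  have hk2 : ∀ v, k.map (finiteComponent F v) = l v := fun v => rfl
  have hk2' : ∀ v, k'.map (finiteComponent F v) = l' v := fun v => rfl
  have hkk : k * k' = 1 := by
    ext i j
    refine adele_ext (fun v => ?_) fun v => ?_
    · have := congrFun (congrFun (h1 v) i) j
      rw [← hk1, ← hk1', ← Matrix.map_mul, ← Matrix.map_one (infiniteComponent F v) (map_zero _)
        (map_one _)] at this
      exact this
    · have := congrFun (congrFun (e1 v) i) j
      rw [← hk2, ← hk2', ← Matrix.map_mul, ← Matrix.map_one (finiteComponent F v) (map_zero _)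
        (map_one _)] at this
      exact this
  refine ⟨⟨k, k', hkk, mul_eq_one_comm.1 hkk⟩, ?_, fun i j hij => ?_⟩
  · rw [mem_maxCompact_iff]
    exact ⟨fun v i j => ⟨e2 v i j, e3 v i j⟩, fun v => h2 v⟩
  · refine adele_ext (fun v => ?_) fun v => ?_
    · have := h3 v i j hij
      rw [← hk1, ← Matrix.map_mul] at this
      rw [map_zero]
      exact this
    · have := e4 v i j hij
      rw [← hk2, ← Matrix.map_mul] at this
      rw [map_zero]
      exact this

/-- At a finite place the minor is an integral polynomial in integral entries; at an infinite place
it is a minor of a unitary matrix. All inequalities between heights originate here. -/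
theorem logAbs_minor_nonpos {k : GL (Fin n) (AdeleRing (𝓞 F) F)} (hk : k ∈ maxCompact F n)
    (p : Fin n → Prop) [DecidablePred p] : logAbs (k.val.toSquareBlockProp p).det ≤ 0 := by
  rw [logAbs]
  split_ifs with h
  · refine Real.log_nonpos (ideleAbs_pos _).le (ideleAbs_le_one (fun v => ?_) fun v => ?_)
    · have h1 := norm_det_toSquareBlockProp_unitary_le_one _ (hk.2 v) p
      rw [IsUnit.unit_spec]
      rw [← (AddMonoidHomClass.isometry_iff_norm
        (InfinitePlace.Completion.extensionEmbedding v)).1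
        (InfinitePlace.Completion.isometry_extensionEmbedding v)]
      refine le_of_eq_of_le ?_ h1
      congr 1
      exact (complexComponent v).map_det _
    · rw [IsUnit.unit_spec, norm_le_one_iff_mem_integers, RingHom.map_det]
      rw [Matrix.det_apply]
      exact sum_mem fun σ _ => zsmul_mem (prod_mem fun i _ => (hk.1 v _ _).1) _
  · exact le_rfl

end Compact

/-! ### Principal minors of block triangular matrices. -/

section Minors

variable {R : Type*} [CommRing R] {n : ℕ}

/-- The principal minor of a matrix on the indices which satisfy `p`. -/
def minor (p : Fin n → Prop) [DecidablePred p] (A : Matrix (Fin n) (Fin n) R) : R :=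
  (A.toSquareBlockProp p).det

/-- The indices which satisfy `p` span an invariant subspace of row vectors. -/
def RowInvariant (p : Fin n → Prop) (A : Matrix (Fin n) (Fin n) R) : Prop :=
  ∀ i j, p i → ¬ p j → A i j = 0

variable {p : Fin n → Prop} [DecidablePred p] {A B : Matrix (Fin n) (Fin n) R}

/-- The `p`-block of `A * B` is a sum of two products of blocks, one of which contains the vanishing
block of `A`. Nothing is asked of `B`. -/
theorem minor_mul (hA : RowInvariant p A) : minor p (A * B) = minor p A * minor p B := by
  rw [minor, minor, minor, ← Matrix.det_mul]
  congr 1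
  have h : A.toBlock p (fun i => ¬ p i) = 0 := by
    ext i j
    exact hA i j i.2 j.2
  rw [Matrix.toSquareBlockProp, Matrix.toBlock_mul_eq_add p p p, h, Matrix.zero_mul, add_zero]
  rfl

omit [DecidablePred p] in
theorem RowInvariant.mul (hA : RowInvariant p A) (hB : RowInvariant p B) :
    RowInvariant p (A * B) := by
  intro i j hi hj
  rw [Matrix.mul_apply]
  refine Finset.sum_eq_zero fun x _ => ?_
  by_cases hx : p x
  · rw [hB x j hx hj, mul_zero]
  · rw [hA i x hi hx, zero_mul]

theorem isUnit_minor (g : GL (Fin n) R) (hg : RowInvariant p g.val) : IsUnit (minor p g.val) := by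
  have h := Matrix.twoBlockTriangular_det' g.val p fun i hi j hj => hg i j hi hj
  have hu : IsUnit g.val.det := (Matrix.isUnit_iff_isUnit_det _).1 g.isUnit
  rw [h] at hu
  exact isUnit_of_mul_isUnit_left hu

theorem minor_of_upperTriangular (hA : ∀ i j, j < i → A i j = 0) :
    minor p A = ∏ i with p i, A i i := by
  have h : (A.toSquareBlockProp p).IsUpperTriangular := fun i j hij => hA _ _ hij
  rw [minor, Matrix.det_of_isUpperTriangular h]
  exact (Finset.prod_subtype (Finset.univ.filter p) (by simp) fun i => A i i).symm

theorem minor_submatrix_perm {q : Fin n → Prop} [DecidablePred q] (σ : Equiv.Perm (Fin n))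
    (hσ : ∀ i, p i ↔ q (σ i)) : minor p (A.submatrix σ σ) = minor q A := by
  rw [minor, minor, ← Matrix.det_submatrix_equiv_self (σ.subtypeEquiv hσ)]
  rfl

theorem minor_map {S : Type*} [CommRing S] (f : R →+* S) : minor p (A.map f) = f (minor p A) := by
  rw [minor, minor, RingHom.map_det]
  rfl

theorem permGL_mul (σ : Equiv.Perm (Fin n)) (M : Matrix (Fin n) (Fin n) R) :
    (permGL R σ).val * M = M.submatrix σ id :=
  PEquiv.toMatrix_toPEquiv_mul σ M

theorem mul_permGL_inv (σ : Equiv.Perm (Fin n)) (M : Matrix (Fin n) (Fin n) R) :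
    M * ((permGL R σ)⁻¹).val = M.submatrix id σ :=
  PEquiv.mul_toMatrix_toPEquiv M σ⁻¹

end Minors

/-! ### Covolumes of the last rows of an adelic matrix. -/

section Volume

variable {F : Type*} [Field F] [NumberField F] {n : ℕ}

/-- The logarithm of the covolume spanned by the rows of `g` from the row `k` on: the absolute value
of the corresponding minor of the triangular part of an Iwasawa decomposition. -/
def logVol (k : ℕ) (g : GL (Fin n) (AdeleRing (𝓞 F) F)) : ℝ :=
  logAbs (minor (fun i : Fin n => k ≤ i) (g * (exists_maxCompact_mul_upperTriangular g).choose).val)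

theorem rowInvariant_of_upperTriangular {R : Type*} [CommRing R] {A : Matrix (Fin n) (Fin n) R}
    (hA : ∀ i j, j < i → A i j = 0) (k : ℕ) : RowInvariant (fun i : Fin n => k ≤ i) A := by
  intro i j hi hj
  exact hA i j (by simp only [Fin.lt_def]; omega)

/-- Passing from `k` to `l` multiplies the minor by a minor of `k⁻¹ * l`, which lies in the maximal
compact subgroup. So a triangularizing element gives the largest minor, and any two of them give the
same one: `logVol` does not depend on the choice made in its definition. -/
theorem logAbs_minor_le {p : Fin n → Prop} [DecidablePred p]
    {g k l : GL (Fin n) (AdeleRing (𝓞 F) F)} (hk : k ∈ maxCompact F n) (hl : l ∈ maxCompact F n)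
    (hgk : RowInvariant p (g * k).val) (hgl : IsUnit (minor p (g * l).val)) :
    logAbs (minor p (g * l).val) ≤ logAbs (minor p (g * k).val) := by
  have h : g * l = g * k * (k⁻¹ * l) := by group
  have h1 : minor p (g * l).val = minor p (g * k).val * minor p (k⁻¹ * l).val := by
    rw [h, Units.val_mul (g * k), minor_mul hgk]
  have hu : IsUnit (minor p (k⁻¹ * l).val) := isUnit_of_mul_isUnit_right (h1 ▸ hgl)
  rw [h1, logAbs_mul (isUnit_minor _ hgk) hu]
  have := logAbs_minor_nonpos (maxCompact_mul (maxCompact_inv hk) hl) p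
  rw [← minor] at this
  linarith

theorem logAbs_minor_le_logVol {k : ℕ} {g l : GL (Fin n) (AdeleRing (𝓞 F) F)}
    (hl : l ∈ maxCompact F n) (hgl : IsUnit (minor (fun i : Fin n => k ≤ i) (g * l).val)) :
    logAbs (minor (fun i : Fin n => k ≤ i) (g * l).val) ≤ logVol k g :=
  have h := (exists_maxCompact_mul_upperTriangular g).choose_spec
  logAbs_minor_le h.1 hl (rowInvariant_of_upperTriangular h.2 k) hgl

theorem logVol_eq {k : ℕ} {g l : GL (Fin n) (AdeleRing (𝓞 F) F)}
    (hl : l ∈ maxCompact F n) (hgl : RowInvariant (fun i : Fin n => k ≤ i) (g * l).val) :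
    logVol k g = logAbs (minor (fun i : Fin n => k ≤ i) (g * l).val) :=
  have h := (exists_maxCompact_mul_upperTriangular g).choose_spec
  le_antisymm (logAbs_minor_le hl h.1 hgl
    (isUnit_minor _ (rowInvariant_of_upperTriangular h.2 k)))
    (logAbs_minor_le_logVol hl (isUnit_minor _ hgl))

theorem logVol_mul {k : ℕ} {g h : GL (Fin n) (AdeleRing (𝓞 F) F)}
    (hg : RowInvariant (fun i : Fin n => k ≤ i) g.val) :
    logVol k (g * h) = logAbs (minor (fun i : Fin n => k ≤ i) g.val) + logVol k h := by
  obtain ⟨l, hl, hhl⟩ := exists_maxCompact_mul_upperTriangular h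
  have h1 := rowInvariant_of_upperTriangular hhl k
  rw [logVol_eq hl h1, logVol_eq (g := g * h) hl (by rw [mul_assoc]; exact hg.mul h1), mul_assoc,
    Units.val_mul, minor_mul hg, logAbs_mul (isUnit_minor _ hg) (isUnit_minor _ h1)]

/-- By the product formula the minor of a rational matrix has adelic absolute value one. This makes
the height of a subspace independent of its basis. -/
theorem logVol_toAdelic_mul {k : ℕ} {γ : GL (Fin n) F} {g : GL (Fin n) (AdeleRing (𝓞 F) F)}
    (hγ : RowInvariant (fun i : Fin n => k ≤ i) γ.val) :
    logVol k (toAdelic F n γ * g) = logVol k g := by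
  have h1 : (toAdelic F n γ).val = γ.val.map (algebraMap F (AdeleRing (𝓞 F) F)) := rfl
  rw [logVol_mul, h1, minor_map, logAbs_algebraMap (isUnit_minor _ hγ).ne_zero, zero_add]
  intro i j hi hj
  rw [h1, Matrix.map_apply, hγ i j hi hj, map_zero]

theorem isUnit_diagonal {R : Type*} [CommRing R] (g : GL (Fin n) R)
    (hg : ∀ i j, j < i → g.val i j = 0) (i : Fin n) : IsUnit (g.val i i) := by
  have hu : IsUnit g.val.det := (Matrix.isUnit_iff_isUnit_det _).1 g.isUnit
  rw [Matrix.det_of_isUpperTriangular fun i j hij => hg i j hij, IsUnit.prod_iff] at hu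
  exact hu i (Finset.mem_univ i)

theorem logAbs_minor_of_upperTriangular {g : GL (Fin n) (AdeleRing (𝓞 F) F)}
    (hg : ∀ i j, j < i → g.val i j = 0) (p : Fin n → Prop) [DecidablePred p] :
    logAbs (minor p g.val) = ∑ i with p i, logAbs (g.val i i) := by
  rw [minor_of_upperTriangular hg, logAbs_prod _ _ fun i _ => isUnit_diagonal g hg i]

theorem logVol_eq_sum {k : ℕ} {g l : GL (Fin n) (AdeleRing (𝓞 F) F)}
    (hl : l ∈ maxCompact F n) (hgl : ∀ i j, j < i → (g * l).val i j = 0) :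
    logVol k g = ∑ i with k ≤ Fin.val i, logAbs ((g * l).val i i) := by
  rw [logVol_eq hl (rowInvariant_of_upperTriangular hgl k), logAbs_minor_of_upperTriangular hgl]

/-- Permuting the rows moves those in `S` to the end, and permuting the columns stays within the
compact group. The permuted matrix need not be triangular, so its minor is only a lower bound for
the covolume. -/
theorem sum_le_logVol_permGL_mul {k : ℕ} {g l : GL (Fin n) (AdeleRing (𝓞 F) F)}
    (hl : l ∈ maxCompact F n) (hgl : ∀ i j, j < i → (g * l).val i j = 0) (S : Finset (Fin n))
    (σ : Equiv.Perm (Fin n)) (hσ : ∀ i : Fin n, k ≤ i ↔ σ i ∈ S) :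
    ∑ i ∈ S, logAbs ((g * l).val i i) ≤ logVol k (permGL (AdeleRing (𝓞 F) F) σ * g) := by
  have h1 : (permGL (AdeleRing (𝓞 F) F) σ * g * (l * (permGL (AdeleRing (𝓞 F) F) σ)⁻¹)).val =
      (g * l).val.submatrix σ σ := by
    rw [mul_assoc, ← mul_assoc g, Units.val_mul, Units.val_mul (g * l), permGL_mul, mul_permGL_inv]
    rfl
  have h2 : minor (fun i : Fin n => k ≤ i)
      (permGL (AdeleRing (𝓞 F) F) σ * g * (l * (permGL (AdeleRing (𝓞 F) F) σ)⁻¹)).val =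
      minor (· ∈ S) (g * l).val := by
    rw [h1, minor_submatrix_perm σ hσ]
  have h3 := logAbs_minor_of_upperTriangular hgl (· ∈ S)
  rw [Finset.filter_univ_mem] at h3
  rw [← h3, ← h2]
  refine logAbs_minor_le_logVol (maxCompact_mul hl (maxCompact_inv (permGL_mem_maxCompact σ))) ?_
  rw [h2, minor_of_upperTriangular hgl]
  exact IsUnit.prod_iff.2 fun i _ => isUnit_diagonal _ hgl i

end Volume

/-! ### Subspaces and flags spanned by rows of rational matrices. -/

section RowSpan

variable {F : Type*} [Field F] {n : ℕ}

/-- The subspace spanned by the rows of an invertible matrix with index in `S`. -/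
def rowSpan (δ : GL (Fin n) F) (S : Finset (Fin n)) : Submodule F (Fin n → F) where
  -- The entries of `x δ⁻¹` are the coordinates of `x` in the basis formed by the rows of `δ`.
  carrier := {x | ∀ j ∉ S, Matrix.vecMul x (δ⁻¹).val j = 0}
  zero_mem' := by simp
  add_mem' := fun {a b} ha hb j hj => by
    rw [Matrix.add_vecMul, Pi.add_apply, ha j hj, hb j hj, add_zero]
  smul_mem' := fun c x hx j hj => by
    rw [Matrix.smul_vecMul, Pi.smul_apply, hx j hj, smul_zero]

theorem mem_rowSpan {δ : GL (Fin n) F} {S : Finset (Fin n)} {x : Fin n → F} :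
    x ∈ rowSpan δ S ↔ ∀ j ∉ S, Matrix.vecMul x (δ⁻¹).val j = 0 := Iff.rfl

theorem row_vecMul_inv (δ γ : GL (Fin n) F) (i : Fin n) :
    Matrix.vecMul (δ.val i) (γ⁻¹).val = (δ * γ⁻¹).val i := rfl

theorem row_mem_rowSpan (δ : GL (Fin n) F) {S : Finset (Fin n)} {i : Fin n} (hi : i ∈ S) :
    δ.val i ∈ rowSpan δ S := by
  intro j hj
  rw [row_vecMul_inv, mul_inv_cancel, Units.val_one, Matrix.one_apply_ne]
  rintro rfl
  exact hj hi

theorem rowSpan_le {δ : GL (Fin n) F} {S : Finset (Fin n)} {V : Submodule F (Fin n → F)}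
    (h : ∀ i ∈ S, δ.val i ∈ V) : rowSpan δ S ≤ V := by
  intro x hx
  have h1 : x = Matrix.vecMul (Matrix.vecMul x (δ⁻¹).val) δ.val := by
    rw [Matrix.vecMul_vecMul, δ.inv_mul, Matrix.vecMul_one]
  rw [h1, Matrix.vecMul_eq_sum]
  refine V.sum_mem fun i _ => ?_
  by_cases hi : i ∈ S
  · exact V.smul_mem _ (h i hi)
  · rw [hx i hi, zero_smul]
    exact V.zero_mem

theorem finrank_rowSpan (δ : GL (Fin n) F) (S : Finset (Fin n)) :
    Module.finrank F (rowSpan δ S) = S.card := by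
  have h1 : rowSpan δ S = Submodule.span F (Set.range fun i : S => δ.val i) :=
    le_antisymm (rowSpan_le fun i hi => Submodule.subset_span ⟨⟨i, hi⟩, rfl⟩)
      (Submodule.span_le.2 (by
        rintro _ ⟨i, rfl⟩
        exact row_mem_rowSpan δ i.2))
  have h2 : LinearIndependent F fun i : S => δ.val i :=
    (Matrix.linearIndependent_rows_of_isUnit δ.isUnit).comp _ Subtype.val_injective
  rw [h1, finrank_span_eq_card h2, Fintype.card_coe]

theorem rowSpan_mono (δ : GL (Fin n) F) {S T : Finset (Fin n)} (h : S ⊆ T) :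
    rowSpan δ S ≤ rowSpan δ T := fun _ hx j hj => hx j fun hS => hj (h hS)

theorem rowSpan_eq_of_le {δ δ' : GL (Fin n) F} {S : Finset (Fin n)}
    (h : ∀ i ∈ S, δ'.val i ∈ rowSpan δ S) : rowSpan δ' S = rowSpan δ S :=
  Submodule.eq_of_le_of_finrank_eq (rowSpan_le h) (by rw [finrank_rowSpan, finrank_rowSpan])

variable (n) in
/-- The indices from `k` on. -/
def tail (k : ℕ) : Finset (Fin n) := Finset.univ.filter fun i => k ≤ i

@[simp]
theorem mem_tail {k : ℕ} {i : Fin n} : i ∈ tail n k ↔ k ≤ i := by simp [tail]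

theorem card_tail (k : ℕ) : (tail n k).card = n - k := by
  rw [← Nat.card_Ico]
  refine Finset.card_bij (fun i _ => (i : ℕ)) (fun i hi => ?_) (fun i _ j _ h => Fin.ext h)
    fun b hb => ?_
  · exact Finset.mem_Ico.2 ⟨mem_tail.1 hi, i.2⟩
  · rw [Finset.mem_Ico] at hb
    exact ⟨⟨b, hb.2⟩, mem_tail.2 hb.1, rfl⟩

theorem tail_subset {k l : ℕ} (h : k ≤ l) : tail n l ⊆ tail n k := fun i hi => by
  rw [mem_tail] at *
  omega

/-- The subspace spanned by the rows of an invertible matrix from the row `k` on. -/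
def flag (δ : GL (Fin n) F) (k : ℕ) : Submodule F (Fin n → F) := rowSpan δ (tail n k)

theorem finrank_flag (δ : GL (Fin n) F) (k : ℕ) :
    Module.finrank F (flag δ k) = n - k := by
  rw [flag, finrank_rowSpan, card_tail]

theorem flag_antitone (δ : GL (Fin n) F) : Antitone (flag δ) := fun _ _ h =>
  rowSpan_mono δ (tail_subset h)

theorem flag_zero (δ : GL (Fin n) F) : flag δ 0 = ⊤ :=
  Submodule.eq_top_of_finrank_eq (by rw [finrank_flag δ _]; simp)

theorem flag_of_le (δ : GL (Fin n) F) {k : ℕ} (hk : n ≤ k) : flag δ k = ⊥ :=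
  le_bot_iff.1 (rowSpan_le fun i hi => by
    rw [mem_tail] at hi
    omega)

theorem row_mem_flag (δ : GL (Fin n) F) {k : ℕ} {i : Fin n} (hi : k ≤ i) :
    δ.val i ∈ flag δ k := row_mem_rowSpan δ (mem_tail.2 hi)

/-- The matrix `δ' * δ⁻¹` expresses the rows of `δ'` in the basis of the rows of `δ`. -/
theorem flag_eq_iff {δ δ' : GL (Fin n) F} {k : ℕ} :
    flag δ' k = flag δ k ↔ RowInvariant (fun i : Fin n => k ≤ i) (δ' * δ⁻¹).val := by
  constructor
  · intro h i j hi hj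
    have := h ▸ row_mem_flag δ' hi
    exact this j (by simpa using hj)
  · intro h
    refine rowSpan_eq_of_le fun i hi j hj => ?_
    exact h i j (by simpa using hi) (by simpa using hj)

theorem flag_eq_of_rows {δ δ' : GL (Fin n) F} {k : ℕ} (h : ∀ i : Fin n, k ≤ i → δ'.val i = δ.val i) :
    flag δ' k = flag δ k :=
  rowSpan_eq_of_le fun i hi => by
    rw [h i (mem_tail.1 hi)]
    exact row_mem_rowSpan δ hi

/-- A vector outside the span of the last rows can be taken as the next row. -/
theorem exists_replace_row (δ : GL (Fin n) F) (m : Fin n) {w : Fin n → F}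
    (hw : w ∉ flag δ (m + 1)) :
    ∃ δ' : GL (Fin n) F, (∀ i, m < i → δ'.val i = δ.val i) ∧ δ'.val m = w := by
  rw [flag, mem_rowSpan] at hw
  push Not at hw
  obtain ⟨j, hj, hne⟩ := hw
  rw [mem_tail, not_le, Nat.lt_succ_iff, Fin.val_fin_le] at hj
  -- Some coordinate `j ≤ m` of `w` is nonzero. After exchanging the rows `j` and `m` it becomes the
  -- coordinate `m`, so `w` may replace the row `m`: the determinant of `U` is this coordinate.
  let A := permGL F (Equiv.swap j m) * δ
  have hA : ∀ i, A.val i = δ.val (Equiv.swap j m i) := fun i => by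
    rw [Units.val_mul, permGL_mul]
    rfl
  let c : Fin n → F := Matrix.vecMul w (A⁻¹).val
  have hc : c m = Matrix.vecMul w (δ⁻¹).val j := by
    simp only [c, A, mul_inv_rev, Units.val_mul, mul_permGL_inv]
    simp [Matrix.vecMul, dotProduct]
  let U : Matrix (Fin n) (Fin n) F := Matrix.updateRow 1 m c
  have hU : U.det ≠ 0 := by
    rw [← Matrix.cramer_transpose_apply, Matrix.transpose_one, Matrix.cramer_one]
    simpa [hc] using hne
  refine ⟨Matrix.GeneralLinearGroup.mkOfDetNeZero U hU * A, fun i hi => ?_, ?_⟩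
  · have h1 : (Matrix.GeneralLinearGroup.mkOfDetNeZero U hU * A).val i = Matrix.vecMul (U i) A.val :=
      rfl
    have h2 : U i = Pi.single i 1 := by
      simp only [U]
      rw [Matrix.updateRow_ne hi.ne']
      ext k
      rw [Matrix.one_apply, Pi.single_apply]
      simp [eq_comm]
    rw [h1, h2, Matrix.single_one_vecMul]
    exact (hA i).trans (by rw [Equiv.swap_apply_of_ne_of_ne (hj.trans_lt hi).ne' hi.ne'])
  · have h1 : (Matrix.GeneralLinearGroup.mkOfDetNeZero U hU * A).val m = Matrix.vecMul (U m) A.val :=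
      rfl
    rw [h1]
    simp only [U]
    rw [Matrix.updateRow_self, Matrix.vecMul_vecMul, A.inv_mul, Matrix.vecMul_one]

/-- As long as `W` is not contained in the span of the chosen rows, a vector of `W` outside it
becomes the preceding row. Repeated use gives bases adapted to several subspaces at once. -/
theorem exists_flag_sup (W : Submodule F (Fin n → F)) (k : ℕ) (hk : k ≤ n) (δ : GL (Fin n) F) :
    ∃ k' ≤ k, ∃ δ' : GL (Fin n) F, (∀ i : Fin n, k ≤ i → δ'.val i = δ.val i) ∧
      (∀ i : Fin n, k' ≤ i → i < k → δ'.val i ∈ W) ∧ flag δ' k' = flag δ k ⊔ W := by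
  induction k generalizing δ with
  | zero =>
    refine ⟨0, le_rfl, δ, fun _ _ => rfl, fun i _ h => absurd h (Nat.not_lt_zero _), ?_⟩
    rw [flag_zero, top_sup_eq]
  | succ m ih =>
    by_cases hW : W ≤ flag δ (m + 1)
    · exact ⟨m + 1, le_rfl, δ, fun _ _ => rfl, fun i _ h => by omega, (sup_eq_left.2 hW).symm⟩
    obtain ⟨w, hwW, hw⟩ := Set.not_subset.1 hW
    obtain ⟨δ₁, h1, h2⟩ := exists_replace_row δ ⟨m, hk⟩ hw
    obtain ⟨k', hk', δ', h3, h4, h5⟩ := ih (by omega) δ₁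
    refine ⟨k', by omega, δ', fun i hi => ?_, fun i hi hi' => ?_, ?_⟩
    · rw [h3 i (by omega), h1 i (by simp only [Fin.lt_def]; omega)]
    · rcases Nat.lt_or_ge i m with him | him
      · exact h4 i hi him
      · have : i = ⟨m, hk⟩ := Fin.ext (by simp only; omega)
        rw [h3 i him, this, h2]
        exact hwW
    · rw [h5]
      apply le_antisymm
      · refine sup_le (rowSpan_le fun i hi => ?_) le_sup_right
        rw [mem_tail] at hi
        rcases Nat.eq_or_lt_of_le hi with him | him
        · have : i = ⟨m, hk⟩ := Fin.ext him.symm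
          rw [this, h2]
          exact Submodule.mem_sup_right hwW
        · rw [h1 i him]
          exact Submodule.mem_sup_left (row_mem_flag δ him)
      · refine sup_le_sup_right (rowSpan_le fun i hi => ?_) W
        rw [mem_tail] at hi
        rw [← h1 i hi]
        exact row_mem_flag δ₁ (by omega)

theorem exists_flag_eq (V : Submodule F (Fin n → F)) :
    ∃ δ : GL (Fin n) F, flag δ (n - Module.finrank F V) = V := by
  obtain ⟨k, hk, δ, -, -, h⟩ := exists_flag_sup V n le_rfl 1
  rw [flag_of_le 1 le_rfl, bot_sup_eq] at h
  have := finrank_flag δ k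
  rw [h] at this
  exact ⟨δ, by rw [this, Nat.sub_sub_self hk, h]⟩

/-- Every chain of subspaces is part of the flag of some basis. -/
theorem exists_flag_eq_of_isChain (C : Set (Submodule F (Fin n → F)))
    (hC : IsChain (· ≤ ·) C) :
    ∃ δ : GL (Fin n) F, ∀ U ∈ C, flag δ (n - Module.finrank F U) = U := by
  have hle : ∀ U : Submodule F (Fin n → F), Module.finrank F U ≤ n := fun U => by
    simpa using Submodule.finrank_le U
  -- The second clause keeps the last `k` rows inside every larger member of the chain, which leaves
  -- room for the next row.
  suffices H : ∀ k ≤ n, ∃ δ : GL (Fin n) F,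
      (∀ U ∈ C, Module.finrank F U ≤ k → flag δ (n - Module.finrank F U) = U) ∧
      ∀ U ∈ C, k ≤ Module.finrank F U → flag δ (n - k) ≤ U by
    obtain ⟨δ, h, -⟩ := H n le_rfl
    exact ⟨δ, fun U hU => h U hU (hle U)⟩
  intro k
  induction k with
  | zero =>
    refine fun _ => ⟨1, fun U _ hU => ?_, fun U _ _ => ?_⟩
    · rw [Submodule.finrank_eq_zero.1 (Nat.le_zero.1 hU)]
      simp [flag_of_le]
    · simp [flag_of_le]
  | succ k ih =>
    intro hk
    obtain ⟨δ, h1, h2⟩ := ih (by omega)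
    by_cases hex : ∃ U ∈ C, k + 1 ≤ Module.finrank F U
    -- The new row is taken in the smallest member of dimension at least `k + 1`; it then lies in
    -- all the larger ones.
    · obtain ⟨U₀, ⟨hU₀, hkU₀⟩, hmin⟩ := WellFounded.has_min
        (measure fun U : Submodule F (Fin n → F) => Module.finrank F U).wf
        {U | U ∈ C ∧ k + 1 ≤ Module.finrank F U} hex
      have hU₀le : ∀ U ∈ C, k + 1 ≤ Module.finrank F U → U₀ ≤ U := fun U hU hkU => by
        rcases hC.total hU₀ hU with h | h
        · exact h
        · have h3 := Submodule.finrank_mono h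
          have h4 := hmin U ⟨hU, hkU⟩
          exact (Submodule.eq_of_le_of_finrank_le h (not_lt.1 h4)).ge
      have hne : ¬ U₀ ≤ flag δ (n - k) := fun h => by
        have := Submodule.finrank_mono h
        rw [finrank_flag] at this
        omega
      obtain ⟨w, hwU, hw⟩ := Set.not_subset.1 hne
      let m : Fin n := ⟨n - (k + 1), by omega⟩
      have hm : (m : ℕ) + 1 = n - k := by simp only [m]; omega
      obtain ⟨δ', h3, h4⟩ := exists_replace_row δ m (w := w) (by rwa [hm])
      have h5 : flag δ' (n - (k + 1)) ≤ U₀ := rowSpan_le fun i hi => by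
        rw [mem_tail] at hi
        rcases Nat.eq_or_lt_of_le hi with him | him
        · have : i = m := Fin.ext him.symm
          rw [this, h4]
          exact hwU
        · rw [h3 i him]
          exact h2 U₀ hU₀ (by omega) (row_mem_flag δ (by omega))
      refine ⟨δ', fun U hU hkU => ?_, fun U hU hkU => h5.trans (hU₀le U hU hkU)⟩
      rcases Nat.eq_or_lt_of_le hkU with hkU | hkU
      · refine Submodule.eq_of_le_of_finrank_eq ?_ ?_
        · rw [hkU]
          exact h5.trans (hU₀le U hU hkU.ge)
        · rw [finrank_flag, Nat.sub_sub_self (hle U)]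
      · rw [← h1 U hU (by omega), finrank_flag, Nat.sub_sub_self (hle U)]
        exact flag_eq_of_rows fun i hi => h3 i (by
          simp only [Fin.lt_def, m]
          omega)
    · push Not at hex
      exact ⟨δ, fun U hU _ => h1 U hU (by have := hex U hU; omega), fun U hU hkU => by
        have := hex U hU
        omega⟩

end RowSpan

/-! ### The height of a subspace and its submodularity. -/

section Height

variable {F : Type*} [Field F] [NumberField F] {n : ℕ}

/-- The logarithmic height of a subspace of `F ^ n`, with respect to the metric of the row vectors
defined by `g`. -/
def height (g : GL (Fin n) (AdeleRing (𝓞 F) F)) (V : Submodule F (Fin n → F)) : ℝ :=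
  logVol (n - Module.finrank F V) (toAdelic F n (exists_flag_eq V).choose * g)

theorem height_flag (g : GL (Fin n) (AdeleRing (𝓞 F) F)) (δ : GL (Fin n) F) {k : ℕ} (hk : k ≤ n) :
    height g (flag δ k) = logVol k (toAdelic F n δ * g) := by
  have h := (exists_flag_eq (flag δ k)).choose_spec
  rw [height]
  set δ' := (exists_flag_eq (flag δ k)).choose
  rw [finrank_flag δ _, Nat.sub_sub_self hk] at h ⊢
  have h2 : toAdelic F n δ' * g = toAdelic F n (δ' * δ⁻¹) * (toAdelic F n δ * g) := by
    rw [← mul_assoc, ← map_mul, inv_mul_cancel_right]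
  rw [h2, logVol_toAdelic_mul (flag_eq_iff.1 h)]

theorem sum_le_height_rowSpan (g : GL (Fin n) (AdeleRing (𝓞 F) F)) (δ : GL (Fin n) F)
    (S : Finset (Fin n)) {l : GL (Fin n) (AdeleRing (𝓞 F) F)} (hl : l ∈ maxCompact F n)
    (hgl : ∀ i j, j < i → (toAdelic F n δ * g * l).val i j = 0) :
    ∑ i ∈ S, logAbs ((toAdelic F n δ * g * l).val i i) ≤ height g (rowSpan δ S) := by
  have hS : S.card ≤ n := by simpa using S.card_le_univ
  have hcard : Fintype.card {i : Fin n // n - S.card ≤ i} = Fintype.card {i // i ∈ S} := by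
    have := card_tail (n := n) (n - S.card)
    rw [Nat.sub_sub_self hS] at this
    rw [Fintype.card_coe, Fintype.card_subtype]
    exact this
  let e := Fintype.equivOfCardEq hcard
  have hσ : ∀ i : Fin n, n - S.card ≤ i ↔ e.extendSubtype i ∈ S := fun i =>
    ⟨fun h => e.extendSubtype_mem i h, fun h => by
      by_contra h'
      exact e.extendSubtype_not_mem i h' h⟩
  have hrow : flag (permGL F e.extendSubtype * δ) (n - S.card) = rowSpan δ S := by
    refine Submodule.eq_of_le_of_finrank_eq (rowSpan_le fun i hi => ?_) ?_
    · rw [Units.val_mul, permGL_mul]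
      exact row_mem_rowSpan δ ((hσ i).1 (mem_tail.1 hi))
    · rw [finrank_flag _ _, finrank_rowSpan, Nat.sub_sub_self hS]
  have hperm : toAdelic F n (permGL F e.extendSubtype) =
      permGL (AdeleRing (𝓞 F) F) e.extendSubtype := by
    ext i j
    simp only [toAdelic, Matrix.GeneralLinearGroup.map_apply, permGL, Equiv.Perm.permMatrix,
      PEquiv.toMatrix_apply]
    split_ifs
    · rw [map_one]
    · rw [map_zero]
  rw [← hrow, height_flag _ _ (Nat.sub_le _ _), map_mul, hperm, mul_assoc (permGL _ _)]
  exact sum_le_logVol_permGL_mul hl hgl S _ hσ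

/-- The height is submodular. -/
theorem height_inf_add_height_sup_le (g : GL (Fin n) (AdeleRing (𝓞 F) F))
    (V W : Submodule F (Fin n → F)) :
    height g (V ⊓ W) + height g (V ⊔ W) ≤ height g V + height g W := by
  -- One basis is adapted to all four subspaces: the rows from `k₁`, `k₂`, `k₃` on span `V ⊓ W`,
  -- `V`, `V ⊔ W`, and the rows between `k₃` and `k₂` lie in `W`. Together with the rows from `k₁`
  -- on, the latter span `W`.
  obtain ⟨k₁, hk₁, δ₁, -, -, h₁⟩ := exists_flag_sup (V ⊓ W) n le_rfl 1
  rw [flag_of_le 1 le_rfl, bot_sup_eq] at h₁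
  obtain ⟨k₂, hk₂, δ₂, h₂, -, h₂'⟩ := exists_flag_sup V k₁ hk₁ δ₁
  rw [h₁, sup_eq_right.2 inf_le_left] at h₂'
  obtain ⟨k₃, hk₃, δ, h₃, h₃', h₃''⟩ := exists_flag_sup W k₂ (hk₂.trans hk₁) δ₂
  rw [h₂'] at h₃''
  have e₁ : flag δ k₁ = V ⊓ W := by
    rw [← h₁]
    exact flag_eq_of_rows fun i hi => by rw [h₃ i (hk₂.trans hi), h₂ i hi]
  have e₂ : flag δ k₂ = V := by rw [← h₂', flag_eq_of_rows h₃]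
  let S : Finset (Fin n) := tail n k₁ ∪ (tail n k₃ \ tail n k₂)
  have hdisj : Disjoint (tail n k₁) (tail n k₃ \ tail n k₂) :=
    Finset.disjoint_sdiff.mono_left (tail_subset hk₂)
  have hS : rowSpan δ S = W := by
    refine Submodule.eq_of_le_of_finrank_eq (rowSpan_le fun i hi => ?_) ?_
    · simp only [S, Finset.mem_union, Finset.mem_sdiff, mem_tail, not_le] at hi
      rcases hi with hi | hi
      · exact (e₁ ▸ row_mem_flag δ hi : δ.val i ∈ V ⊓ W).2
      · exact h₃' i hi.1 hi.2
    · have := Submodule.finrank_sup_add_finrank_inf_eq V W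
      rw [← h₃'', ← e₁, finrank_flag _ _, finrank_flag _ _, ← e₂,
        finrank_flag _ _] at this
      rw [finrank_rowSpan, Finset.card_union_of_disjoint hdisj,
        Finset.card_sdiff_of_subset (tail_subset hk₃), card_tail, card_tail, card_tail]
      omega
  obtain ⟨l, hl, hgl⟩ := exists_maxCompact_mul_upperTriangular (toAdelic F n δ * g)
  -- For the three final segments the height equals the sum of the diagonal logarithms, while for
  -- `W` it is at least this sum. Counting indices then gives the inequality.
  have hW := sum_le_height_rowSpan g δ S hl hgl
  rw [hS, Finset.sum_union hdisj] at hW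
  have hflag : ∀ k ≤ n, height g (flag δ k) =
      ∑ i ∈ tail n k, logAbs ((toAdelic F n δ * g * l).val i i) := fun k hk => by
    rw [height_flag g δ hk, logVol_eq_sum hl hgl]
    rfl
  have hsplit := Finset.sum_sdiff (tail_subset (n := n) hk₃)
    (f := fun i => logAbs ((toAdelic F n δ * g * l).val i i))
  have a₁ := hflag k₁ hk₁
  have a₂ := hflag k₂ (by omega)
  have a₃ := hflag k₃ (by omega)
  rw [e₁] at a₁
  rw [e₂] at a₂
  rw [h₃''] at a₃
  linarith

end Height

/-! ### Harder-Narasimhan filtrations for submodular functions on subspaces. -/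

section HarderNarasimhan

variable {K E : Type*} [Field K] [AddCommGroup E] [Module K E]

/-- Submodular real valued functions on the lattice of subspaces. -/
def Submodular (d : Submodule K E → ℝ) : Prop :=
  ∀ V W, d (V ⊓ W) + d (V ⊔ W) ≤ d V + d W

/-- The dimension of a subspace, as a real number. -/
def rdim (V : Submodule K E) : ℝ := Module.finrank K V

variable {d φ : Submodule K E → ℝ}

/-- If the bottom of each step is the strict minimum in that step, the bottom of the chain is the
strict minimum over the chain. One replaces `X` by `X ⊓ U j`: submodularity for `X ⊓ U j` and `U (j
+ 1)` shows that going from `j` to `j + 1` does not increase `φ`. -/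
theorem Submodular.lt_or_eq_of_le (hφ : Submodular φ) {U : ℕ → Submodule K E} (hU : Antitone U)
    {a i : ℕ} (hai : a ≤ i)
    (h : ∀ j, a ≤ j → j < i → ∀ Y, U (j + 1) ≤ Y → Y ≤ U j →
      φ (U (j + 1)) < φ Y ∨ Y = U (j + 1))
    {X : Submodule K E} (hX : U i ≤ X) (hXa : X ≤ U a) : φ (U i) < φ X ∨ X = U i := by
  suffices H : ∀ j ≤ i, a ≤ j → φ (U i) < φ (X ⊓ U j) ∨ X ⊓ U j = U i by
    have := H a hai le_rfl
    rwa [inf_eq_left.2 hXa] at this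
  intro j hj
  induction hj using Nat.decreasingInduction with
  | self => exact fun _ => Or.inr (inf_eq_right.2 hX)
  | of_succ j hj ih =>
    intro haj
    have ih := ih (by omega)
    have hUj := hU (Nat.le_succ j)
    have hle : U (j + 1) ≤ (X ⊓ U j) ⊔ U (j + 1) := le_sup_right
    have h1 := h j haj hj ((X ⊓ U j) ⊔ U (j + 1)) le_sup_right (sup_le inf_le_right hUj)
    have h2 := hφ (X ⊓ U j) (U (j + 1))
    rw [inf_assoc, inf_eq_right.2 hUj] at h2
    rcases h1 with h1 | h1
    · left
      rcases ih with ih | ih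
      · linarith
      · rw [ih] at h2
        linarith
    · have h3 : X ⊓ U j = X ⊓ U (j + 1) :=
        le_antisymm (le_inf inf_le_left (sup_eq_right.1 h1)) (inf_le_inf_left X hUj)
      rw [h3]
      exact ih

/-- The dual statement, for minima at the tops of the steps, with `X ⊔ U j` in place of `X ⊓ U j`.
-/
theorem Submodular.lt_or_eq_of_ge (hφ : Submodular φ) {U : ℕ → Submodule K E} (hU : Antitone U)
    {i b : ℕ} (hib : i ≤ b)
    (h : ∀ j, i ≤ j → j < b → ∀ Y, U (j + 1) ≤ Y → Y ≤ U j → φ (U j) < φ Y ∨ Y = U j)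
    {X : Submodule K E} (hX : X ≤ U i) (hXb : U b ≤ X) : φ (U i) < φ X ∨ X = U i := by
  suffices H : ∀ j, i ≤ j → j ≤ b → φ (U i) < φ (X ⊔ U j) ∨ X ⊔ U j = U i by
    have := H b hib le_rfl
    rwa [sup_eq_left.2 hXb] at this
  intro j hij
  induction j, hij using Nat.le_induction with
  | base => exact fun _ => Or.inr (sup_eq_right.2 hX)
  | succ j hij ih =>
    intro hjb
    have ih := ih (by omega)
    have hUj := hU (Nat.le_succ j)
    have h1 := h j hij hjb (U j ⊓ (X ⊔ U (j + 1))) (le_inf hUj le_sup_right) inf_le_left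
    have h2 := hφ (U j) (X ⊔ U (j + 1))
    have h3 : U j ⊔ (X ⊔ U (j + 1)) = X ⊔ U j := by
      rw [sup_left_comm, sup_eq_left.2 hUj]
    rw [h3] at h2
    rcases h1 with h1 | h1
    · left
      rcases ih with ih | ih
      · linarith
      · rw [ih] at h2
        linarith
    · have h4 : X ⊔ U (j + 1) = X ⊔ U j :=
        le_antisymm (sup_le_sup_left hUj X) (sup_le le_sup_left (inf_eq_left.1 h1))
      rw [h4]
      exact ih

theorem Submodular.le_of_ge (hφ : Submodular φ) {U : ℕ → Submodule K E} (hU : Antitone U)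
    {i b : ℕ} (hib : i ≤ b)
    (h : ∀ j, i ≤ j → j < b → ∀ Y, U (j + 1) ≤ Y → Y ≤ U j → φ (U j) ≤ φ Y)
    {X : Submodule K E} (hX : X ≤ U i) (hXb : U b ≤ X) : φ (U i) ≤ φ X := by
  suffices H : ∀ j, i ≤ j → j ≤ b → φ (U i) ≤ φ (X ⊔ U j) by
    have := H b hib le_rfl
    rwa [sup_eq_left.2 hXb] at this
  intro j hij
  induction j, hij using Nat.le_induction with
  | base => exact fun _ => by rw [sup_eq_right.2 hX]
  | succ j hij ih =>
    intro hjb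
    have ih := ih (by omega)
    have hUj := hU (Nat.le_succ j)
    have h1 := h j hij hjb (U j ⊓ (X ⊔ U (j + 1))) (le_inf hUj le_sup_right) inf_le_left
    have h2 := hφ (U j) (X ⊔ U (j + 1))
    have h3 : U j ⊔ (X ⊔ U (j + 1)) = X ⊔ U j := by
      rw [sup_left_comm, sup_eq_left.2 hUj]
    rw [h3] at h2
    linarith

variable [FiniteDimensional K E]

theorem rdim_inf_add_rdim_sup (V W : Submodule K E) :
    rdim (V ⊓ W) + rdim (V ⊔ W) = rdim V + rdim W := by
  have := Submodule.finrank_sup_add_finrank_inf_eq V W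
  rw [add_comm] at this
  simp only [rdim]
  exact_mod_cast this

theorem rdim_mono {V W : Submodule K E} (h : V ≤ W) : rdim V ≤ rdim W :=
  Nat.cast_le.2 (Submodule.finrank_mono h)

theorem rdim_lt {V W : Submodule K E} (h : V < W) : rdim V + 1 ≤ rdim W := by
  have := Submodule.finrank_lt_finrank_of_lt h
  simp only [rdim]
  exact_mod_cast this

theorem eq_of_le_of_rdim_le {V W : Submodule K E} (h : V ≤ W) (h' : rdim W ≤ rdim V) : V = W :=
  Submodule.eq_of_le_of_finrank_le h (Nat.cast_le.1 h')

/-- The dimension is modular, so subtracting a multiple of it preserves submodularity. -/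
theorem Submodular.sub_mul_rdim (hd : Submodular d) (c : ℝ) :
    Submodular fun V => d V - c * rdim V := by
  intro V W
  have h1 := hd V W
  have h2 := congrArg (c * ·) (rdim_inf_add_rdim_sup V W)
  simp only at h2 ⊢
  linarith

/-- In the induction on `T`, take a hyperplane `T'` of `T`. If `V ≤ T` is not contained in `T'`,
then `V ⊔ T' = T`, and submodularity bounds `d V` below in terms of `d (V ⊓ T')`. -/
theorem Submodular.bddBelow (hd : Submodular d) : ∃ C, ∀ V, C ≤ d V := by
  suffices H : ∀ T : Submodule K E, ∃ C, ∀ V ≤ T, C ≤ d V by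
    obtain ⟨C, hC⟩ := H ⊤
    exact ⟨C, fun V => hC V le_top⟩
  intro T
  induction T using WellFoundedLT.induction with
  | ind T ih =>
    rcases eq_bot_or_bot_lt T with rfl | hT
    · exact ⟨d ⊥, fun V hV => by rw [le_bot_iff.1 hV]⟩
    obtain ⟨T', -, hT'⟩ := exists_le_covBy_of_lt hT
    obtain ⟨C, hC⟩ := ih T' hT'.lt
    refine ⟨min C (C + d T - d T'), fun V hV => ?_⟩
    by_cases hVT : V ≤ T'
    · exact (min_le_left _ _).trans (hC V hVT)
    · have h1 : V ⊔ T' = T := by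
        by_contra hne
        exact hT'.2 (lt_of_le_of_ne le_sup_right fun h => hVT (h ▸ le_sup_left))
          (lt_of_le_of_ne (sup_le hV hT'.le) hne)
      have h2 := hd V T'
      rw [h1] at h2
      have h3 := hC (V ⊓ T') inf_le_right
      exact (min_le_right _ _).trans (by linarith)

/-- The first step of the Harder-Narasimhan filtration above a subspace `B`: the largest subspace of
minimal slope. -/
theorem Submodular.exists_min_slope (hd : Submodular d) {B : Submodule K E} (hB : B < ⊤) :
    ∃ U > B, ∃ μ : ℝ, d U - d B = μ * (rdim U - rdim B) ∧
      (∀ Y ≥ B, μ * (rdim Y - rdim B) ≤ d Y - d B) ∧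
      ∀ Y > U, μ * (rdim Y - rdim B) < d Y - d B := by
  obtain ⟨C, hC⟩ := hd.bddBelow
  let slopes : Set ℝ := {x | ∃ Y > B, x = (d Y - d B) / (rdim Y - rdim B)}
  have hpos : ∀ Y > B, 1 ≤ rdim Y - rdim B := fun Y hY => by linarith [rdim_lt hY]
  have hbdd : BddBelow slopes := by
    refine ⟨min 0 (C - d B), ?_⟩
    rintro _ ⟨Y, hY, rfl⟩
    have h1 := hpos Y hY
    rw [le_div_iff₀ (by linarith)]
    have h2 : min 0 (C - d B) ≤ 0 := min_le_left _ _
    have h3 : min 0 (C - d B) ≤ C - d B := min_le_right _ _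
    nlinarith [hC Y]
  have hne : slopes.Nonempty := ⟨_, ⊤, hB, rfl⟩
  let μ := sInf slopes
  let φ : Submodule K E → ℝ := fun Y => d Y - d B - μ * (rdim Y - rdim B)
  have hφ : ∀ V W, φ (V ⊓ W) + φ (V ⊔ W) ≤ φ V + φ W := fun V W => by
    have := hd.sub_mul_rdim μ V W
    simp only [φ] at this ⊢
    linarith
  have hφ0 : ∀ Y ≥ B, 0 ≤ φ Y := by
    intro Y hY
    rcases eq_or_lt_of_le hY with rfl | hY
    · simp [φ]
    · have h1 := csInf_le hbdd ⟨Y, hY, rfl⟩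
      rw [le_div_iff₀ (by linarith [hpos Y hY])] at h1
      simp only [φ, μ]
      linarith
  have hφε : ∀ ε > 0, ∃ Y > B, φ Y < ε := by
    intro ε hε
    let N : ℝ := rdim (⊤ : Submodule K E) - rdim B
    have hN : 1 ≤ N := hpos ⊤ hB
    obtain ⟨_, ⟨Y, hY, rfl⟩, hlt⟩ := exists_lt_of_csInf_lt hne
      (show sInf slopes < μ + ε / N from lt_add_of_pos_right _ (by positivity))
    refine ⟨Y, hY, ?_⟩
    have h1 := hpos Y hY
    have h2 : rdim Y - rdim B ≤ N := by
      have := rdim_mono (le_top : Y ≤ ⊤)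
      simp only [N]
      linarith
    rw [div_lt_iff₀ (by linarith)] at hlt
    have h3 : ε / N * (rdim Y - rdim B) ≤ ε / N * N := by gcongr
    rw [div_mul_cancel₀ _ (by positivity)] at h3
    simp only [φ]
    linarith
  -- `φ` is nonnegative above `B` with infimum zero over `Y > B`, but the infimum must be shown to
  -- be attained. Here `k` is the largest dimension bound that still permits arbitrarily small
  -- values of `φ`.
  let A : ℕ → Prop := fun k => ∀ ε > 0, ∃ Y > B, k ≤ Module.finrank K Y ∧ φ Y < ε
  classical
  let k := Nat.findGreatest A (Module.finrank K E)
  have hk : A k := Nat.findGreatest_spec (m := 0) (Nat.zero_le _) fun ε hε => by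
    obtain ⟨Y, hY, h⟩ := hφε ε hε
    exact ⟨Y, hY, Nat.zero_le _, h⟩
  have hk' : ¬ A (k + 1) := fun h => by
    obtain ⟨Y, -, hY, -⟩ := h 1 one_pos
    exact Nat.findGreatest_is_greatest (Nat.lt_succ_self k) (hY.trans (Submodule.finrank_le Y)) h
  obtain ⟨ε, hε, hlarge⟩ : ∃ ε > 0, ∀ Y > B, k + 1 ≤ Module.finrank K Y → ε ≤ φ Y := by
    simp only [A] at hk'
    push Not at hk'
    exact hk'
  obtain ⟨U, hUB, hUk, hUε⟩ := hk (ε / 2) (half_pos hε)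
  -- The sum of two subspaces with small `φ` again has small `φ`. By the choice of `k` it has
  -- dimension at most `k`, so the two subspaces coincide, and `φ U` is smaller than any positive
  -- number.
  have hφU : φ U = 0 := by
    refine le_antisymm (le_of_forall_pos_lt_add fun ε' hε' => ?_) (hφ0 U hUB.le)
    obtain ⟨Y, hYB, hYk, hYε⟩ := hk (min ε' (ε / 2)) (lt_min hε' (half_pos hε))
    have h1 := hφ U Y
    have h2 := hφ0 (U ⊓ Y) (le_inf hUB.le hYB.le)
    have h3 : φ (U ⊔ Y) < ε := by linarith [min_le_right ε' (ε / 2)]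
    have h4 : Module.finrank K ↥(U ⊔ Y) ≤ k := by
      by_contra h
      exact absurd (hlarge _ (hUB.trans_le le_sup_left) (by omega)) (not_le.2 h3)
    have h5 : U = U ⊔ Y := Submodule.eq_of_le_of_finrank_le le_sup_left (h4.trans hUk)
    have h6 : Y = U ⊔ Y := Submodule.eq_of_le_of_finrank_le le_sup_right (h4.trans hYk)
    rw [h5, ← h6]
    linarith [min_le_left ε' (ε / 2)]
  refine ⟨U, hUB, μ, ?_, fun Y hY => ?_, fun Y hY => ?_⟩
  · simp only [φ] at hφU
    linarith
  · have := hφ0 Y hY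
    simp only [φ] at this
    linarith
  · have h1 := Submodule.finrank_lt_finrank_of_lt hY
    have := hlarge Y (hUB.trans hY) (by omega)
    simp only [φ] at this
    linarith

/-- The existence of the Harder-Narasimhan filtration. -/
theorem Submodular.exists_filtration (hd : Submodular d) (B : Submodule K E) :
    ∃ (r : ℕ) (U : ℕ → Submodule K E) (h : ℕ → ℝ), U 0 = B ∧ U r = ⊤ ∧
      (∀ j < r, U j < U (j + 1)) ∧
      (∀ j < r, d (U (j + 1)) - d (U j) = h j * (rdim (U (j + 1)) - rdim (U j))) ∧
      (∀ j < r, ∀ Y, U j ≤ Y → Y ≤ U (j + 1) → h j * (rdim Y - rdim (U j)) ≤ d Y - d (U j)) ∧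
      ∀ j, j + 1 < r → h j < h (j + 1) := by
  induction B using WellFoundedGT.induction with
  | ind B ih =>
    rcases eq_top_or_lt_top B with rfl | hB
    · exact ⟨0, fun _ => ⊤, fun _ => 0, rfl, rfl, by simp, by simp, by simp, by simp⟩
    obtain ⟨V, hVB, μ, hV, hmin, hmax⟩ := hd.exists_min_slope hB
    obtain ⟨r, U, h, hU0, hUr, h1, h2, h3, h4⟩ := ih V hVB
    refine ⟨r + 1, fun j => Nat.casesOn j B U, fun j => Nat.casesOn j μ h, rfl, hUr, ?_, ?_, ?_, ?_⟩
    · rintro (_ | j) hj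
      · show B < U 0
        rwa [hU0]
      · exact h1 j (by omega)
    · rintro (_ | j) hj
      · show d (U 0) - d B = μ * (rdim (U 0) - rdim B)
        rwa [hU0]
      · exact h2 j (by omega)
    · rintro (_ | j) hj Y hY hY'
      · exact hmin Y hY
      · exact h3 j (by omega) Y hY hY'
    · rintro (_ | j) hj
      · have e1 := h1 0 (by omega)
        have e2 := h2 0 (by omega)
        rw [hU0, zero_add] at e1 e2
        have e3 := hmax (U 1) e1
        have e4 := rdim_lt e1
        show μ < h 0
        -- Otherwise `U 1` would have slope at most `μ` over `B`, against the maximality of `V`.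
        by_contra hle
        have e5 : h 0 * (rdim (U 1) - rdim V) ≤ μ * (rdim (U 1) - rdim V) :=
          mul_le_mul_of_nonneg_right (not_lt.1 hle) (by linarith)
        linarith
      · exact h4 j (by omega)

end HarderNarasimhan

/-! ### Compositions as sets of cuts, and parabolic subgroups as stabilizers of flags. -/

section Cuts

variable {n : ℕ}

/-- The partial sums of a composition, including `0` and `n`. -/
def IsCut (P : Composition n) (k : ℕ) : Prop := ∃ a ≤ P.length, P.sizeUpTo a = k

variable {P Q : Composition n}

theorem isCut_sizeUpTo (P : Composition n) (a : ℕ) : IsCut P (P.sizeUpTo a) := by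
  rcases le_total a P.length with h | h
  · exact ⟨a, h, rfl⟩
  · exact ⟨P.length, le_rfl, by rw [P.sizeUpTo_length, P.sizeUpTo_ofLength_le a h]⟩

theorem IsCut.le {k : ℕ} (h : IsCut P k) : k ≤ n := by
  obtain ⟨a, -, rfl⟩ := h
  exact P.sizeUpTo_le a

theorem isCut_zero (P : Composition n) : IsCut P 0 := ⟨0, Nat.zero_le _, P.sizeUpTo_zero⟩

theorem isCut_self (P : Composition n) : IsCut P n := ⟨P.length, le_rfl, P.sizeUpTo_length⟩

theorem isCut_iff_mem_boundaries {k : ℕ} (hk : k < n + 1) :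
    IsCut P k ↔ (⟨k, hk⟩ : Fin (n + 1)) ∈ P.boundaries := by
  rw [Composition.boundaries, Finset.mem_map]
  constructor
  · rintro ⟨a, ha, rfl⟩
    exact ⟨⟨a, Nat.lt_succ_of_le ha⟩, Finset.mem_univ _, rfl⟩
  · rintro ⟨a, -, ha⟩
    exact ⟨a, Nat.le_of_lt_succ a.2, congrArg Fin.val ha⟩

theorem composition_ext (h : ∀ k, IsCut P k ↔ IsCut Q k) : P = Q := by
  apply (compositionEquiv n).injective
  refine CompositionAsSet.ext (Finset.ext fun k => ?_)
  exact (isCut_iff_mem_boundaries k.2).symm.trans ((h k).trans (isCut_iff_mem_boundaries k.2))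

theorem exists_composition (C : Set ℕ) (h0 : 0 ∈ C) (hn : n ∈ C) (hC : ∀ k ∈ C, k ≤ n) :
    ∃ P : Composition n, ∀ k, IsCut P k ↔ k ∈ C := by
  classical
  let c : CompositionAsSet n :=
    ⟨Finset.univ.filter fun k => (k : ℕ) ∈ C, by simpa using h0, by simpa using hn⟩
  refine ⟨c.toComposition, fun k => ?_⟩
  constructor
  · intro h
    have := (isCut_iff_mem_boundaries (Nat.lt_succ_of_le h.le)).1 h
    rw [c.toComposition_boundaries] at this
    simpa [c] using this
  · intro h
    rw [isCut_iff_mem_boundaries (Nat.lt_succ_of_le (hC k h)), c.toComposition_boundaries]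
    simpa [c] using h

theorem lt_sizeUpTo_index_succ (P : Composition n) (i : Fin n) :
    (i : ℕ) < P.sizeUpTo (P.index i + 1) := P.lt_sizeUpTo_index_succ i

theorem index_lt_of_lt_sizeUpTo {i : Fin n} {a : ℕ} (h : (i : ℕ) < P.sizeUpTo a) :
    (P.index i : ℕ) < a := by
  by_contra h'
  have := P.monotone_sizeUpTo (not_lt.1 h')
  have := P.sizeUpTo_index_le i
  omega

theorem le_index_of_sizeUpTo_le {i : Fin n} {a : ℕ} (h : P.sizeUpTo a ≤ i) :
    a ≤ (P.index i : ℕ) := by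
  by_contra h'
  have := P.monotone_sizeUpTo (Nat.succ_le_of_lt (not_le.1 h'))
  have := lt_sizeUpTo_index_succ P i
  simp only [Nat.succ_eq_add_one] at *
  omega

theorem index_eq_iff {i : Fin n} {a : ℕ} :
    (P.index i : ℕ) = a ↔ P.sizeUpTo a ≤ i ∧ (i : ℕ) < P.sizeUpTo (a + 1) := by
  constructor
  · rintro rfl
    exact ⟨P.sizeUpTo_index_le i, P.lt_sizeUpTo_index_succ i⟩
  · rintro ⟨h1, h2⟩
    have := index_lt_of_lt_sizeUpTo h2
    have := le_index_of_sizeUpTo_le h1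
    omega

theorem index_lt_index_iff {i j : Fin n} :
    P.index i < P.index j ↔ ∃ k, IsCut P k ∧ (i : ℕ) < k ∧ k ≤ j := by
  constructor
  · intro h
    refine ⟨_, isCut_sizeUpTo P (P.index j), ?_, P.sizeUpTo_index_le j⟩
    have h1 := P.monotone_sizeUpTo (Nat.succ_le_of_lt (Fin.lt_def.1 h))
    have h2 := lt_sizeUpTo_index_succ P i
    simp only [Nat.succ_eq_add_one] at *
    omega
  · rintro ⟨_, ⟨a, -, rfl⟩, h1, h2⟩
    exact Fin.lt_def.2 ((index_lt_of_lt_sizeUpTo h1).trans_le (le_index_of_sizeUpTo_le h2))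

theorem index_mono (P : Composition n) : Monotone P.index := fun i j h => by
  by_contra h'
  obtain ⟨k, -, h1, h2⟩ := index_lt_index_iff.1 (not_le.1 h')
  have := Fin.le_def.1 h
  omega

theorem mem_parabolic_iff {R : Type*} [CommRing R] {g : GL (Fin n) R} :
    g ∈ parabolic P R ↔ ∀ k, IsCut P k → RowInvariant (fun i : Fin n => k ≤ i) g.val := by
  constructor
  · intro h k hk i j hi hj
    exact h (index_lt_index_iff.2 ⟨k, hk, not_le.1 hj, hi⟩)
  · intro h i j hij
    obtain ⟨k, hk, h1, h2⟩ := index_lt_index_iff.1 hij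
    exact h k hk i j h2 (not_le.2 h1)

theorem parabolic_le_iff {F : Type*} [Field F] :
    parabolic P F ≤ parabolic Q F ↔ ∀ k, IsCut Q k → IsCut P k := by
  constructor
  · intro h k hk
    by_contra hkP
    have hk0 : k ≠ 0 := by
      rintro rfl
      exact hkP (isCut_zero P)
    have hkn : k < n := lt_of_le_of_ne hk.le (by
      rintro rfl
      exact hkP (isCut_self P))
    let i : Fin n := ⟨k - 1, by omega⟩
    let j : Fin n := ⟨k, hkn⟩
    have hij : j ≠ i := by
      simp only [i, j, ne_eq, Fin.mk.injEq]
      omega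
    -- If `k` is a cut of `Q` but not of `P`, the transvection with its extra entry in row `k` and
    -- column `k - 1` lies in `P` but not in `Q`.
    let g : GL (Fin n) F := Matrix.GeneralLinearGroup.mkOfDetNeZero (Matrix.transvection j i 1)
      (by rw [Matrix.det_transvection_of_ne j i hij]; exact one_ne_zero)
    have hg : ∀ x y, g.val x y = if x = j ∧ y = i then 1 else (1 : Matrix _ _ F) x y := by
      intro x y
      change (1 + Matrix.single j i 1 : Matrix (Fin n) (Fin n) F) x y = _
      rw [Matrix.add_apply, Matrix.single_apply]
      by_cases hxy : x = j ∧ y = i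
      · rw [if_pos hxy, if_pos ⟨hxy.1.symm, hxy.2.symm⟩, hxy.1, hxy.2, Matrix.one_apply_ne hij,
          zero_add]
      · rw [if_neg hxy, if_neg fun h => hxy ⟨h.1.symm, h.2.symm⟩, add_zero]
    have hgP : g ∈ parabolic P F := by
      rw [mem_parabolic_iff]
      intro l hl x y hx hy
      rw [hg, if_neg, Matrix.one_apply_ne]
      · rintro rfl
        exact hy hx
      · rintro ⟨rfl, rfl⟩
        simp only [i, j] at hx hy
        have : l = k := by omega
        exact hkP (this ▸ hl)
    have := mem_parabolic_iff.1 (h hgP) k hk j i (by simp [j]) (by simp only [i]; omega)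
    rw [hg, if_pos ⟨rfl, rfl⟩] at this
    exact one_ne_zero this
  · intro h g hg
    rw [mem_parabolic_iff] at *
    exact fun k hk => hg k (h k hk)

/-- This identifies the cosets of a parabolic subgroup with partial flags. -/
theorem mul_inv_mem_parabolic_iff {F : Type*} [Field F] {δ δ' : GL (Fin n) F} :
    δ' * δ⁻¹ ∈ parabolic P F ↔ ∀ k, IsCut P k → flag δ' k = flag δ k := by
  rw [mem_parabolic_iff]
  exact forall₂_congr fun k _ => flag_eq_iff.symm

end Cuts

/-! ### Levi and unipotent components of block triangular matrices. -/

section Levi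

variable {n : ℕ} {R : Type*} [CommRing R] (P : Composition n)

theorem levi_val (m : ∀ i : Fin P.length, GL (Fin (P.blocksFun i)) R) :
    (levi P R m).val = Matrix.reindex P.blocksFinEquiv P.blocksFinEquiv
      (Matrix.blockDiagonal' fun i => (m i).val) := rfl

theorem levi_apply_embedding (m : ∀ i : Fin P.length, GL (Fin (P.blocksFun i)) R) (a : Fin P.length)
    (s t : Fin (P.blocksFun a)) :
    (levi P R m).val (P.embedding a s) (P.embedding a t) = (m a).val s t := by
  have h : ∀ s, P.blocksFinEquiv.symm (P.embedding a s) = ⟨a, s⟩ := fun s =>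
    P.blocksFinEquiv.symm_apply_apply ⟨a, s⟩
  rw [levi_val, Matrix.reindex_apply, Matrix.submatrix_apply, h, h,
    Matrix.blockDiagonal'_apply_eq]

theorem levi_apply_of_ne (m : ∀ i : Fin P.length, GL (Fin (P.blocksFun i)) R) {x y : Fin n}
    (h : P.index x ≠ P.index y) : (levi P R m).val x y = 0 := by
  rw [levi_val, Matrix.reindex_apply, Matrix.submatrix_apply]
  exact Matrix.blockDiagonal'_apply_ne _ _ _ h

theorem det_levi (m : ∀ i : Fin P.length, GL (Fin (P.blocksFun i)) R) :
    (levi P R m).val.det = ∏ i, (m i).val.det := by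
  rw [levi_val, Matrix.det_reindex_self,
    (Matrix.blockTriangular_blockDiagonal' fun i => (m i).val).det_fintype]
  refine Finset.prod_congr rfl fun i _ => ?_
  let e : Fin (P.blocksFun i) ≃
      {x : Σ i : Fin P.length, Fin (P.blocksFun i) // x.1 = i} :=
    { toFun := fun s => ⟨⟨i, s⟩, rfl⟩
      invFun := fun x => x.2 ▸ x.1.2
      left_inv := fun _ => rfl
      right_inv := by rintro ⟨⟨_, s⟩, rfl⟩; rfl }
  rw [← Matrix.det_submatrix_equiv_self e]
  congr 1
  ext s t
  exact Matrix.blockDiagonal'_apply_eq (fun i => (m i).val) i s t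

theorem levi_mem_parabolic (m : ∀ i : Fin P.length, GL (Fin (P.blocksFun i)) R) :
    levi P R m ∈ parabolic P R := fun _ _ h => levi_apply_of_ne P m h.ne'

variable {P}

theorem unipotentRadical_apply_eq_zero {u : GL (Fin n) R} (hu : u ∈ unipotentRadical P R)
    {i j : Fin n} (hij : j < i) : u.val i j = 0 := by
  rw [hu i j (index_mono P hij.le), Matrix.one_apply_ne hij.ne']

theorem unipotentRadical_apply_self {u : GL (Fin n) R} (hu : u ∈ unipotentRadical P R)
    (i : Fin n) : u.val i i = 1 := by
  rw [hu i i le_rfl, Matrix.one_apply_eq]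

theorem minor_unipotentRadical {u : GL (Fin n) R} (hu : u ∈ unipotentRadical P R)
    (p : Fin n → Prop) [DecidablePred p] : minor p u.val = 1 := by
  rw [minor_of_upperTriangular fun i j hij => unipotentRadical_apply_eq_zero hu hij]
  exact Finset.prod_eq_one fun i _ => unipotentRadical_apply_self hu i

theorem index_embedding_eq (a : Fin P.length) (s : Fin (P.blocksFun a)) :
    P.index (P.embedding a s) = a := P.index_embedding a s

theorem exists_embedding_eq (x : Fin n) : ∃ a s, P.embedding a s = x :=
  ⟨P.index x, P.invEmbedding x, P.embedding_comp_inv x⟩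

theorem minor_levi (m : ∀ i : Fin P.length, GL (Fin (P.blocksFun i)) R) (a : ℕ) :
    minor (fun x : Fin n => P.sizeUpTo a ≤ x) (levi P R m).val =
      ∏ i : Fin P.length with a ≤ Fin.val i, (m i).val.det := by
  classical
  -- Replacing the blocks before `a` by identities leaves the minor unchanged and makes it equal to
  -- the full determinant.
  let m' : ∀ i : Fin P.length, GL (Fin (P.blocksFun i)) R := fun i => if a ≤ i then m i else 1
  have hle : ∀ x : Fin n, P.sizeUpTo a ≤ x ↔ a ≤ (P.index x : ℕ) := fun x =>
    ⟨le_index_of_sizeUpTo_le, fun h => (P.monotone_sizeUpTo h).trans (P.sizeUpTo_index_le x)⟩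
  have h1 := Matrix.twoBlockTriangular_det' (levi P R m').val (fun x : Fin n => P.sizeUpTo a ≤ x)
    fun i hi j hj => mem_parabolic_iff.1 (levi_mem_parabolic P m') _ (isCut_sizeUpTo P a) i j hi hj
  have h2 : ((levi P R m').val.toSquareBlockProp fun x : Fin n => P.sizeUpTo a ≤ x) =
      (levi P R m).val.toSquareBlockProp fun x : Fin n => P.sizeUpTo a ≤ x := by
    ext ⟨x, hx⟩ ⟨y, hy⟩
    change (levi P R m').val x y = (levi P R m).val x y
    by_cases hxy : P.index x = P.index y
    · obtain ⟨b, s, rfl⟩ := exists_embedding_eq (P := P) x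
      obtain ⟨c, t, rfl⟩ := exists_embedding_eq (P := P) y
      rw [index_embedding_eq, index_embedding_eq] at hxy
      subst hxy
      rw [hle, index_embedding_eq] at hx
      rw [levi_apply_embedding, levi_apply_embedding]
      simp only [m', if_pos hx]
    · rw [levi_apply_of_ne P m' hxy, levi_apply_of_ne P m hxy]
  have h3 : ((levi P R m').val.toSquareBlockProp fun x : Fin n => ¬ P.sizeUpTo a ≤ x) = 1 := by
    ext ⟨x, hx⟩ ⟨y, hy⟩
    change (levi P R m').val x y = _
    by_cases hxy : P.index x = P.index y
    · obtain ⟨b, s, rfl⟩ := exists_embedding_eq (P := P) x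
      obtain ⟨c, t, rfl⟩ := exists_embedding_eq (P := P) y
      rw [index_embedding_eq, index_embedding_eq] at hxy
      subst hxy
      rw [hle, index_embedding_eq] at hx
      rw [levi_apply_embedding]
      simp only [m', if_neg hx, Units.val_one, Matrix.one_apply, Subtype.mk.injEq,
        EmbeddingLike.apply_eq_iff_eq]
    · rw [levi_apply_of_ne P m' hxy, Matrix.one_apply_ne]
      intro h
      rw [Subtype.mk.injEq] at h
      exact hxy (congrArg _ h)
  rw [h2, h3, Matrix.det_one, mul_one, det_levi] at h1
  rw [minor, ← h1, Finset.prod_filter]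
  refine Finset.prod_congr rfl fun i _ => ?_
  simp only [m']
  split_ifs
  · rfl
  · simp

/-- An upper triangular matrix is the product of a Levi and a unipotent component. -/
theorem exists_levi_mul_unipotent (b : GL (Fin n) R) (hb : ∀ i j, j < i → b.val i j = 0) :
    ∃ m, ∃ u ∈ unipotentRadical P R, b = levi P R m * u := by
  have hu : ∀ a : Fin P.length, IsUnit (b.val.submatrix (P.embedding a) (P.embedding a)).det := by
    intro a
    have h : (b.val.submatrix (P.embedding a) (P.embedding a)).IsUpperTriangular :=
      fun i j hij => hb _ _ ((P.embedding a).strictMono hij)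
    rw [Matrix.det_of_isUpperTriangular h, IsUnit.prod_iff]
    exact fun i _ => isUnit_diagonal b hb _
  let m : ∀ a : Fin P.length, GL (Fin (P.blocksFun a)) R := fun a =>
    Matrix.nonsingInvUnit _ (hu a)
  have hbP : b ∈ parabolic P R := mem_parabolic_iff.2 fun k _ =>
    rowInvariant_of_upperTriangular hb k
  refine ⟨m, (levi P R m)⁻¹ * b, ?_, by group⟩
  have huP : (levi P R m)⁻¹ * b ∈ parabolic P R :=
    mul_mem (inv_mem (levi_mem_parabolic P m)) hbP
  set u := (levi P R m)⁻¹ * b with hu_def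
  have hbu : b = levi P R m * u := by rw [hu_def]; group
  intro i j hij
  rcases lt_or_eq_of_le hij with hij | hij
  · rw [huP hij, Matrix.one_apply_ne]
    rintro rfl
    exact hij.ne rfl
  · obtain ⟨a, s, rfl⟩ := exists_embedding_eq (P := P) i
    obtain ⟨c, t, rfl⟩ := exists_embedding_eq (P := P) j
    rw [index_embedding_eq, index_embedding_eq] at hij
    subst hij
    have h1 : (m c).val = (m c).val * u.val.submatrix (P.embedding c) (P.embedding c) := by
      ext x y
      have h2 := congrArg (fun g : GL (Fin n) R => g.val (P.embedding c x) (P.embedding c y)) hbu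
      simp only [Units.val_mul] at h2
      change b.val (P.embedding c x) (P.embedding c y) = _
      rw [h2, Matrix.mul_apply, Matrix.mul_apply, ← P.blocksFinEquiv.sum_comp, Fintype.sum_sigma,
        Finset.sum_eq_single c]
      · exact Finset.sum_congr rfl fun z _ => by
          rw [← levi_apply_embedding P m c x z]
          rfl
      · intro d _ hd
        refine Finset.sum_eq_zero fun z _ => ?_
        have : P.index (P.embedding c x) ≠ P.index (P.embedding d z) := by
          rw [index_embedding_eq, index_embedding_eq]
          exact hd.symm
        rw [show P.blocksFinEquiv ⟨d, z⟩ = P.embedding d z from rfl, levi_apply_of_ne P m this,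
          zero_mul]
      · simp
    have h3 : u.val.submatrix (P.embedding c) (P.embedding c) = 1 := by
      have h4 := congrArg (fun M => ((m c)⁻¹).val * M) h1
      simp only [← Matrix.mul_assoc, (m c).inv_mul, Matrix.one_mul] at h4
      exact h4.symm
    have h5 := congrFun (congrFun h3 s) t
    rw [Matrix.submatrix_apply] at h5
    rw [h5, Matrix.one_apply, Matrix.one_apply]
    simp

end Levi

/-! ### The Harish-Chandra map in terms of heights. -/

section HarishChandra

variable {F : Type*} [Field F] [NumberField F] {n : ℕ}

theorem exists_iwasawa (P : Composition n) (g : GL (Fin n) (AdeleRing (𝓞 F) F)) :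
    ∃ m : ∀ i : Fin P.length, GL (Fin (P.blocksFun i)) (AdeleRing (𝓞 F) F),
      ∃ u ∈ unipotentRadical P (AdeleRing (𝓞 F) F), ∃ k ∈ maxCompact F n,
        g = levi P (AdeleRing (𝓞 F) F) m * u * k := by
  obtain ⟨k, hk, h⟩ := exists_maxCompact_mul_upperTriangular g
  obtain ⟨m, u, hu, hmu⟩ := exists_levi_mul_unipotent (P := P) _ h
  exact ⟨m, u, hu, k⁻¹, maxCompact_inv hk, by rw [← hmu]; group⟩

theorem logVol_levi_mul {P : Composition n}
    (m : ∀ i : Fin P.length, GL (Fin (P.blocksFun i)) (AdeleRing (𝓞 F) F))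
    {u k : GL (Fin n) (AdeleRing (𝓞 F) F)} (hu : u ∈ unipotentRadical P (AdeleRing (𝓞 F) F))
    (hk : k ∈ maxCompact F n) (a : ℕ) :
    logVol (P.sizeUpTo a) (levi P (AdeleRing (𝓞 F) F) m * u * k) =
      ∑ i : Fin P.length with a ≤ Fin.val i, logAbs (m i).val.det := by
  have h1 := mem_parabolic_iff.1 (levi_mem_parabolic P m) _ (isCut_sizeUpTo P a)
  have h2 := rowInvariant_of_upperTriangular
    (fun i j hij => unipotentRadical_apply_eq_zero hu (i := i) (j := j) hij) (P.sizeUpTo a)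
  have h3 : levi P (AdeleRing (𝓞 F) F) m * u * k * k⁻¹ = levi P (AdeleRing (𝓞 F) F) m * u := by
    group
  rw [logVol_eq (maxCompact_inv hk) (by rw [h3]; exact h1.mul h2), h3, Units.val_mul,
    minor_mul h1, minor_unipotentRadical hu, mul_one, minor_levi, logAbs_prod]
  exact fun i _ => (Matrix.isUnit_iff_isUnit_det _).1 (m i).isUnit

theorem sum_tail_leviHeight {P : Composition n}
    (m : ∀ i : Fin P.length, GL (Fin (P.blocksFun i)) (AdeleRing (𝓞 F) F)) (a : ℕ) :
    ∑ x ∈ tail n (P.sizeUpTo a), leviHeight P m x =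
      ∑ i : Fin P.length with a ≤ Fin.val i, logAbs (m i).val.det := by
  have hle : ∀ x : Fin n, P.sizeUpTo a ≤ x ↔ a ≤ (P.index x : ℕ) := fun x =>
    ⟨le_index_of_sizeUpTo_le, fun h => (P.monotone_sizeUpTo h).trans (P.sizeUpTo_index_le x)⟩
  rw [tail, Finset.sum_filter, Finset.sum_filter, ← P.blocksFinEquiv.sum_comp, Fintype.sum_sigma]
  refine Finset.sum_congr rfl fun i _ => ?_
  have hpos : (P.blocksFun i : ℝ) ≠ 0 := Nat.cast_ne_zero.2 (by
    have := P.one_le_blocksFun i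
    omega)
  have h1 : ∀ s : Fin (P.blocksFun i), (if P.sizeUpTo a ≤ (P.blocksFinEquiv ⟨i, s⟩ : Fin n) then
      leviHeight P m (P.blocksFinEquiv ⟨i, s⟩) else 0) =
      if a ≤ (i : ℕ) then logAbs (m i).val.det / P.blocksFun i else 0 := by
    intro s
    have h2 : leviHeight P m (P.blocksFinEquiv ⟨i, s⟩) =
        logAbs (m i).val.det / P.blocksFun i := by
      rw [show P.blocksFinEquiv ⟨i, s⟩ = P.embedding i s from rfl, leviHeight,
        index_embedding_eq, ← logAbs_coe]
      rfl
    rw [h2]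
    refine if_congr ?_ rfl rfl
    rw [hle, show P.blocksFinEquiv ⟨i, s⟩ = P.embedding i s from rfl, index_embedding_eq]
  rw [Finset.sum_congr rfl fun s _ => h1 s, Finset.sum_const, Finset.card_univ, Fintype.card_fin,
    nsmul_eq_mul]
  split_ifs
  · rw [mul_div_cancel₀ _ hpos]
  · rw [mul_zero]

theorem harishChandra_eq_of_index_eq {P : Composition n} (g : GL (Fin n) (AdeleRing (𝓞 F) F))
    {x y : Fin n} (h : P.index x = P.index y) : harishChandra P g x = harishChandra P g y := by
  rw [harishChandra, dif_pos (exists_iwasawa P g), leviHeight, leviHeight, h]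

/-- The right-hand side involves no Iwasawa decomposition relative to `P`. Hence the decomposition
selected in `harishChandra` is immaterial. -/
theorem sum_tail_harishChandra {P : Composition n} (g : GL (Fin n) (AdeleRing (𝓞 F) F))
    {k : ℕ} (hk : IsCut P k) : ∑ x ∈ tail n k, harishChandra P g x = logVol k g := by
  obtain ⟨a, -, rfl⟩ := hk
  have h := exists_iwasawa P g
  rw [harishChandra, dif_pos h, sum_tail_leviHeight]
  obtain ⟨u, hu, l, hl, hg⟩ := h.choose_spec
  conv_rhs => rw [hg]
  rw [logVol_levi_mul _ hu hl]

theorem sum_tail_harishChandra_toAdelic {P : Composition n} (g : GL (Fin n) (AdeleRing (𝓞 F) F))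
    (δ : GL (Fin n) F) {k : ℕ} (hk : IsCut P k) :
    ∑ x ∈ tail n k, harishChandra P (toAdelic F n δ * g) x = height g (flag δ k) := by
  rw [sum_tail_harishChandra _ hk, height_flag g δ hk.le]

end HarishChandra

/-! ### Segments of indices, and the pairing with `ρ`. -/

section Pairing

variable {n : ℕ}

/-- The indices `i` with `k ≤ i < l`. -/
def segment (n k l : ℕ) : Finset (Fin n) := tail n k \ tail n l

@[simp]
theorem mem_segment {k l : ℕ} {i : Fin n} : i ∈ segment n k l ↔ k ≤ i ∧ (i : ℕ) < l := by
  simp [segment]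

theorem sum_segment (f : Fin n → ℝ) {k l : ℕ} (h : k ≤ l) :
    ∑ i ∈ segment n k l, f i = ∑ i ∈ tail n k, f i - ∑ i ∈ tail n l, f i := by
  rw [segment, Finset.sum_sdiff_eq_sub (tail_subset h)]

theorem card_segment {k l : ℕ} (h : k ≤ l) (hl : l ≤ n) :
    ((segment n k l).card : ℝ) = (l : ℝ) - k := by
  rw [segment, Finset.card_sdiff_of_subset (tail_subset h), card_tail, card_tail,
    ← Nat.cast_sub h]
  congr 1
  omega

theorem rho_dotProduct (P Q : Composition n) (H : Fin n → ℝ) :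
    rho P Q ⬝ᵥ H = 1 / 2 * ∑ ij : Fin n × Fin n with
      Q.index ij.1 = Q.index ij.2 ∧ P.index ij.1 < P.index ij.2, (H ij.1 - H ij.2) := by
  rw [rho, smul_dotProduct, sum_dotProduct, smul_eq_mul]
  congr 1
  refine Finset.sum_congr rfl fun ij _ => ?_
  rw [sub_dotProduct, single_one_dotProduct, single_one_dotProduct]

/-- Abel summation: if all the final partial sums of `f` are at least `0` and the sum vanishes,
then the sum of the differences is at most `0`. -/
theorem sum_sub_nonpos_of_partial_sums {ι : Type*} [LinearOrder ι] (B : Finset ι) (f : ι → ℝ)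
    (h0 : ∑ i ∈ B, f i = 0) (h : ∀ j ∈ B, 0 ≤ ∑ i ∈ B with j ≤ i, f i) :
    ∑ x ∈ B, ∑ y ∈ B with x < y, (f x - f y) ≤ 0 := by
  simp only [Finset.sum_sub_distrib]
  have h1 : ∑ x ∈ B, ∑ y ∈ B with x < y, f x ≤ 0 := by
    simp only [Finset.sum_filter]
    rw [Finset.sum_comm]
    refine Finset.sum_nonpos fun y hy => ?_
    rw [← Finset.sum_filter]
    have h2 := Finset.sum_filter_add_sum_filter_not B (fun x => y ≤ x) f
    simp only [not_le] at h2
    linarith [h y hy]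
  have h2 : ∑ x ∈ B, ∑ y ∈ B with x < y, f y = ∑ x ∈ B, ∑ y ∈ B with x ≤ y, f y := by
    have h3 : ∀ x ∈ B, ∑ y ∈ B with x ≤ y, f y = f x + ∑ y ∈ B with x < y, f y := by
      intro x hx
      have : B.filter (fun y => x ≤ y) = insert x (B.filter fun y => x < y) := by
        ext y
        simp only [Finset.mem_filter, Finset.mem_insert]
        constructor
        · rintro ⟨hy, hxy⟩
          rcases eq_or_lt_of_le hxy with rfl | hxy
          · exact Or.inl rfl
          · exact Or.inr ⟨hy, hxy⟩
        · rintro (rfl | ⟨hy, hxy⟩)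
          · exact ⟨hx, le_rfl⟩
          · exact ⟨hy, hxy.le⟩
      rw [this, Finset.sum_insert (by simp)]
    rw [Finset.sum_congr rfl h3, Finset.sum_add_distrib, h0, zero_add]
  have h3 : 0 ≤ ∑ x ∈ B, ∑ y ∈ B with x ≤ y, f y := Finset.sum_nonneg h
  linarith

end Pairing

/-! ### Slopes of flags, and semistability from the degree of instability. -/

section Slopes

theorem rdim_flag {F : Type*} [Field F] {n : ℕ} (δ : GL (Fin n) F) {k : ℕ} (hk : k ≤ n) :
    rdim (flag δ k) = n - k := by
  rw [rdim, finrank_flag, Nat.cast_sub hk]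

variable {F : Type*} [Field F] [NumberField F] {n : ℕ}

/-- The slope of the `a`-th step of the flag of type `P` defined by `δ`. -/
def slope (g : GL (Fin n) (AdeleRing (𝓞 F) F)) (P : Composition n) (δ : GL (Fin n) F) (a : ℕ) : ℝ :=
  (height g (flag δ (P.sizeUpTo a)) - height g (flag δ (P.sizeUpTo (a + 1)))) /
    (P.sizeUpTo (a + 1) - P.sizeUpTo a)

variable {g : GL (Fin n) (AdeleRing (𝓞 F) F)} {P Q : Composition n} {δ δ' : GL (Fin n) F}

theorem slope_mul {a : ℕ} (ha : a < P.length) :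
    slope g P δ a * (P.sizeUpTo (a + 1) - P.sizeUpTo a) =
      height g (flag δ (P.sizeUpTo a)) - height g (flag δ (P.sizeUpTo (a + 1))) := by
  have : (P.sizeUpTo a : ℝ) < P.sizeUpTo (a + 1) := Nat.cast_lt.2 (P.sizeUpTo_strict_mono ha)
  rw [slope, div_mul_cancel₀ _ (by linarith)]

/-- `H_P` is constant on each block, and its sum over the block is a difference of two heights. -/
theorem harishChandra_eq_slope (x : Fin n) :
    harishChandra P (toAdelic F n δ * g) x = slope g P δ (P.index x) := by
  set H := harishChandra P (toAdelic F n δ * g) with hH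
  obtain ⟨a, ha⟩ : ∃ a, a = (P.index x : ℕ) := ⟨_, rfl⟩
  have haP : a < P.length := ha ▸ (P.index x).2
  have hlt := P.sizeUpTo_strict_mono haP
  have h1 : ∀ y ∈ segment n (P.sizeUpTo a) (P.sizeUpTo (a + 1)), H y = H x := fun y hy => by
    rw [mem_segment, ← index_eq_iff] at hy
    exact harishChandra_eq_of_index_eq _ (Fin.ext (hy.trans ha))
  rw [← ha]
  have h2 := sum_segment H hlt.le
  rw [Finset.sum_congr rfl h1, Finset.sum_const, nsmul_eq_mul, card_segment hlt.le (P.sizeUpTo_le _),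
    hH, sum_tail_harishChandra_toAdelic g δ (isCut_sizeUpTo P a),
    sum_tail_harishChandra_toAdelic g δ (isCut_sizeUpTo P (a + 1)), ← slope_mul haP, mul_comm] at h2
  have : (P.sizeUpTo a : ℝ) < P.sizeUpTo (a + 1) := Nat.cast_lt.2 hlt
  exact mul_right_cancel₀ (by linarith) h2

theorem sum_segment_harishChandra (R : Composition n) (δ : GL (Fin n) F) {k l : ℕ} (hk : IsCut R k)
    (hl : IsCut R l) (hkl : k ≤ l) :
    ∑ x ∈ segment n k l, harishChandra R (toAdelic F n δ * g) x =
      height g (flag δ k) - height g (flag δ l) := by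
  rw [sum_segment _ hkl, sum_tail_harishChandra_toAdelic g δ hk,
    sum_tail_harishChandra_toAdelic g δ hl]

/-- The steps of the flag are semistable. -/
def SemistableSteps (g : GL (Fin n) (AdeleRing (𝓞 F) F)) (P : Composition n) (δ : GL (Fin n) F) :
    Prop :=
  ∀ a < P.length, ∀ Y, flag δ (P.sizeUpTo (a + 1)) ≤ Y → Y ≤ flag δ (P.sizeUpTo a) →
    slope g P δ a * (rdim Y - rdim (flag δ (P.sizeUpTo (a + 1)))) ≤
      height g Y - height g (flag δ (P.sizeUpTo (a + 1)))

/-- The degree of instability is tested on the flag refined by the single subspace `Y`: the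
composition `R` is `P` with the cut `j` of `Y` added. -/
theorem semistableSteps_of_instabilityDegree_le
    (h : instabilityDegree P (toAdelic F n δ * g) ≤ 0) : SemistableSteps g P δ := by
  intro a ha Y hY hY'
  have hlt := P.sizeUpTo_strict_mono ha
  set K := P.sizeUpTo a with hK
  set L := P.sizeUpTo (a + 1) with hL
  have hLn : L ≤ n := P.sizeUpTo_le _
  have hKc : IsCut P K := isCut_sizeUpTo P a
  have hLc : IsCut P L := isCut_sizeUpTo P (a + 1)
  obtain ⟨j, hj⟩ : ∃ j, j = n - Module.finrank F Y := ⟨_, rfl⟩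
  have hYn : Module.finrank F Y ≤ n := by simpa using Submodule.finrank_le Y
  have hKj : K ≤ j := by
    have := Submodule.finrank_mono hY'
    rw [finrank_flag] at this
    omega
  have hjL : j ≤ L := by
    have := Submodule.finrank_mono hY
    rw [finrank_flag] at this
    omega
  have hcuts : ∀ k, IsCut P k → k ≤ K ∨ L ≤ k := by
    rintro _ ⟨b, -, rfl⟩
    rcases Nat.lt_or_ge a b with hb | hb
    · exact Or.inr (P.monotone_sizeUpTo hb)
    · exact Or.inl (P.monotone_sizeUpTo hb)
  obtain ⟨R, hR⟩ := exists_composition (n := n) (insert j {k | IsCut P k})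
    (Or.inr (isCut_zero P)) (Or.inr (isCut_self P)) (by
      rintro k (rfl | hk)
      · omega
      · exact hk.le)
  have hRP : ∀ k, IsCut P k → IsCut R k := fun k hk => (hR k).2 (Or.inr hk)
  have hRj : IsCut R j := (hR j).2 (Or.inl rfl)
  obtain ⟨δ', hδ'⟩ := exists_flag_eq_of_isChain (insert Y {V | ∃ k, IsCut P k ∧ V = flag δ k}) (by
    refine IsChain.insert ?_ ?_
    · rintro _ ⟨k, -, rfl⟩ _ ⟨l, -, rfl⟩ -
      exact (le_total l k).imp (fun h => flag_antitone δ h) fun h => flag_antitone δ h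
    · rintro _ ⟨k, hk, rfl⟩ -
      rcases hcuts k hk with hk | hk
      · exact Or.inl (hY'.trans (flag_antitone δ hk))
      · exact Or.inr ((flag_antitone δ hk).trans hY))
  have hflag : ∀ k, IsCut P k → flag δ' k = flag δ k := fun k hk => by
    have := hδ' (flag δ k) (Or.inr ⟨k, hk, rfl⟩)
    rwa [finrank_flag, Nat.sub_sub_self hk.le] at this
  have hYj : flag δ' j = Y := hj ▸ hδ' Y (Or.inl rfl)
  have hle : ((rho R P ⬝ᵥ harishChandra R (toAdelic F n δ' * g) : ℝ) : EReal) ≤ 0 := by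
    refine le_trans ?_ h
    have h1 : toAdelic F n δ' * g = toAdelic F n (δ' * δ⁻¹) * (toAdelic F n δ * g) := by
      rw [← mul_assoc, ← map_mul, inv_mul_cancel_right]
    rw [h1]
    exact le_iSup_of_le R (le_iSup_of_le (parabolic_le_iff.2 hRP)
      (le_iSup_of_le ⟨δ' * δ⁻¹, mul_inv_mem_parabolic_iff.2 hflag⟩ le_rfl))
  have hle' : rho R P ⬝ᵥ harishChandra R (toAdelic F n δ' * g) ≤ 0 := EReal.coe_nonpos.1 hle
  rw [rho_dotProduct] at hle'
  set H := harishChandra R (toAdelic F n δ' * g) with hH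
  -- Only the pairs separated by the new cut contribute to `ρ_R^P`. The condition becomes the
  -- comparison of the mean of `H` before `j` with its mean after `j`, cleared of denominators.
  have hset : (Finset.univ.filter fun ij : Fin n × Fin n =>
      P.index ij.1 = P.index ij.2 ∧ R.index ij.1 < R.index ij.2) =
      segment n K j ×ˢ segment n j L := by
    ext ⟨x, y⟩
    simp only [Finset.mem_filter, Finset.mem_univ, true_and, Finset.mem_product, mem_segment]
    constructor
    · rintro ⟨h1, h2⟩
      obtain ⟨k, hk, hxk, hky⟩ := index_lt_index_iff.1 h2
      rcases (hR k).1 hk with rfl | hk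
      · have hx : ¬ (x : ℕ) < K := fun hx => h1.not_lt
          (index_lt_index_iff.2 ⟨K, hKc, hx, by omega⟩)
        have hy : ¬ L ≤ (y : ℕ) := fun hy => h1.not_lt
          (index_lt_index_iff.2 ⟨L, hLc, by omega, hy⟩)
        omega
      · exact absurd (index_lt_index_iff.2 ⟨k, hk, hxk, hky⟩) h1.not_lt
    · rintro ⟨⟨h1, h2⟩, h3, h4⟩
      refine ⟨Fin.ext ?_, index_lt_index_iff.2 ⟨j, hRj, h2, h3⟩⟩
      rw [index_eq_iff.2 ⟨h1, h2.trans_le hjL⟩, index_eq_iff.2 ⟨hKj.trans h3, h4⟩]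
  rw [hset, Finset.sum_product] at hle'
  simp only [Finset.sum_sub_distrib, Finset.sum_const, nsmul_eq_mul, ← Finset.mul_sum] at hle'
  rw [card_segment hKj (by omega), card_segment hjL hLn, hH,
    sum_segment_harishChandra R δ' (hRP K hKc) hRj hKj,
    sum_segment_harishChandra R δ' hRj (hRP L hLc) hjL, hYj, hflag K hKc, hflag L hLc] at hle'
  have hs := slope_mul (g := g) (δ := δ) ha
  rw [← hK, ← hL] at hs
  have hdim : rdim Y - rdim (flag δ L) = (L : ℝ) - j := by
    rw [← hYj, rdim_flag δ' (by omega), rdim_flag δ hLn]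
    ring
  rw [hdim]
  have hKL : (K : ℝ) < L := Nat.cast_lt.2 hlt
  have h5 : (height g Y - height g (flag δ L) - slope g P δ a * (L - j)) * ((L : ℝ) - K) ≥ 0 := by
    have h6 : slope g P δ a * ((L : ℝ) - j) * (L - K) =
        (L - j) * (height g (flag δ K) - height g (flag δ L)) := by
      rw [← hs]
      ring
    rw [sub_mul, h6]
    nlinarith
  have := nonneg_of_mul_nonneg_left h5 (by linarith)
  linarith

end Slopes

/-! ### The terms of the truncation function as conditions on flags. -/

section Terms

variable {F : Type*} [Field F] [NumberField F] {n : ℕ}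
  {g : GL (Fin n) (AdeleRing (𝓞 F) F)} {P Q : Composition n} {δ δ' : GL (Fin n) F}

/-- The pairing with `ρ_R^P` splits over the blocks of `P`. In each block the slope is subtracted
from `H`; semistability makes the final partial sums nonnegative, and Abel summation applies. -/
theorem instabilityDegree_le_of_semistableSteps (h : SemistableSteps g P δ) :
    instabilityDegree P (toAdelic F n δ * g) ≤ 0 := by
  refine iSup_le fun R => iSup_le fun hRP => iSup_le fun γ => EReal.coe_nonpos.2 ?_
  rw [parabolic_le_iff] at hRP
  obtain ⟨δ', hδ'⟩ : ∃ δ', δ' = γ.1 * δ := ⟨_, rfl⟩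
  have hflag : ∀ k, IsCut P k → flag δ' k = flag δ k := mul_inv_mem_parabolic_iff.1 (by
    rw [hδ', mul_inv_cancel_right]
    exact γ.2)
  rw [← mul_assoc, ← map_mul, ← hδ', rho_dotProduct]
  obtain ⟨H, hH⟩ : ∃ H, H = harishChandra R (toAdelic F n δ' * g) := ⟨_, rfl⟩
  rw [← hH]
  have hHR : ∀ {x y}, R.index x = R.index y → H x = H y := fun hxy => by
    rw [hH]
    exact harishChandra_eq_of_index_eq _ hxy
  -- Pairs inside one block of `R` contribute zero, so the sum may run over all pairs `x < y`.
  have h1 : ∑ ij : Fin n × Fin n with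
      P.index ij.1 = P.index ij.2 ∧ R.index ij.1 < R.index ij.2, (H ij.1 - H ij.2) =
      ∑ ij : Fin n × Fin n with P.index ij.1 = P.index ij.2 ∧ ij.1 < ij.2, (H ij.1 - H ij.2) := by
    refine Finset.sum_subset (fun ij hij => ?_) fun ij hij hij' => ?_
    · rw [Finset.mem_filter] at *
      exact ⟨hij.1, hij.2.1, (index_mono R).reflect_lt hij.2.2⟩
    · simp only [Finset.mem_filter, Finset.mem_univ, true_and, not_and, not_lt] at hij hij'
      rw [hHR (le_antisymm (index_mono R hij.2.le) (hij' hij.1)), sub_self]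
  have h2 : ∀ a : Fin P.length, ∑ x ∈ segment n (P.sizeUpTo a) (P.sizeUpTo (a + 1)),
      ∑ y ∈ segment n (P.sizeUpTo a) (P.sizeUpTo (a + 1)) with x < y, (H x - H y) ≤ 0 := by
    intro a
    have hlt := P.sizeUpTo_strict_mono a.2
    obtain ⟨K, hK⟩ : ∃ K, K = P.sizeUpTo a := ⟨_, rfl⟩
    obtain ⟨L, hL⟩ : ∃ L, L = P.sizeUpTo (a + 1) := ⟨_, rfl⟩
    have hs := slope_mul (g := g) (δ := δ) a.2
    have hsemi := h a a.2
    rw [← hK, ← hL] at hs hsemi hlt ⊢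
    have hLn : L ≤ n := hL ▸ P.sizeUpTo_le _
    have hKc : IsCut P K := hK ▸ isCut_sizeUpTo P a
    have hLc : IsCut P L := hL ▸ isCut_sizeUpTo P (a + 1)
    obtain ⟨c, hc⟩ : ∃ c, c = slope g P δ a := ⟨_, rfl⟩
    rw [← hc] at hs hsemi
    have hsum : ∀ k l, k ≤ l → l ≤ n → ∑ i ∈ segment n k l, (H i - c) =
        ∑ i ∈ segment n k l, H i - (l - k) * c := fun k l hkl hl => by
      rw [Finset.sum_sub_distrib, Finset.sum_const, nsmul_eq_mul, card_segment hkl hl]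
    have hT : ∀ j, IsCut R j → K ≤ j → j ≤ L → 0 ≤ ∑ i ∈ segment n j L, (H i - c) := by
      intro j hj hKj hjL
      have := hsemi (flag δ' j) (by rw [← hflag L hLc]; exact flag_antitone _ hjL)
        (by rw [← hflag K hKc]; exact flag_antitone _ hKj)
      rw [rdim_flag _ hj.le, rdim_flag _ hLn] at this
      rw [hsum j L hjL hLn, hH, sum_segment_harishChandra R δ' hj (hRP L hLc) hjL, hflag L hLc]
      linarith
    have key := sum_sub_nonpos_of_partial_sums (segment n K L) (fun i => H i - c) ?_ ?_
    · simpa only [sub_sub_sub_cancel_right] using key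
    · rw [hsum K L hlt.le hLn, hH, sum_segment_harishChandra R δ' (hRP K hKc) (hRP L hLc) hlt.le,
        hflag L hLc, hflag K hKc, ← hs]
      ring
    · intro j hj
      rw [mem_segment] at hj
      have hfilter : (segment n K L).filter (fun i => j ≤ i) = segment n j L := by
        ext i
        simp only [Finset.mem_filter, mem_segment, Fin.le_def]
        omega
      rw [hfilter]
      obtain ⟨p, hp⟩ : ∃ p, p = R.sizeUpTo (R.index j) := ⟨_, rfl⟩
      obtain ⟨q, hq⟩ : ∃ q, q = R.sizeUpTo (R.index j + 1) := ⟨_, rfl⟩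
      have hpj : p ≤ j := hp ▸ R.sizeUpTo_index_le j
      have hjq : (j : ℕ) < q := hq ▸ lt_sizeUpTo_index_succ R j
      have hpc : IsCut R p := hp ▸ isCut_sizeUpTo R _
      have hqc : IsCut R q := hq ▸ isCut_sizeUpTo R _
      have hKp : K ≤ p := by
        obtain ⟨b, -, hb⟩ := hRP K hKc
        rw [hp, ← hb]
        exact R.monotone_sizeUpTo (le_index_of_sizeUpTo_le (by omega))
      have hqL : q ≤ L := by
        obtain ⟨b, -, hb⟩ := hRP L hLc
        rw [hq, ← hb]
        exact R.monotone_sizeUpTo (index_lt_of_lt_sizeUpTo (by omega))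
      -- Semistability controls the partial sums at cuts of `R` only. Between two consecutive cuts
      -- `p`, `q` the partial sum is affine in `k`, hence at least the smaller of its values at the
      -- two ends.
      have hconst : ∀ k, p ≤ k → k ≤ q → ∑ i ∈ segment n k L, (H i - c) =
          ∑ i ∈ segment n q L, (H i - c) + (q - k) * (H j - c) := by
        intro k hpk hkq
        have h3 : ∑ i ∈ segment n k q, (H i - c) = (q - k) * (H j - c) := by
          rw [← card_segment hkq (hqL.trans hLn), ← nsmul_eq_mul, ← Finset.sum_const]
          refine Finset.sum_congr rfl fun i hi => ?_
          rw [mem_segment] at hi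
          rw [hHR (Fin.ext (index_eq_iff.2 ⟨hp ▸ hpk.trans hi.1, hq ▸ hi.2⟩) :
            R.index i = R.index j)]
        rw [← h3, sum_segment _ (hkq.trans hqL), sum_segment _ hqL, sum_segment _ hkq]
        ring
      have hTp := hT p hpc hKp (by omega)
      have hTq := hT q hqc (by omega) hqL
      have e1 := hconst j hpj hjq.le
      have e2 := hconst p le_rfl (by omega)
      have hpj' : (p : ℝ) ≤ (j : ℕ) := Nat.cast_le.2 hpj
      have hjq' : ((j : ℕ) : ℝ) ≤ q := Nat.cast_le.2 hjq.le
      rcases le_total c (H j) with hc | hc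
      · rw [e1]
        have := mul_nonneg (sub_nonneg.2 hjq') (sub_nonneg.2 hc)
        linarith
      · have := mul_nonneg (sub_nonneg.2 hpj') (sub_nonneg.2 hc)
        rw [e1]
        linarith
  have h3 : ∑ ij : Fin n × Fin n with P.index ij.1 = P.index ij.2 ∧ ij.1 < ij.2,
      (H ij.1 - H ij.2) = ∑ a : Fin P.length,
        ∑ x ∈ segment n (P.sizeUpTo a) (P.sizeUpTo (a + 1)),
        ∑ y ∈ segment n (P.sizeUpTo a) (P.sizeUpTo (a + 1)) with x < y, (H x - H y) := by
    rw [Finset.sum_filter, Fintype.sum_prod_type, ← Finset.sum_fiberwise Finset.univ P.index]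
    have hseg : ∀ (a : Fin P.length) (x : Fin n),
        x ∈ segment n (P.sizeUpTo a) (P.sizeUpTo (a + 1)) ↔ P.index x = a := fun a x => by
      rw [mem_segment, ← index_eq_iff, Fin.ext_iff]
    refine Finset.sum_congr rfl fun a _ => ?_
    refine Finset.sum_congr (by ext x; simp [hseg]) fun x hx => ?_
    rw [← Finset.sum_filter]
    refine Finset.sum_congr ?_ fun y _ => rfl
    ext y
    have hx' : P.index x = a := (hseg a x).1 hx
    simp only [Finset.mem_filter, Finset.mem_univ, true_and, hseg, hx']
    rw [eq_comm]
  rw [h1, h3]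
  have := Finset.sum_nonpos fun a (_ : a ∈ Finset.univ) => h2 a
  linarith

/-- The flag of type `P` defined by `δ` is a relative Harder-Narasimhan filtration: its steps are
semistable and their slopes decrease, except at the steps of `Q`. -/
def IsHarderNarasimhan (g : GL (Fin n) (AdeleRing (𝓞 F) F)) (P Q : Composition n)
    (δ : GL (Fin n) F) : Prop :=
  SemistableSteps g P δ ∧ ∀ a, a + 1 < P.length → ¬ IsCut Q (P.sizeUpTo (a + 1)) →
    slope g P δ (a + 1) < slope g P δ a

theorem slope_congr (h : ∀ k, IsCut P k → flag δ' k = flag δ k) (a : ℕ) :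
    slope g P δ' a = slope g P δ a := by
  rw [slope, slope, h _ (isCut_sizeUpTo P _), h _ (isCut_sizeUpTo P _)]

theorem IsHarderNarasimhan.congr (h : ∀ k, IsCut P k → flag δ' k = flag δ k)
    (hδ : IsHarderNarasimhan g P Q δ) : IsHarderNarasimhan g P Q δ' := by
  constructor
  · intro a ha
    rw [slope_congr h, h _ (isCut_sizeUpTo P _), h _ (isCut_sizeUpTo P _)]
    exact hδ.1 a ha
  · intro a ha
    rw [slope_congr h, slope_congr h]
    exact hδ.2 a ha

theorem sizeUpTo_lt {a : ℕ} (ha : a < P.length) : P.sizeUpTo a < n :=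
  (P.sizeUpTo_strict_mono ha).trans_le (P.sizeUpTo_le _)

theorem index_sizeUpTo {a : ℕ} (ha : a < P.length) :
    (P.index ⟨P.sizeUpTo a, sizeUpTo_lt ha⟩ : ℕ) = a :=
  index_eq_iff.2 ⟨le_rfl, P.sizeUpTo_strict_mono ha⟩

theorem exists_sizeUpTo_eq {k : ℕ} (hk : IsCut P k) (hkn : k < n) :
    ∃ a < P.length, P.sizeUpTo a = k := by
  obtain ⟨a, ha, rfl⟩ := hk
  refine ⟨a, lt_of_le_of_ne ha ?_, rfl⟩
  rintro rfl
  rw [P.sizeUpTo_length] at hkn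
  exact hkn.false

theorem forall_simpleRoots_iff : (∀ α ∈ simpleRoots P Q,
      0 < α ⬝ᵥ harishChandra P (toAdelic F n δ * g)) ↔
    ∀ a, a + 1 < P.length → ¬ IsCut Q (P.sizeUpTo (a + 1)) →
      slope g P δ (a + 1) < slope g P δ a := by
  have hpair : ∀ i j : Fin n, (Pi.single i 1 - Pi.single j 1 : Fin n → ℝ) ⬝ᵥ
      harishChandra P (toAdelic F n δ * g) =
      slope g P δ (P.index i) - slope g P δ (P.index j) := fun i j => by
    rw [sub_dotProduct, single_one_dotProduct, single_one_dotProduct, harishChandra_eq_slope,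
      harishChandra_eq_slope]
  constructor
  · intro h a ha hQ
    have hlt := P.sizeUpTo_strict_mono (show a < P.length by omega)
    have hltn := sizeUpTo_lt ha
    let i : Fin n := ⟨P.sizeUpTo (a + 1) - 1, by omega⟩
    let j : Fin n := ⟨P.sizeUpTo (a + 1), hltn⟩
    have hi : (P.index i : ℕ) = a := index_eq_iff.2 (by simp only [i]; omega)
    have hj : (P.index j : ℕ) = a + 1 := index_sizeUpTo ha
    have h1 := h _ ⟨i, j, by simp only [i, j]; omega, ?_, ?_, rfl⟩
    · rw [hpair, hi, hj] at h1
      linarith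
    · refine le_antisymm (index_mono Q (by simp [i, j, Fin.le_def])) (not_lt.1 fun hlt => ?_)
      obtain ⟨k, hk, h1, h2⟩ := index_lt_index_iff.1 hlt
      simp only [i, j] at h1 h2
      exact hQ ((show k = P.sizeUpTo (a + 1) by omega) ▸ hk)
    · intro hij
      have := congrArg Fin.val hij
      omega
  · rintro h _ ⟨i, j, hij, hQ, hP, rfl⟩
    have hlt : P.index i < P.index j :=
      lt_of_le_of_ne (index_mono P (Fin.le_def.2 (by omega))) hP
    obtain ⟨k, hk, h1, h2⟩ := index_lt_index_iff.1 hlt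
    obtain ⟨b, hb, rfl⟩ := exists_sizeUpTo_eq hk (by omega)
    have hbj : P.sizeUpTo b = j := by omega
    rcases b with _ | a
    · rw [P.sizeUpTo_zero] at h1
      omega
    · have hlt' := P.sizeUpTo_strict_mono (show a < P.length by omega)
      have hi : (P.index i : ℕ) = a := index_eq_iff.2 (by omega)
      have hj : (P.index j : ℕ) = a + 1 := index_eq_iff.2
        ⟨hbj.le, hbj ▸ P.sizeUpTo_strict_mono hb⟩
      rw [hpair, hi, hj, sub_pos]
      refine h a hb fun hcut => ?_
      exact hQ.not_lt (index_lt_index_iff.2 ⟨_, hcut, h1, h2⟩)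

/-- Each sum is a positive multiple of one slope. By `hPQ` the block of `P` concerned begins where
the block of `Q` begins. -/
theorem forall_sum_nonpos_iff (hPQ : ∀ k, IsCut Q k → IsCut P k) :
    (∀ b : Fin Q.length, ∑ i : Fin n with
        P.index i = P.index (Q.embedding b ⟨0, Q.one_le_blocksFun b⟩),
      harishChandra P (toAdelic F n δ * g) i ≤ 0) ↔
    ∀ a < P.length, IsCut Q (P.sizeUpTo a) → slope g P δ a ≤ 0 := by
  have hsum : ∀ x : Fin n, ∑ i : Fin n with P.index i = P.index x,
      harishChandra P (toAdelic F n δ * g) i ≤ 0 ↔ slope g P δ (P.index x) ≤ 0 := by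
    intro x
    have h1 : ∀ i ∈ Finset.univ.filter (fun i => P.index i = P.index x),
        harishChandra P (toAdelic F n δ * g) i = slope g P δ (P.index x) := fun i hi => by
      rw [harishChandra_eq_slope, (Finset.mem_filter.1 hi).2]
    rw [Finset.sum_congr rfl h1, Finset.sum_const, nsmul_eq_mul]
    have h2 : 0 < ((Finset.univ.filter fun i => P.index i = P.index x).card : ℝ) :=
      Nat.cast_pos.2 (Finset.card_pos.2 ⟨x, by simp⟩)
    exact ⟨fun h => by
      by_contra h'
      exact absurd h (not_le.2 (mul_pos h2 (not_le.1 h'))),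
      fun h => mul_nonpos_of_nonneg_of_nonpos h2.le h⟩
  have hval : ∀ b : Fin Q.length,
      (Q.embedding b ⟨0, Q.one_le_blocksFun b⟩ : ℕ) = Q.sizeUpTo b := fun b => by
    rw [Composition.coe_embedding, add_zero]
  constructor
  · intro h a ha hcut
    obtain ⟨b, hb, hba⟩ := exists_sizeUpTo_eq hcut (sizeUpTo_lt ha)
    have h1 := (hsum _).1 (h ⟨b, hb⟩)
    have h2 : (P.index (Q.embedding ⟨b, hb⟩ ⟨0, Q.one_le_blocksFun ⟨b, hb⟩⟩) : ℕ) = a :=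
      index_eq_iff.2 (by rw [hval, hba]; exact ⟨le_rfl, P.sizeUpTo_strict_mono ha⟩)
    rwa [h2] at h1
  · intro h b
    obtain ⟨a, ha, hab⟩ := exists_sizeUpTo_eq (hPQ _ (isCut_sizeUpTo Q b)) (sizeUpTo_lt b.2)
    have h2 : (P.index (Q.embedding b ⟨0, Q.one_le_blocksFun b⟩) : ℕ) = a :=
      index_eq_iff.2 (by rw [hval, ← hab]; exact ⟨le_rfl, P.sizeUpTo_strict_mono ha⟩)
    rw [hsum, h2]
    exact h a ha (hab ▸ isCut_sizeUpTo Q b)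

/-- The class of `δ` contributes to the truncation function of `Q` at `g`. -/
def Contributes (g : GL (Fin n) (AdeleRing (𝓞 F) F)) (P Q : Composition n) (δ : GL (Fin n) F) :
    Prop :=
  IsHarderNarasimhan g P Q δ ∧ ∀ a < P.length, IsCut Q (P.sizeUpTo a) → slope g P δ a ≤ 0

theorem Contributes.congr (h : ∀ k, IsCut P k → flag δ' k = flag δ k)
    (hδ : Contributes g P Q δ) : Contributes g P Q δ' :=
  ⟨hδ.1.congr h, fun a ha hQ => (slope_congr h a).trans_le (hδ.2 a ha hQ)⟩

open scoped Classical in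
theorem term_eq_ite (hPQ : ∀ k, IsCut Q k → IsCut P k) :
    semistable P (toAdelic F n δ * g) *
      tau P Q (harishChandra P (toAdelic F n δ * g)) *
      chi P Q (harishChandra P (toAdelic F n δ * g)) =
    if Contributes g P Q δ then 1 else 0 := by
  have h1 : instabilityDegree P (toAdelic F n δ * g) ≤ 0 ↔ SemistableSteps g P δ :=
    ⟨semistableSteps_of_instabilityDegree_le, instabilityDegree_le_of_semistableSteps⟩
  rw [semistable, tau, chi]
  by_cases a1 : instabilityDegree P (toAdelic F n δ * g) ≤ 0
  · by_cases a2 : ∀ α ∈ simpleRoots P Q, 0 < α ⬝ᵥ harishChandra P (toAdelic F n δ * g)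
    · rw [if_pos a1, if_pos a2, one_mul, one_mul]
      exact if_congr ((forall_sum_nonpos_iff hPQ).trans
        ⟨fun h => ⟨⟨h1.1 a1, forall_simpleRoots_iff.1 a2⟩, h⟩, fun h => h.2⟩) rfl rfl
    · rw [if_neg a2, mul_zero, zero_mul, if_neg fun h => a2 (forall_simpleRoots_iff.2 h.1.2)]
  · rw [if_neg a1, zero_mul, zero_mul, if_neg fun h => a1 (h1.2 h.1.1)]

end Terms

/-! ### Flags attached to the cosets of `P(F)\Q(F)`. -/

section Flags

variable {F : Type*} [Field F] {n : ℕ} {P Q : Composition n}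

theorem antitone_flag_sizeUpTo (P : Composition n) (δ : GL (Fin n) F) :
    Antitone fun a => flag δ (P.sizeUpTo a) :=
  fun _ _ h => flag_antitone δ (P.monotone_sizeUpTo h)

theorem rdim_flag_sizeUpTo (P : Composition n) (δ : GL (Fin n) F) (a : ℕ) :
    rdim (flag δ (P.sizeUpTo a)) = n - P.sizeUpTo a := rdim_flag δ (P.sizeUpTo_le a)

theorem flag_eq_flag_one (δ : parabolic Q F) {k : ℕ} (hk : IsCut Q k) :
    flag δ.1 k = flag (1 : GL (Fin n) F) k :=
  mul_inv_mem_parabolic_iff.1 (by simp) k hk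

theorem mk_eq_mk_iff {δ δ' : parabolic Q F} :
    (Quotient.mk _ δ' : Cosets F P Q) = Quotient.mk _ δ ↔
      ∀ k, IsCut P k → flag δ'.1 k = flag δ.1 k := by
  rw [Quotient.eq, QuotientGroup.rightRel_apply, Subgroup.mem_subgroupOf,
    ← mul_inv_mem_parabolic_iff, ← inv_mem_iff]
  simp

end Flags

/-! ### Uniqueness of the relative Harder-Narasimhan filtration. -/

section Uniqueness

variable {F : Type*} [Field F] [NumberField F] {n : ℕ}
  {g : GL (Fin n) (AdeleRing (𝓞 F) F)} {P P' Q : Composition n} {δ δ' : GL (Fin n) F}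

theorem submodular_height (g : GL (Fin n) (AdeleRing (𝓞 F) F)) : Submodular (height g) :=
  height_inf_add_height_sup_le g

/-- Semistability stated for quotients of a step instead of its subspaces. -/
theorem SemistableSteps.height_sub_le (h : SemistableSteps g P δ) {a : ℕ} (ha : a < P.length)
    {Y : Submodule F (Fin n → F)} (hY : flag δ (P.sizeUpTo (a + 1)) ≤ Y)
    (hY' : Y ≤ flag δ (P.sizeUpTo a)) :
    height g (flag δ (P.sizeUpTo a)) - height g Y ≤
      slope g P δ a * (rdim (flag δ (P.sizeUpTo a)) - rdim Y) := by
  have h1 := h a ha Y hY hY'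
  have h2 := slope_mul (g := g) (δ := δ) ha
  rw [rdim_flag_sizeUpTo] at h1 ⊢
  linarith

theorem IsHarderNarasimhan.slope_lt (h : IsHarderNarasimhan g P Q δ) {A B : ℕ}
    (hB : B ≤ P.length) (hQ : ∀ j, A < j → j < B → ¬ IsCut Q (P.sizeUpTo j)) {j k : ℕ}
    (hAj : A ≤ j) (hjk : j < k) (hkB : k < B) : slope g P δ k < slope g P δ j := by
  induction k, hjk using Nat.le_induction with
  | base => exact h.2 j (by omega) (hQ _ (by omega) hkB)
  | succ k hjk ih =>
    exact (h.2 k (by omega) (hQ _ (by omega) hkB)).trans (ih (by omega))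

/-- The steps of the Harder-Narasimhan filtration are the unique minima of the functions
`V ↦ d V - c dim V`. -/
theorem IsHarderNarasimhan.lt_or_eq (h : IsHarderNarasimhan g P Q δ) {A i B : ℕ}
    (hAi : A ≤ i) (hiB : i ≤ B) (hB : B ≤ P.length) {c : ℝ}
    (h1 : ∀ j, A ≤ j → j < i → c < slope g P δ j) (h2 : ∀ j, i ≤ j → j < B → slope g P δ j < c)
    {X : Submodule F (Fin n → F)} (hX : flag δ (P.sizeUpTo B) ≤ X)
    (hX' : X ≤ flag δ (P.sizeUpTo A)) :
    height g (flag δ (P.sizeUpTo i)) - c * rdim (flag δ (P.sizeUpTo i)) <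
      height g X - c * rdim X ∨ X = flag δ (P.sizeUpTo i) := by
  have hφ := (submodular_height g).sub_mul_rdim c
  have hU := antitone_flag_sizeUpTo P δ
  have hdim : ∀ {Y Z : Submodule F (Fin n → F)}, Y ≤ Z → rdim Y < rdim Z ∨ Y = Z := fun hYZ =>
    (lt_or_eq_of_le (rdim_mono hYZ)).imp_right fun e => eq_of_le_of_rdim_le hYZ e.ge
  -- Larger indices are smaller subspaces: slopes above `c` make `U i` minimal among the larger
  -- subspaces, slopes below `c` among the smaller ones. Submodularity for `X` and `U i` combines
  -- the two.
  have above := hφ.lt_or_eq_of_le hU hAi (fun j hAj hji Y hY hY' => by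
    rcases hdim hY with hlt | rfl
    · left
      have e1 := h.1 j (by omega) Y hY hY'
      have e2 := mul_pos (sub_pos.2 (h1 j hAj hji)) (sub_pos.2 hlt)
      linarith
    · exact Or.inr rfl) (X := X ⊔ flag δ (P.sizeUpTo i)) le_sup_right (sup_le hX' (hU hAi))
  have below := hφ.lt_or_eq_of_ge hU hiB (fun j hij hjB Y hY hY' => by
    rcases hdim hY' with hlt | rfl
    · left
      have e1 := h.1.height_sub_le (by omega) hY hY'
      have e2 := mul_pos (sub_pos.2 (h2 j hij hjB)) (sub_pos.2 hlt)
      linarith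
    · exact Or.inr rfl) (X := X ⊓ flag δ (P.sizeUpTo i)) inf_le_right (le_inf hX (hU hiB))
  have hsub := hφ X (flag δ (P.sizeUpTo i))
  simp only at above below hsub
  rcases above with above | above
  · left
    rcases below with below | below
    · linarith
    · rw [below] at hsub
      linarith
  · rw [above] at hsub
    rcases below with below | below
    · left
      linarith
    · exact Or.inr (le_antisymm (sup_eq_right.1 above) (inf_eq_right.1 below))

theorem exists_consecutive_cuts {c : ℕ} (hc : ¬ IsCut Q c) (hcn : c ≤ n) :
    ∃ K L, IsCut Q K ∧ IsCut Q L ∧ K < c ∧ c < L ∧ ∀ k, K < k → k < L → ¬ IsCut Q k := by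
  have hcn' : c < n := lt_of_le_of_ne hcn fun h => hc (h ▸ isCut_self Q)
  let x : Fin n := ⟨c, hcn'⟩
  refine ⟨_, _, isCut_sizeUpTo Q (Q.index x), isCut_sizeUpTo Q (Q.index x + 1), ?_,
    lt_sizeUpTo_index_succ Q x, ?_⟩
  · exact lt_of_le_of_ne (Q.sizeUpTo_index_le x) fun h => hc (by
      rw [show c = Q.sizeUpTo (Q.index x) from h.symm]
      exact isCut_sizeUpTo Q _)
  · rintro _ h1 h2 ⟨b, -, rfl⟩
    rcases Nat.lt_or_ge (Q.index x) b with hb | hb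
    · exact h2.not_ge (Q.monotone_sizeUpTo hb)
    · exact h1.not_ge (Q.monotone_sizeUpTo hb)

/-- Between consecutive cuts of `Q`, each step of a filtration is the unique minimum of `V ↦ height
V - c * dim V` for a suitable real `c`. The other filtration also contains a minimum for the same
`c`, so the two subspaces agree. -/
theorem IsHarderNarasimhan.isCut_and_flag_eq (h : IsHarderNarasimhan g P Q δ)
    (h' : IsHarderNarasimhan g P' Q δ') (hP : ∀ k, IsCut Q k → IsCut P k)
    (hP' : ∀ k, IsCut Q k → IsCut P' k) (hflag : ∀ k, IsCut Q k → flag δ' k = flag δ k) {c : ℕ}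
    (hc : IsCut P c) : IsCut P' c ∧ flag δ' c = flag δ c := by
  by_cases hcQ : IsCut Q c
  · exact ⟨hP' c hcQ, hflag c hcQ⟩
  obtain ⟨K, L, hK, hL, hKc, hcL, hKL⟩ := exists_consecutive_cuts hcQ hc.le
  obtain ⟨i, hi, rfl⟩ := hc
  obtain ⟨A, hA, hAK⟩ := hP K hK
  obtain ⟨B, hB, hBL⟩ := hP L hL
  obtain ⟨A', hA', hAK'⟩ := hP' K hK
  obtain ⟨B', hB', hBL'⟩ := hP' L hL
  have hAi : A < i := P.monotone_sizeUpTo.reflect_lt (hAK ▸ hKc)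
  have hiB : i < B := P.monotone_sizeUpTo.reflect_lt (hBL ▸ hcL)
  have hAB' : A' < B' := P'.monotone_sizeUpTo.reflect_lt (by omega)
  have hcuts : ∀ j, A < j → j < B → ¬ IsCut Q (P.sizeUpTo j) := fun j h1 h2 =>
    hKL _ (by
      have := P.sizeUpTo_strict_mono (show A < P.length by omega)
      have := P.monotone_sizeUpTo (show A + 1 ≤ j from h1)
      omega) (by
      have := P.sizeUpTo_strict_mono (show j < P.length by omega)
      have := P.monotone_sizeUpTo (show j + 1 ≤ B from h2)
      omega)
  have hcuts' : ∀ j, A' < j → j < B' → ¬ IsCut Q (P'.sizeUpTo j) := fun j h1 h2 =>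
    hKL _ (by
      have := P'.sizeUpTo_strict_mono (show A' < P'.length by omega)
      have := P'.monotone_sizeUpTo (show A' + 1 ≤ j from h1)
      omega) (by
      have := P'.sizeUpTo_strict_mono (show j < P'.length by omega)
      have := P'.monotone_sizeUpTo (show j + 1 ≤ B' from h2)
      omega)
  -- `c` is now a real number strictly between the slopes on the two sides of step `i`, and
  -- different from the finitely many slopes of the other flag.
  obtain ⟨c, hc, hcs⟩ := (Set.Ioo_infinite (h.slope_lt hB hcuts (show A ≤ i - 1 by omega)
    (show i - 1 < i by omega) hiB)).exists_notMem_finset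
    ((Finset.range B').image (slope g P' δ'))
  have hcs : ∀ j < B', slope g P' δ' j ≠ c := fun j hj e =>
    hcs (Finset.mem_image.2 ⟨j, Finset.mem_range.2 hj, e⟩)
  have hex : ∃ i', A' ≤ i' ∧ (i' = B' ∨ slope g P' δ' i' < c) := ⟨B', hAB'.le, Or.inl rfl⟩
  classical
  -- `i'` is the first place where the slopes of the other flag fall below `c`, or the end `B'` if
  -- they never do.
  obtain ⟨i', hi', hmin⟩ : ∃ i', (A' ≤ i' ∧ (i' = B' ∨ slope g P' δ' i' < c)) ∧
      ∀ j < i', ¬ (A' ≤ j ∧ (j = B' ∨ slope g P' δ' j < c)) :=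
    ⟨Nat.find hex, Nat.find_spec hex, fun j hj => Nat.find_min hex hj⟩
  have hiB' : i' ≤ B' := not_lt.1 fun hlt => hmin B' hlt ⟨hAB'.le, Or.inl rfl⟩
  have key := fun X => h.lt_or_eq hAi.le hiB.le hB (c := c) (X := X)
    (fun j hAj hji => by
      rcases eq_or_lt_of_le (show j ≤ i - 1 by omega) with rfl | hj
      · exact hc.2
      · exact hc.2.trans (h.slope_lt hB hcuts hAj hj (by omega)))
    (fun j hij hjB => by
      rcases eq_or_lt_of_le hij with rfl | hj
      · exact hc.1
      · exact (h.slope_lt hB hcuts hAi.le hj hjB).trans hc.1)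
  have key' := fun X => h'.lt_or_eq hi'.1 hiB' hB' (c := c) (X := X)
    (fun j hAj hji => by
      have e1 : ¬ slope g P' δ' j < c := fun e => hmin j hji ⟨hAj, Or.inr e⟩
      exact lt_of_le_of_ne (not_lt.1 e1) (hcs j (by omega)).symm)
    (fun j hij hjB => by
      have e1 : slope g P' δ' i' < c := hi'.2.resolve_left (by omega)
      rcases eq_or_lt_of_le hij with rfl | hj
      · exact e1
      · exact (h'.slope_lt hB' hcuts' hi'.1 hj hjB).trans e1)
  rw [hAK, hBL] at key
  rw [hAK', hBL', hflag K hK, hflag L hL] at key'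
  have e1 := key (flag δ' (P'.sizeUpTo i'))
    (by rw [← hflag L hL, ← hBL']; exact antitone_flag_sizeUpTo P' δ' hiB')
    (by rw [← hflag K hK, ← hAK']; exact antitone_flag_sizeUpTo P' δ' hi'.1)
  have e2 := key' (flag δ (P.sizeUpTo i))
    (by rw [← hBL]; exact antitone_flag_sizeUpTo P δ hiB.le)
    (by rw [← hAK]; exact antitone_flag_sizeUpTo P δ hAi.le)
  have e3 : flag δ' (P'.sizeUpTo i') = flag δ (P.sizeUpTo i) := by
    rcases e1 with e1 | e1
    · rcases e2 with e2 | e2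
      · exact absurd e1 e2.not_gt
      · exact e2.symm
    · exact e1
  have e4 := congrArg (fun V : Submodule F (Fin n → F) => Module.finrank F V) e3
  simp only [finrank_flag] at e4
  have e5 : P'.sizeUpTo i' = P.sizeUpTo i := by
    have := P'.sizeUpTo_le i'
    have := P.sizeUpTo_le i
    omega
  exact ⟨e5 ▸ isCut_sizeUpTo P' i', e5 ▸ e3⟩

open scoped Classical in
theorem truncation_eq (Q : Composition n) (g : GL (Fin n) (AdeleRing (𝓞 F) F)) :
    truncation Q g = ∑ P : Composition n with parabolic P F ≤ parabolic Q F,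
      ∑' δ : Cosets F P Q, if Contributes g P Q δ.out.1 then (1 : ℝ≥0∞) else 0 := by
  rw [truncation]
  refine Finset.sum_congr rfl fun P hP => tsum_congr fun δ => ?_
  exact term_eq_ite (parabolic_le_iff.1 (Finset.mem_filter.1 hP).2)

/-- Two contributing terms have the same cuts and the same flags, hence the same `P` and the same
coset. -/
theorem truncation_le_one (Q : Composition n) (g : GL (Fin n) (AdeleRing (𝓞 F) F)) :
    truncation Q g ≤ 1 := by
  classical
  rw [truncation_eq]
  by_cases hex : ∃ P, parabolic P F ≤ parabolic Q F ∧ ∃ δ : Cosets F P Q, Contributes g P Q δ.out.1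
  · obtain ⟨P, hP, δ, hδ⟩ := hex
    have key : ∀ P', parabolic P' F ≤ parabolic Q F → ∀ δ' : Cosets F P' Q,
        Contributes g P' Q δ'.out.1 → (∀ k, IsCut P' k ↔ IsCut P k) ∧
          ∀ k, IsCut P k → flag δ'.out.1 k = flag δ.out.1 k := by
      intro P' hP' δ' hδ'
      rw [parabolic_le_iff] at hP hP'
      have hflag : ∀ k, IsCut Q k → flag δ'.out.1 k = flag δ.out.1 k := fun k hk =>
        (flag_eq_flag_one _ hk).trans (flag_eq_flag_one _ hk).symm
      exact ⟨fun k => ⟨fun hk => (hδ'.1.isCut_and_flag_eq hδ.1 hP' hP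
          (fun k hk => (hflag k hk).symm) hk).1,
        fun hk => (hδ.1.isCut_and_flag_eq hδ'.1 hP hP' hflag hk).1⟩,
        fun k hk => (hδ.1.isCut_and_flag_eq hδ'.1 hP hP' hflag hk).2⟩
    rw [Finset.sum_eq_single P, tsum_eq_single δ]
    · exact (if_pos hδ).le
    · intro δ' hne
      refine if_neg fun hδ' => hne ?_
      rw [← Quotient.out_eq δ', ← Quotient.out_eq δ, mk_eq_mk_iff]
      exact (key P hP δ' hδ').2
    · intro P' hP' hne
      refine ENNReal.tsum_eq_zero.2 fun δ' => if_neg fun hδ' => hne ?_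
      exact composition_ext (key P' (Finset.mem_filter.1 hP').2 δ' hδ').1
    · exact fun hn => (hn (by simpa using hP)).elim
  · push Not at hex
    rw [Finset.sum_eq_zero]
    · exact zero_le_one
    · exact fun P hP => ENNReal.tsum_eq_zero.2 fun δ =>
        if_neg (hex P (Finset.mem_filter.1 hP).2 δ)

theorem exists_contributes_of_truncation_ne_zero (h : truncation Q g ≠ 0) :
    ∃ P, (∀ k, IsCut Q k → IsCut P k) ∧ ∃ δ : parabolic Q F, Contributes g P Q δ.1 := by
  classical
  rw [truncation_eq] at h
  obtain ⟨P, hP, hP'⟩ := Finset.exists_ne_zero_of_sum_ne_zero h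
  obtain ⟨δ, hδ⟩ := not_forall.1 (mt ENNReal.tsum_eq_zero.2 hP')
  exact ⟨P, parabolic_le_iff.1 (Finset.mem_filter.1 hP).2, δ.out,
    by_contra fun hn => hδ (if_neg hn)⟩

theorem one_le_truncation (hP : ∀ k, IsCut Q k → IsCut P k) (δ : parabolic Q F)
    (hδ : Contributes g P Q δ.1) : 1 ≤ truncation Q g := by
  classical
  rw [truncation_eq]
  have h1 : Contributes g P Q (Quotient.mk _ δ : Cosets F P Q).out.1 :=
    hδ.congr (mk_eq_mk_iff.1 (Quotient.out_eq _))
  calc (1 : ℝ≥0∞) = if Contributes g P Q (Quotient.mk _ δ : Cosets F P Q).out.1 then 1 else 0 :=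
        (if_pos h1).symm
    _ ≤ ∑' δ : Cosets F P Q, if Contributes g P Q δ.out.1 then (1 : ℝ≥0∞) else 0 :=
        ENNReal.le_tsum (f := fun δ : Cosets F P Q =>
          if Contributes g P Q δ.out.1 then (1 : ℝ≥0∞) else 0) _
    _ ≤ _ := Finset.single_le_sum (f := fun P => ∑' δ : Cosets F P Q,
          if Contributes g P Q δ.out.1 then (1 : ℝ≥0∞) else 0) (fun _ _ => zero_le)
          (Finset.mem_filter.2 ⟨Finset.mem_univ P, parabolic_le_iff.2 hP⟩)

end Uniqueness

/-! ### Nonvanishing of the truncation function and minimality of the height of the full space. -/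

section Existence

theorem isCut_single_iff {n : ℕ} (hn : 0 < n) {k : ℕ} :
    IsCut (Composition.single n hn) k ↔ k = 0 ∨ k = n := by
  constructor
  · rintro ⟨a, ha, rfl⟩
    rw [Composition.single_length] at ha
    interval_cases a
    · exact Or.inl (Composition.sizeUpTo_zero _)
    · exact Or.inr ((Composition.single n hn).sizeUpTo_length)
  · rintro (rfl | rfl)
    · exact isCut_zero _
    · exact isCut_self _

theorem mem_parabolic_single {R : Type*} [CommRing R] {n : ℕ} (hn : 0 < n) (g : GL (Fin n) R) :
    g ∈ parabolic (Composition.single n hn) R := by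
  rw [mem_parabolic_iff]
  intro k hk i j hi hj
  rcases (isCut_single_iff hn).1 hk with rfl | rfl
  · exact absurd (Nat.zero_le _) hj
  · exact absurd hi (not_le.2 i.2)

variable {F : Type*} [Field F] [NumberField F] {n : ℕ}
  {g : GL (Fin n) (AdeleRing (𝓞 F) F)}

/-- The Harder-Narasimhan filtration of the full space supplies the term. The hypothesis makes its
last slope, which is the largest, nonpositive, as required by `χ`. -/
theorem one_le_truncationGL (hn : 0 < n) (h : ∀ Y, height g ⊤ ≤ height g Y) :
    1 ≤ truncationGL hn g := by
  obtain ⟨r, U, c, hU0, hUr, hlt, hslope, hsemi, hc⟩ := (submodular_height g).exists_filtration ⊥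
  have hfin : ∀ V : Submodule F (Fin n → F), Module.finrank F V ≤ n := fun V => by
    simpa using Submodule.finrank_le V
  have hmono : ∀ i j, i ≤ j → j ≤ r → U i ≤ U j := by
    intro i j hij
    induction j, hij using Nat.le_induction with
    | base => exact fun _ => le_rfl
    | succ j hij ih => exact fun hj => (ih (by omega)).trans (hlt j (by omega)).le
  have hdim : ∀ i j, i < j → j ≤ r → Module.finrank F (U i) < Module.finrank F (U j) :=
    fun i j hij hj => (Submodule.finrank_lt_finrank_of_lt (hlt i (by omega))).trans_le
      (Submodule.finrank_mono (hmono (i + 1) j hij hj))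
  obtain ⟨δ, hδ⟩ := exists_flag_eq_of_isChain {V | ∃ j ≤ r, V = U j} (by
    rintro _ ⟨i, hi, rfl⟩ _ ⟨j, hj, rfl⟩ -
    exact (le_total i j).imp (fun h => hmono _ _ h hj) fun h => hmono _ _ h hi)
  have hδ : ∀ j ≤ r, flag δ (n - Module.finrank F (U j)) = U j := fun j hj => hδ _ ⟨j, hj, rfl⟩
  obtain ⟨P, hP⟩ := exists_composition (n := n) {k | ∃ j ≤ r, k = n - Module.finrank F (U j)}
    ⟨r, le_rfl, by rw [hUr, finrank_top, Module.finrank_fin_fun, Nat.sub_self]⟩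
    ⟨0, Nat.zero_le _, by rw [hU0, finrank_bot, Nat.sub_zero]⟩ (by
      rintro _ ⟨j, -, rfl⟩
      exact Nat.sub_le _ _)
  -- The filtration increases while the flag decreases, so the numbering is reversed: step `a` of
  -- the flag goes from `U (j + 1)` down to `U j`.
  have hstep : ∀ a < P.length, ∃ j < r, P.sizeUpTo a = n - Module.finrank F (U (j + 1)) ∧
      P.sizeUpTo (a + 1) = n - Module.finrank F (U j) := by
    intro a ha
    have h1 := P.sizeUpTo_strict_mono ha
    obtain ⟨i, hi, hia⟩ := (hP _).1 (isCut_sizeUpTo P a)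
    obtain ⟨j, hj, hja⟩ := (hP _).1 (isCut_sizeUpTo P (a + 1))
    have hji : j < i := by
      by_contra hle
      have := Submodule.finrank_mono (hmono i j (not_lt.1 hle) hj)
      omega
    refine ⟨j, by omega, ?_, hja⟩
    rcases eq_or_lt_of_le (show j + 1 ≤ i from hji) with rfl | hlt'
    · exact hia
    · obtain ⟨b, -, hb⟩ := (hP (n - Module.finrank F (U (j + 1)))).2 ⟨j + 1, by omega, rfl⟩
      have h2 := hdim j (j + 1) (by omega) (by omega)
      have h3 := hdim (j + 1) i hlt' hi
      have h4 := hfin (U i)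
      have h5 : a < b := P.monotone_sizeUpTo.reflect_lt (by omega)
      have h6 : b < a + 1 := P.monotone_sizeUpTo.reflect_lt (by omega)
      omega
  have hslope' : ∀ a < P.length, ∀ j < r, P.sizeUpTo a = n - Module.finrank F (U (j + 1)) →
      P.sizeUpTo (a + 1) = n - Module.finrank F (U j) → slope g P δ a = c j := by
    intro a ha j hj h1 h2
    have h3 := slope_mul (g := g) (δ := δ) ha
    have h4 := hslope j hj
    have h5 := rdim_lt (hlt j hj)
    have h6 := rdim_flag_sizeUpTo P δ a
    have h7 := rdim_flag_sizeUpTo P δ (a + 1)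
    rw [h1, h2, hδ _ hj, hδ _ hj.le] at h3
    rw [h1, hδ _ hj] at h6
    rw [h2, hδ _ hj.le] at h7
    have h8 : slope g P δ a * (rdim (U (j + 1)) - rdim (U j)) =
        c j * (rdim (U (j + 1)) - rdim (U j)) := by
      rw [← h4, ← h3, h6, h7]
      ring
    exact mul_right_cancel₀ (by linarith) h8
  refine one_le_truncation (P := P) (fun k hk => ?_) ⟨δ, mem_parabolic_single hn δ⟩ ⟨⟨?_, ?_⟩, ?_⟩
  · rcases (isCut_single_iff hn).1 hk with rfl | rfl
    · exact isCut_zero P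
    · exact isCut_self P
  · intro a ha Y hY hY'
    obtain ⟨j, hj, h1, h2⟩ := hstep a ha
    simp only [hslope' a ha j hj h1 h2]
    rw [h2, hδ _ hj.le] at hY ⊢
    rw [h1, hδ _ hj] at hY'
    exact hsemi j hj Y hY hY'
  · intro a ha _
    obtain ⟨j, hj, h1, h2⟩ := hstep a (by omega)
    obtain ⟨i, hi, h3, h4⟩ := hstep (a + 1) ha
    have hij : i + 1 = j := by
      have h5 := hfin (U j)
      have h6 := hfin (U (i + 1))
      rcases lt_trichotomy (i + 1) j with h | h | h
      · have := hdim _ _ h hj.le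
        omega
      · exact h
      · have := hdim _ _ h hi
        omega
    subst hij
    simp only [hslope' a (by omega) _ hj h1 h2, hslope' (a + 1) ha i hi h3 h4]
    exact hc i hj
  · intro a ha hcut
    obtain ⟨j, hj, h1, h2⟩ := hstep a ha
    have h3 := hslope j hj
    have h4 := rdim_lt (hlt j hj)
    simp only [hslope' a ha j hj h1 h2]
    -- For the full group the only cut at the beginning of a block is `0`, so this is the top step
    -- of the filtration.
    have h5 : U (j + 1) = ⊤ := by
      rw [← hδ _ hj, ← h1, (((isCut_single_iff hn).1 hcut).resolve_right (sizeUpTo_lt ha).ne),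
        flag_zero]
    rw [h5] at h3 h4
    by_contra hpos
    have := mul_pos (not_le.1 hpos) (show 0 < rdim (⊤ : Submodule F (Fin n → F)) - rdim (U j) by
      linarith)
    linarith [h (U j)]

variable {Q : Composition n}

/-- Inside a block of `Q` the slopes decrease from a first one that is nonpositive, so all are
nonpositive. Each semistable step then has minimal height at its top, and submodularity glues the
steps. -/
theorem height_flag_le_of_truncation_ne_zero (h : truncation Q g ≠ 0) {b : ℕ} (hb : b < Q.length)
    {Y : Submodule F (Fin n → F)} (hY : flag 1 (Q.sizeUpTo (b + 1)) ≤ Y)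
    (hY' : Y ≤ flag 1 (Q.sizeUpTo b)) : height g (flag 1 (Q.sizeUpTo b)) ≤ height g Y := by
  obtain ⟨P, hP, δ, hδ⟩ := exists_contributes_of_truncation_ne_zero h
  have hlt := Q.sizeUpTo_strict_mono hb
  obtain ⟨A, hA, hAb⟩ := hP _ (isCut_sizeUpTo Q b)
  obtain ⟨B, hB, hBb⟩ := hP _ (isCut_sizeUpTo Q (b + 1))
  have hAB : A < B := P.monotone_sizeUpTo.reflect_lt (by omega)
  have hcuts : ∀ j, A < j → j < B → ¬ IsCut Q (P.sizeUpTo j) := by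
    rintro j h1 h2 ⟨e, -, he⟩
    have h3 := P.sizeUpTo_strict_mono (show A < P.length by omega)
    have h4 := P.monotone_sizeUpTo (show A + 1 ≤ j from h1)
    have h5 := P.sizeUpTo_strict_mono (show j < P.length by omega)
    have h6 := P.monotone_sizeUpTo (show j + 1 ≤ B from h2)
    have h7 : b < e := Q.monotone_sizeUpTo.reflect_lt (by omega)
    have h8 : e < b + 1 := Q.monotone_sizeUpTo.reflect_lt (by omega)
    omega
  have hslope : ∀ j, A ≤ j → j < B → slope g P δ j ≤ 0 := by
    intro j hAj hjB
    have h0 := hδ.2 A (by omega) (hAb ▸ isCut_sizeUpTo Q b)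
    rcases eq_or_lt_of_le hAj with rfl | hAj
    · exact h0
    · exact (hδ.1.slope_lt hB hcuts le_rfl hAj hjB).le.trans h0
  rw [← flag_eq_flag_one δ (isCut_sizeUpTo Q _), ← hAb] at hY' ⊢
  rw [← flag_eq_flag_one δ (isCut_sizeUpTo Q _), ← hBb] at hY
  refine (submodular_height g).le_of_ge (antitone_flag_sizeUpTo P δ.1) hAB.le
    (fun j hj hjB Y hY hY' => ?_) hY' hY
  have h1 := hδ.1.1.height_sub_le (by omega) hY hY'
  have h2 := mul_nonpos_of_nonpos_of_nonneg (hslope j hj hjB) (sub_nonneg.2 (rdim_mono hY'))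
  linarith

/-- The same gluing, now along the standard flag of type `Q`. -/
theorem height_top_le_of_truncation_ne_zero (h : truncation Q g ≠ 0)
    (Y : Submodule F (Fin n → F)) : height g ⊤ ≤ height g Y := by
  have := (submodular_height g).le_of_ge (antitone_flag_sizeUpTo Q (1 : GL (Fin n) F))
    (Nat.zero_le Q.length) (fun b _ hb Y hY hY' => height_flag_le_of_truncation_ne_zero h hb hY hY')
    (X := Y) (by rw [Q.sizeUpTo_zero, flag_zero]; exact le_top)
    (by rw [Q.sizeUpTo_length, flag_of_le _ le_rfl]; exact bot_le)
  rwa [Q.sizeUpTo_zero, flag_zero] at this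

end Existence

/-! ### Levi and unipotent subgroups: conjugation, base change, compact elements. -/

section LeviUnipotent

variable {R : Type*} [CommRing R] {n : ℕ} {P : Composition n}

theorem inv_mul_mul_mem_unipotentRadical {u y : GL (Fin n) R} (hu : u ∈ unipotentRadical P R)
    (hy : y ∈ parabolic P R) : y⁻¹ * u * y ∈ unipotentRadical P R := by
  intro i j hij
  have h1 : (y⁻¹ * u * y).val = (y⁻¹).val * (u.val - 1) * y.val + 1 := by
    rw [Matrix.mul_sub, Matrix.sub_mul, Matrix.mul_one, y.inv_mul, sub_add_cancel]
    rfl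
  rw [h1, Matrix.add_apply, Matrix.mul_apply, Finset.sum_eq_zero, zero_add]
  intro z _
  rw [Matrix.mul_apply, Finset.sum_mul, Finset.sum_eq_zero]
  intro x _
  by_cases hx : P.index x < P.index i
  · rw [inv_mem hy hx, zero_mul, zero_mul]
  by_cases hz : P.index j < P.index z
  · rw [show y.val z j = 0 from hy hz, mul_zero]
  · rw [Matrix.sub_apply, hu x z ((not_lt.1 hz).trans (hij.trans (not_lt.1 hx))), sub_self,
      mul_zero, zero_mul]

theorem map_levi {S : Type*} [CommRing S] (f : R →+* S)
    (m : ∀ i : Fin P.length, GL (Fin (P.blocksFun i)) R) :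
    Matrix.GeneralLinearGroup.map f (levi P R m) =
      levi P S fun i => Matrix.GeneralLinearGroup.map f (m i) := by
  refine Units.ext ?_
  rw [levi_val]
  change (levi P R m).val.map f = _
  rw [levi_val, Matrix.reindex_apply, Matrix.reindex_apply, ← Matrix.submatrix_map,
    Matrix.blockDiagonal'_map _ _ (map_zero f)]
  rfl

variable {F : Type*} [Field F] [NumberField F]

theorem one_mem_maxCompact : (1 : GL (Fin n) (AdeleRing (𝓞 F) F)) ∈ maxCompact F n := by
  have h := permGL_mem_maxCompact (F := F) (1 : Equiv.Perm (Fin n))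
  rw [← mul_inv_cancel (permGL (AdeleRing (𝓞 F) F) (1 : Equiv.Perm (Fin n)))]
  exact maxCompact_mul h (maxCompact_inv h)

theorem levi_mem_maxCompact {k : ∀ i : Fin P.length, GL (Fin (P.blocksFun i)) (AdeleRing (𝓞 F) F)}
    (hk : ∀ i, k i ∈ maxCompact F _) : levi P (AdeleRing (𝓞 F) F) k ∈ maxCompact F n := by
  have hint : ∀ (v : IsDedekindDomain.HeightOneSpectrum (𝓞 F))
      (m : ∀ i : Fin P.length, GL (Fin (P.blocksFun i)) (AdeleRing (𝓞 F) F)),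
      (∀ i s t, finiteComponent F v ((m i).val s t) ∈ v.adicCompletionIntegers F) →
      ∀ x y, finiteComponent F v ((levi P (AdeleRing (𝓞 F) F) m).val x y) ∈
        v.adicCompletionIntegers F := by
    intro v m hm x y
    obtain ⟨a, s, rfl⟩ := exists_embedding_eq (P := P) x
    obtain ⟨b, t, rfl⟩ := exists_embedding_eq (P := P) y
    by_cases hab : a = b
    · subst hab
      rw [levi_apply_embedding]
      exact hm a s t
    · rw [levi_apply_of_ne P m (by rwa [index_embedding_eq, index_embedding_eq]), map_zero]
      exact zero_mem _
  rw [mem_maxCompact_iff]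
  refine ⟨fun v x y => ⟨?_, ?_⟩, fun v => ?_⟩
  · exact hint v k (fun i s t => ((mem_maxCompact_iff.1 (hk i)).1 v s t).1) x y
  · rw [← map_inv]
    exact hint v k⁻¹ (fun i s t => ((mem_maxCompact_iff.1 (hk i)).1 v s t).2) x y
  · rw [levi_val, Matrix.reindex_apply, ← Matrix.submatrix_map,
      Matrix.blockDiagonal'_map _ _ (map_zero _), Matrix.mem_unitaryGroup_iff,
      Matrix.star_eq_conjTranspose, Matrix.conjTranspose_submatrix,
      Matrix.blockDiagonal'_conjTranspose, Matrix.submatrix_mul_equiv, ← Matrix.blockDiagonal'_mul]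
    have h1 : (fun i => (k i).val.map (complexComponent v) *
        ((k i).val.map (complexComponent v)).conjTranspose) = 1 :=
      funext fun i => Matrix.mem_unitaryGroup_iff.1 ((mem_maxCompact_iff.1 (hk i)).2 v)
    rw [h1, Matrix.blockDiagonal'_one, Matrix.submatrix_one_equiv]

end LeviUnipotent

/-! ### Comparison of heights for `p` and for its first diagonal block. -/

section FirstBlock

variable {R : Type*} [CommRing R] {n : ℕ} {P : Composition n} {a : Fin P.length}

theorem embedding_val (ha : (a : ℕ) = 0) (s : Fin (P.blocksFun a)) :
    (P.embedding a s : ℕ) = s := by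
  rw [Composition.coe_embedding, ha, P.sizeUpTo_zero, zero_add]

theorem levi_apply_of_eq_one (ha : (a : ℕ) = 0)
    {m : ∀ i : Fin P.length, GL (Fin (P.blocksFun i)) R} (hm : m a = 1) {k : ℕ}
    (hk : k ≤ P.blocksFun a) {x y : Fin n} (hy : (y : ℕ) < k) :
    (levi P R m).val x y = (1 : Matrix (Fin n) (Fin n) R) x y := by
  have hy' : P.embedding a ⟨y, by omega⟩ = y := Fin.ext (embedding_val ha _)
  obtain ⟨b, s, rfl⟩ := exists_embedding_eq (P := P) x
  rw [← hy']
  by_cases hab : b = a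
  · subst hab
    rw [levi_apply_embedding, hm, Units.val_one, Matrix.one_apply, Matrix.one_apply]
    exact if_congr (P.embedding b).injective.eq_iff.symm rfl rfl
  · have h1 : P.index (P.embedding b s) ≠ P.index (P.embedding a ⟨y, by omega⟩) := by
      rwa [index_embedding_eq, index_embedding_eq]
    rw [levi_apply_of_ne P m h1, Matrix.one_apply_ne fun h => h1 (congrArg _ h)]

theorem minor_levi_of_eq_one (ha : (a : ℕ) = 0)
    {m : ∀ i : Fin P.length, GL (Fin (P.blocksFun i)) R} (hm : m a = 1) {k : ℕ}
    (hk : k ≤ P.blocksFun a) :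
    RowInvariant (fun x : Fin n => k ≤ x) (levi P R m).val ∧
    minor (fun x : Fin n => k ≤ x) (levi P R m).val = (levi P R m).val.det := by
  have h1 : RowInvariant (fun x : Fin n => k ≤ x) (levi P R m).val := fun x y hx hy => by
    rw [levi_apply_of_eq_one ha hm hk (not_le.1 hy), Matrix.one_apply_ne]
    rintro rfl
    exact hy hx
  refine ⟨h1, ?_⟩
  rw [Matrix.twoBlockTriangular_det' _ (fun x : Fin n => k ≤ x) fun x hx y hy => h1 x y hx hy]
  have h2 : ((levi P R m).val.toSquareBlockProp fun x : Fin n => ¬ k ≤ x) = 1 := by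
    ext x y
    have := levi_apply_of_eq_one ha hm hk (x := x.1) (not_le.1 y.2)
    rw [Matrix.toSquareBlockProp, Matrix.toBlock_apply, this, Matrix.one_apply, Matrix.one_apply]
    exact if_congr Subtype.ext_iff.symm rfl rfl
  rw [h2, Matrix.det_one, mul_one, minor]

variable {F : Type*} [Field F] [NumberField F]

/-- An element triangularizing `m a`, placed in the block `a`, triangularizes the whole product: it
conjugates `u` into the unipotent radical. The diagonal entries outside the first block equal one.
-/
theorem logVol_levi_of_eq_one_mul (ha : (a : ℕ) = 0)
    {m : ∀ i : Fin P.length, GL (Fin (P.blocksFun i)) (AdeleRing (𝓞 F) F)}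
    (hm : ∀ i ≠ a, m i = 1) {u : GL (Fin n) (AdeleRing (𝓞 F) F)}
    (hu : u ∈ unipotentRadical P (AdeleRing (𝓞 F) F)) {k : ℕ} (hk : k ≤ P.blocksFun a) :
    logVol k (levi P (AdeleRing (𝓞 F) F) m * u) = logVol k (m a) := by
  obtain ⟨κ, hκ, hupper⟩ := exists_maxCompact_mul_upperTriangular (m a)
  let y : ∀ i : Fin P.length, GL (Fin (P.blocksFun i)) (AdeleRing (𝓞 F) F) :=
    Function.update 1 a κ
  have hya : y a = κ := Function.update_self ..
  have hyb : ∀ b ≠ a, y b = 1 := fun b hb => Function.update_of_ne hb ..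
  have hy : levi P (AdeleRing (𝓞 F) F) y ∈ maxCompact F n := levi_mem_maxCompact fun i => by
    by_cases hi : i = a
    · subst hi
      rwa [hya]
    · rw [hyb i hi]
      exact one_mem_maxCompact
  obtain ⟨u', hu'⟩ : ∃ u', u' = (levi P (AdeleRing (𝓞 F) F) y)⁻¹ * u * levi P _ y := ⟨_, rfl⟩
  have hu'N : u' ∈ unipotentRadical P (AdeleRing (𝓞 F) F) :=
    hu' ▸ inv_mul_mul_mem_unipotentRadical hu (levi_mem_parabolic P y)
  have h1 : levi P (AdeleRing (𝓞 F) F) m * u * levi P _ y = levi P _ (m * y) * u' := by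
    rw [hu', map_mul]
    group
  have hmya : (m * y) a = m a * κ := by rw [Pi.mul_apply, hya]
  have hmyb : ∀ b ≠ a, (m * y) b = 1 := fun b hb => by
    rw [Pi.mul_apply, hm b hb, hyb b hb, one_mul]
  have h2 : ∀ i j, j < i → (levi P (AdeleRing (𝓞 F) F) (m * y)).val i j = 0 := by
    intro i j hij
    obtain ⟨b, s, rfl⟩ := exists_embedding_eq (P := P) i
    obtain ⟨c, t, rfl⟩ := exists_embedding_eq (P := P) j
    by_cases hbc : b = c
    · subst hbc
      rw [levi_apply_embedding]
      have hts : t < s := (P.embedding b).lt_iff_lt.1 hij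
      by_cases hb : b = a
      · subst hb
        rw [hmya]
        exact hupper s t hts
      · rw [hmyb b hb, Units.val_one, Matrix.one_apply_ne hts.ne']
    · exact levi_apply_of_ne P _ (by rwa [index_embedding_eq, index_embedding_eq])
  have h3 := rowInvariant_of_upperTriangular h2 k
  have h4 := rowInvariant_of_upperTriangular
    (fun i j hij => unipotentRadical_apply_eq_zero hu'N hij) k
  rw [logVol_eq hy (by rw [h1]; exact h3.mul h4), h1, Units.val_mul, minor_mul h3,
    minor_unipotentRadical hu'N, mul_one, logAbs_minor_of_upperTriangular h2,
    logVol_eq_sum hκ hupper]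
  symm
  refine Finset.sum_of_injOn (P.embedding a) (P.embedding a).injective.injOn ?_ ?_ ?_
  · intro s hs
    simpa [embedding_val ha] using hs
  · intro x hx hx'
    obtain ⟨b, s, rfl⟩ := exists_embedding_eq (P := P) x
    by_cases hb : b = a
    · subst hb
      refine absurd ⟨s, ?_, rfl⟩ hx'
      simpa [embedding_val ha] using hx
    · rw [levi_apply_embedding, hmyb b hb, Units.val_one, Matrix.one_apply_eq, logAbs_one]
  · intro s _
    rw [levi_apply_embedding, hmya]

/-- The Levi element is split into its part outside the first block, which contributes a determinant
independent of `k`, and its first block. -/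
theorem logVol_levi_mul_of_le (ha : (a : ℕ) = 0)
    (m : ∀ i : Fin P.length, GL (Fin (P.blocksFun i)) (AdeleRing (𝓞 F) F))
    {u : GL (Fin n) (AdeleRing (𝓞 F) F)}
    (hu : u ∈ unipotentRadical P (AdeleRing (𝓞 F) F)) {k : ℕ} (hk : k ≤ P.blocksFun a) :
    logVol k (levi P (AdeleRing (𝓞 F) F) m * u) =
      logAbs (levi P (AdeleRing (𝓞 F) F) (Function.update m a 1)).val.det + logVol k (m a) := by
  have h1 : m = Function.update m a 1 * Function.update (1 : ∀ i : Fin P.length,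
      GL (Fin (P.blocksFun i)) (AdeleRing (𝓞 F) F)) a (m a) := by
    funext b
    rw [Pi.mul_apply]
    by_cases hb : b = a
    · subst hb
      rw [Function.update_self, Function.update_self, one_mul]
    · rw [Function.update_of_ne hb, Function.update_of_ne hb, Pi.one_apply, mul_one]
  have h2 := minor_levi_of_eq_one (R := AdeleRing (𝓞 F) F) ha
    (m := Function.update m a 1) (Function.update_self ..) hk
  have h3 := logVol_levi_of_eq_one_mul ha
    (m := Function.update (1 : ∀ i : Fin P.length, GL (Fin (P.blocksFun i)) (AdeleRing (𝓞 F) F))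
      a (m a)) (fun i hi => Function.update_of_ne hi _ _) hu hk
  rw [Function.update_self] at h3
  conv_lhs => rw [h1, map_mul, mul_assoc, logVol_mul h2.1, h2.2, h3]

/-- Extending a basis `δ` of `F ^ n₁` by the identity in the other blocks sends a subspace to its
preimage under the projection to the first block. Heights then change by a constant that cancels in
the comparison with `⊤`. -/
theorem height_top_le_of_height_top_le (ha : (a : ℕ) = 0)
    (m : ∀ i : Fin P.length, GL (Fin (P.blocksFun i)) (AdeleRing (𝓞 F) F))
    {u : GL (Fin n) (AdeleRing (𝓞 F) F)} (hu : u ∈ unipotentRadical P (AdeleRing (𝓞 F) F))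
    (h : ∀ Y, height (levi P (AdeleRing (𝓞 F) F) m * u) ⊤ ≤
      height (levi P (AdeleRing (𝓞 F) F) m * u) Y)
    (Y : Submodule F (Fin (P.blocksFun a) → F)) : height (m a) ⊤ ≤ height (m a) Y := by
  obtain ⟨δ, hδ⟩ := exists_flag_eq Y
  let Δ : GL (Fin n) F := levi P F (Function.update 1 a δ)
  have hle : P.blocksFun a ≤ n := P.blocksFun_le a
  have key : ∀ k ≤ P.blocksFun a, height (levi P (AdeleRing (𝓞 F) F) m * u) (flag Δ k) =
      logAbs (levi P (AdeleRing (𝓞 F) F) (Function.update m a 1)).val.det +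
        height (m a) (flag δ k) := by
    intro k hk
    have h1 : toAdelic F n Δ * (levi P (AdeleRing (𝓞 F) F) m * u) =
        levi P (AdeleRing (𝓞 F) F) (Function.update m a (toAdelic F _ δ * m a)) * u := by
      rw [← mul_assoc, toAdelic, map_levi, ← map_mul]
      congr 2
      funext b
      rw [Pi.mul_apply]
      by_cases hb : b = a
      · subst hb
        rw [Function.update_self, Function.update_self]
        rfl
      · rw [Function.update_of_ne hb, Function.update_of_ne hb, Pi.one_apply, map_one, one_mul]
    rw [height_flag _ _ (hk.trans hle), height_flag _ _ hk, h1, logVol_levi_mul_of_le ha _ hu hk,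
      Function.update_self, Function.update_idem]
  have h1 := key _ (Nat.sub_le _ (Module.finrank F Y))
  have h2 := key 0 (Nat.zero_le _)
  have h3 := h (flag Δ (P.blocksFun a - Module.finrank F Y))
  rw [hδ] at h1
  rw [flag_zero, flag_zero] at h2
  linarith

end FirstBlock

end Truncation

end

/-- All truncation functions are at most one, so in each inequality it suffices that the right side
is at least one when the left side is nonzero. -/
theorem mainTheorem10 (F : Type*) [Field F] [NumberField F] (n : ℕ) (hn : 0 < n)
    (P : Composition n)
    (p : GL (Fin n) (NumberField.AdeleRing (NumberField.RingOfIntegers F) F))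
    (hp : p ∈ Truncation.parabolic P (NumberField.AdeleRing (NumberField.RingOfIntegers F) F))
    (m : ∀ i : Fin P.length,
      GL (Fin (P.blocksFun i)) (NumberField.AdeleRing (NumberField.RingOfIntegers F) F))
    (u : GL (Fin n) (NumberField.AdeleRing (NumberField.RingOfIntegers F) F))
    (hu : u ∈ Truncation.unipotentRadical P
      (NumberField.AdeleRing (NumberField.RingOfIntegers F) F))
    (hpmu : p = Truncation.levi P
      (NumberField.AdeleRing (NumberField.RingOfIntegers F) F) m * u) :
    Truncation.truncation P p ≤ Truncation.truncationGL hn p ∧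
      Truncation.truncationGL hn p ≤
        Truncation.truncationGL (P.one_le_blocksFun ⟨0, P.length_pos_iff.2 hn⟩)
          (m ⟨0, P.length_pos_iff.2 hn⟩) := by
  constructor
  · rcases eq_or_ne (Truncation.truncation P p) 0 with h | h
    · exact h ▸ zero_le
    · exact (Truncation.truncation_le_one P p).trans (Truncation.one_le_truncationGL hn
        (Truncation.height_top_le_of_truncation_ne_zero h))
  · rcases eq_or_ne (Truncation.truncationGL hn p) 0 with h | h
    · exact h ▸ zero_le
    · refine (Truncation.truncation_le_one _ p).trans (Truncation.one_le_truncationGL _ ?_)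
      have h1 := Truncation.height_top_le_of_truncation_ne_zero h
      rw [hpmu] at h1
      exact Truncation.height_top_le_of_height_top_le rfl m hu h1
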